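/- Let $n\ge 0$ and $m$ be integers and let $A=\mathbb{Z}[x]/(x^{n+1})$, graded by $|x|=2m$. Put $\overline{A}=A/\mathbb{Z}\cdot 1$ and let $HH^*(A;A)=\bigoplus_{p\ge 0}HH^p(A;A)$ be the cohomology of the normalized Hochschild cochain complex $\bigoplus_{p}\mathrm{Hom}_{\mathbb{Z}}((s\overline{A})^{\otimes p},A)$, with the cup product. A cochain $(s\overline A)^{\otimes p}\to A$ that maps $A_{i_1}\otimes\cdots\otimes A_{i_p}$ to $A_{i_1+\cdots+i_p+d}$ is given the total degree $-(d+p)$. For a cochain $f$ of $p+1$ arguments put $$(\Delta f)(a_1,\dots,a_p)=(-1)^{p+1}\sum_{j=0}^{n}\sum_{i=0}^{p}(-1)^{i(p+1-i)}\langle 1,f(a_i,\dots,a_p,a_0,a_1,\dots,a_{i-1})\rangle\,x^{n-j},\qquad a_0=x^j$$ (for $i=0$ the argument of $f$ is $(a_0,a_1,\dots,a_p)$), where $\langle a,b\rangle$ is the coefficient of $x^n$ in $ab$, and let $\Delta f=0$ for cochains of no arguments. This is the operator dual to Connes' boundary operator under the Poincaré duality of $A$; all elements of $A$ have even degree, and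 the signs are the resulting Koszul signs. Then $\Delta$ induces an operator on $HH^*(A;A)$ that makes it a Batalin-Vilkovisky algebra, that is, a graded commutative ring with an operator $\Delta$ of degree $+1$ such that $\Delta^2=0$ and $$\Delta(abc)=\Delta(ab)c+(-1)^{|a|}a\Delta(bc)+(-1)^{(|a|-1)|b|}b\Delta(ac)-\Delta(a)bc-(-1)^{|a|}a\Delta(b)c-(-1)^{|a|+|b|}ab\Delta(c),$$ and as a Batalin-Vilkovisky algebra $$HH^*(A;A)=\mathbb{Z}[x,u,t]/(x^{n+1},\,u^2,\,(n+1)x^nt,\,ux^n),$$ with $|x|=-2m$, $|u|=-1$, $|t|=2mn+2(m-1)$, and, for all $k,l\ge 0$, $$\Delta(t^kx^l)=0,\qquad \Delta(t^kux^l)=(-(k+1)n-k+l)\,t^kx^l.$$ Here $x\in HH^0$, $u\in HH^1$, $t\in HH^2$ are the classes of the cocycles $\bar x=x\in A$, $\bar u(x^i)=ix^i$ and $\bar t(x^i,x^j)=x^{i+j-(n+1)}$ (read as $0$ if $i+j<n+1$), for $0\le i,j\le n$. -/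

import Mathlib

/-! ### The Hochschild cochain algebra of a ring, over `ℤ`

A linear map `T(sĀ) → A` is the same thing as a family of multiadditive maps, one for every number
of arguments, that vanish as soon as one argument is `1`.  Such a family is encoded as a function
that takes the word `[a₁, …, a_p]` of its arguments to a value in `A`. -/

namespace Hochschild

/-- Functions from words in `A` to `A`, multiplied by the cup product
`(f ∪ g)(a₁, …, a_p) = ∑ᵢ f(a₁, …, aᵢ) g(aᵢ₊₁, …, a_p)`. -/
structure WordFun (A : Type*) where
  /-- The value on a word. -/
  eval : List A → A

namespace WordFun

instance {A : Type*} : CoeFun (WordFun A) (fun _ => List A → A) := ⟨eval⟩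

@[ext] theorem ext {A : Type*} {f g : WordFun A} (h : ∀ l, f l = g l) : f = g := by
  cases f; cases g; congr; exact funext h

variable {A : Type*} [Ring A]

/-! Addition is pointwise. -/

instance : Zero (WordFun A) := ⟨⟨fun _ => 0⟩⟩
instance : Add (WordFun A) := ⟨fun f g => ⟨fun l => f l + g l⟩⟩
instance : Neg (WordFun A) := ⟨fun f => ⟨fun l => -f l⟩⟩
instance : Sub (WordFun A) := ⟨fun f g => ⟨fun l => f l - g l⟩⟩
instance : SMul ℕ (WordFun A) := ⟨fun n f => ⟨fun l => n • f l⟩⟩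
instance : SMul ℤ (WordFun A) := ⟨fun n f => ⟨fun l => n • f l⟩⟩

instance : AddCommGroup (WordFun A) :=
  Function.Injective.addCommGroup (fun f : WordFun A => f.eval)
    (fun _ _ h => ext fun l => congrFun h l) rfl (fun _ _ => rfl) (fun _ => rfl)
    (fun _ _ => rfl) (fun _ _ => rfl) (fun _ _ => rfl)

/-- The cup product. -/
def cup (f g : WordFun A) : WordFun A :=
  ⟨fun l => ∑ i ∈ Finset.range (l.length + 1), f (l.take i) * g (l.drop i)⟩

instance : Mul (WordFun A) := ⟨cup⟩

/-- The unit of the cup product: the element `1 ∈ A`, as a function of no arguments. -/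
instance : One (WordFun A) := ⟨⟨fun l => if l = [] then 1 else 0⟩⟩

theorem word_add (f g : WordFun A) (l : List A) : (f + g) l = f l + g l := rfl
theorem word_sub (f g : WordFun A) (l : List A) : (f - g) l = f l - g l := rfl
theorem word_neg (f : WordFun A) (l : List A) : (-f) l = -f l := rfl
theorem word_zero (l : List A) : (0 : WordFun A) l = 0 := rfl

theorem word_mul (f g : WordFun A) (l : List A) :
    (f * g) l = ∑ i ∈ Finset.range (l.length + 1), f (l.take i) * g (l.drop i) := rfl

theorem one_nil : (1 : WordFun A) [] = 1 := rfl
theorem one_cons (a : A) (l : List A) : (1 : WordFun A) (a :: l) = 0 := rfl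

/-- Fix the first argument. -/
def shift {A : Type*} (a : A) (f : WordFun A) : WordFun A := ⟨fun l => f (a :: l)⟩

theorem shift_apply {A : Type*} (a : A) (f : WordFun A) (l : List A) :
    shift a f l = f (a :: l) := rfl

theorem mul_nil (f g : WordFun A) : (f * g) [] = f [] * g [] := by
  simp [word_mul]

theorem mul_cons (f g : WordFun A) (a : A) (l : List A) :
    (f * g) (a :: l) = f [] * g (a :: l) + (shift a f * g) l := by
  simp only [word_mul, List.length_cons, shift_apply]
  rw [Finset.sum_range_succ', add_comm]
  simp

protected theorem zero_mul' (f : WordFun A) : (0 : WordFun A) * f = 0 := by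
  ext l; simp [word_mul, word_zero]
protected theorem mul_zero' (f : WordFun A) : f * (0 : WordFun A) = 0 := by
  ext l; simp [word_mul, word_zero]
protected theorem add_mul' (f g h : WordFun A) : (f + g) * h = f * h + g * h := by
  ext l; simp [word_mul, word_add, add_mul, Finset.sum_add_distrib]
protected theorem mul_add' (f g h : WordFun A) : f * (g + h) = f * g + f * h := by
  ext l; simp [word_mul, word_add, mul_add, Finset.sum_add_distrib]
protected theorem one_mul' (f : WordFun A) : 1 * f = f := by
  ext l
  cases l with
  | nil => simp [mul_nil, one_nil]
  | cons a l =>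
    have : shift a (1 : WordFun A) = 0 := rfl
    rw [mul_cons, this, WordFun.zero_mul', one_nil, word_zero]; simp
protected theorem mul_one' (f : WordFun A) : f * 1 = f := by
  ext l
  induction l generalizing f with
  | nil => simp [mul_nil, one_nil]
  | cons a l ih => rw [mul_cons, ih, one_cons, shift_apply]; simp

theorem shift_mul (a : A) (f g : WordFun A) :
    shift a (f * g) = (⟨fun l => f [] * g (a :: l)⟩ : WordFun A) + shift a f * g := by
  ext l; exact mul_cons f g a l

theorem smul_left_mul (c : A) (f g : WordFun A) (l : List A) :
    ((⟨fun w => c * f w⟩ : WordFun A) * g) l = c * (f * g) l := by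
  simp [word_mul, Finset.mul_sum, mul_assoc]

protected theorem mul_assoc' (f g h : WordFun A) : f * g * h = f * (g * h) := by
  ext l
  induction l generalizing f with
  | nil => simp [mul_nil, mul_assoc]
  | cons a l ih =>
    have key : ((⟨fun w => f [] * g (a :: w)⟩ : WordFun A) * h) l = f [] * (shift a g * h) l :=
      smul_left_mul (f []) (shift a g) h l
    rw [mul_cons, mul_cons, shift_mul, WordFun.add_mul', word_add, ih, key, mul_nil, mul_cons,
      mul_add, mul_assoc, add_assoc]

instance : Ring (WordFun A) :=
  { (inferInstance : AddCommGroup (WordFun A)) with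
    mul := (· * ·)
    one := 1
    zero_mul := WordFun.zero_mul'
    mul_zero := WordFun.mul_zero'
    left_distrib := WordFun.mul_add'
    right_distrib := WordFun.add_mul'
    mul_assoc := WordFun.mul_assoc'
    one_mul := WordFun.one_mul'
    mul_one := WordFun.mul_one' }

end WordFun

open WordFun

/-! ### The Hochschild differential -/

section Differential

variable {A : Type*} [Ring A]

/-- Replace the neighbours `aᵢ, aᵢ₊₁` (counted from `0`) of a word by their product. -/
def mergeAt : ℕ → List A → List A
  | 0, a :: b :: l => (a * b) :: l
  | i + 1, a :: l => a :: mergeAt i l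
  | _, l => l

/-- The inner part `∑ᵢ (-1)^i f(a₁, …, aᵢ aᵢ₊₁, …, a_{p+1})` of the Hochschild differential. -/
def mid (f : WordFun A) : WordFun A :=
  ⟨fun l => ∑ i ∈ Finset.range (l.length - 1), (-1) ^ (i + 1) * f (mergeAt i l)⟩

/-- The Hochschild differential:
`(β f)(a₁, …, a_{p+1}) = a₁ f(a₂, …, a_{p+1}) + ∑ᵢ (-1)^i f(a₁, …, aᵢ aᵢ₊₁, …, a_{p+1})
  + (-1)^{p+1} f(a₁, …, a_p) a_{p+1}`. -/
def differential (f : WordFun A) : WordFun A where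
  eval
    | [] => 0
    | a :: l => a * f l + mid f (a :: l)
        + (-1) ^ (l.length + 1) * f ((a :: l).dropLast) * (a :: l).getLast (List.cons_ne_nil a l)

/-- The sign `(-1)^p` on functions of `p` arguments. -/
def sgn (f : WordFun A) : WordFun A := ⟨fun l => (-1) ^ l.length * f l⟩

/-- The function of one argument `a ↦ a`. -/
def iota : WordFun A where
  eval
    | [a] => a
    | _ => 0

theorem length_mergeAt (i : ℕ) (l : List A) (h : i + 1 < l.length) :
    (mergeAt i l).length + 1 = l.length := by
  induction i generalizing l with
  | zero =>
    rcases l with _ | ⟨a, _ | ⟨b, l⟩⟩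
    · simp at h
    · simp at h
    · simp [mergeAt]
  | succ i ih =>
    cases l with
    | nil => simp at h
    | cons a l =>
      have := ih l (by simpa using h)
      simp [mergeAt, this]

theorem mid_nil (f : WordFun A) : mid f [] = 0 := by simp [mid]
theorem mid_one (f : WordFun A) (a : A) : mid f [a] = 0 := by simp [mid]
theorem mid_cons (f : WordFun A) (a b : A) (l : List A) :
    mid f (a :: b :: l) = -f (a * b :: l) - mid (shift a f) (b :: l) := by
  simp only [mid, List.length_cons, Nat.add_sub_cancel]
  rw [Finset.sum_range_succ', add_comm, sub_eq_add_neg, ← Finset.sum_neg_distrib]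
  simp [mergeAt, shift_apply, pow_succ]

theorem mid_zero : mid (0 : WordFun A) = 0 := by ext l; simp [mid, word_zero]
theorem mid_add (f g : WordFun A) : mid (f + g) = mid f + mid g := by
  ext l; simp [mid, word_add, mul_add, Finset.sum_add_distrib]
theorem mid_neg (f : WordFun A) : mid (-f) = -mid f := by
  ext l; simp [mid, word_neg]
theorem mid_sub (f g : WordFun A) : mid (f - g) = mid f - mid g := by
  rw [sub_eq_add_neg, mid_add, mid_neg, ← sub_eq_add_neg]
theorem mid_smul (c : A) (f : WordFun A) (l : List A) :
    mid (⟨fun w => c * f w⟩ : WordFun A) l = c * mid f l := by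
  simp only [mid, Finset.mul_sum]
  refine Finset.sum_congr rfl fun i _ => ?_
  rw [← mul_assoc, ← mul_assoc, ((Commute.neg_one_left c).pow_left (i + 1)).eq]

theorem sgn_nil (f : WordFun A) : sgn f [] = f [] := by simp [sgn]
theorem shift_sgn (a : A) (f : WordFun A) : shift a (sgn f) = -sgn (shift a f) := by
  ext l; simp [shift, sgn, word_neg, pow_succ]
theorem sgn_sgn (f : WordFun A) : sgn (sgn f) = f := by
  ext l; simp only [sgn]; rw [← mul_assoc, ← pow_add, Even.neg_one_pow ⟨_, rfl⟩, one_mul]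
theorem sgn_neg (f : WordFun A) : sgn (-f) = -sgn f := by ext l; simp [sgn, word_neg]
theorem sgn_add (f g : WordFun A) : sgn (f + g) = sgn f + sgn g := by
  ext l; simp [sgn, word_add, mul_add]
theorem sgn_sub (f g : WordFun A) : sgn (f - g) = sgn f - sgn g := by
  rw [sub_eq_add_neg, sgn_add, sgn_neg, ← sub_eq_add_neg]

theorem sgn_mul (f g : WordFun A) : sgn (f * g) = sgn f * sgn g := by
  ext l
  simp only [sgn, word_mul, Finset.mul_sum]
  refine Finset.sum_congr rfl fun i hi => ?_
  have h : l.length = (l.take i).length + (l.drop i).length := by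
    rw [← List.length_append, List.take_append_drop]
  rw [h, pow_add, mul_assoc, mul_assoc, ← mul_assoc ((-1) ^ (l.drop i).length),
    ((Commute.neg_one_left (f (l.take i))).pow_left _).eq, mul_assoc]

theorem sgn_iota : sgn (iota : WordFun A) = -iota := by
  ext l
  rcases l with _ | ⟨a, _ | ⟨b, l⟩⟩ <;> simp [sgn, iota, word_neg]

theorem sgn_mid (f : WordFun A) : sgn (mid f) = -mid (sgn f) := by
  ext l
  induction l generalizing f with
  | nil => simp [sgn_nil, mid_nil, word_neg]
  | cons a l ih =>
    cases l with
    | nil => simp [sgn, mid_one, word_neg]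
    | cons b l =>
      have h := ih (shift a f)
      rw [word_neg, mid_cons, shift_sgn, mid_neg, word_neg, ← word_neg, ← word_neg] at *
      simp only [word_neg] at *
      rw [← h]
      simp only [sgn, mid_cons, List.length_cons, pow_succ]
      noncomm_ring

theorem mid_iota : mid (iota : WordFun A) = -(iota * iota) := by
  ext l
  rcases l with _ | ⟨a, _ | ⟨b, _ | ⟨c, l⟩⟩⟩
  · simp [mid_nil, mul_nil, word_neg, iota]
  · simp [mid_one, mul_cons, mul_nil, word_neg, iota, shift_apply]
  · have h : shift b (shift a (iota : WordFun A)) = 0 := by ext w; rfl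
    simp [mid_cons, mid_one, mul_cons, mul_nil, word_neg, iota, shift_apply]
  · have h0 : shift b (shift a (iota : WordFun A)) = 0 := by ext w; rfl
    have h1 : shift c (0 : WordFun A) = 0 := rfl
    rw [mid_cons, mid_cons, h0, mid_zero, word_neg, mul_cons, mul_cons, h0, zero_mul]
    simp [iota, shift_apply, word_zero]

/-- The inner part of the differential is a graded derivation of the cup product. -/
theorem mid_mul (f g : WordFun A) : mid (f * g) = mid f * g + sgn f * mid g := by
  ext l
  rw [word_add]
  induction l generalizing f with
  | nil => simp [mid_nil, mul_nil]
  | cons a l ih =>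
    cases l with
    | nil => simp [mid_one, mid_nil, mul_cons, mul_nil, shift_apply]
    | cons b l =>
      have h1 : mid (⟨fun w => f [] * g (a :: w)⟩ : WordFun A) (b :: l)
          = f [] * mid (shift a g) (b :: l) := mid_smul (f []) (shift a g) (b :: l)
      have h2 : (shift a (mid f) * g) (b :: l)
          = -(shift (a * b) f * g) l - (mid (shift a f) * g) (b :: l) := by
        have e : shift b (shift a (mid f))
            = -shift (a * b) f - shift b (mid (shift a f)) := by
          ext w; exact mid_cons f a b w
        rw [mul_cons, mul_cons (mid (shift a f)), e, sub_mul, word_sub, neg_mul, word_neg,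
          shift_apply, mid_one, mid_nil]
        simp
      rw [mid_cons, shift_mul, mid_add, word_add, h1, ih, mul_cons (mid f), h2, mid_nil,
        mul_cons (sgn f), shift_sgn, neg_mul, word_neg, sgn_nil, mul_cons, mid_cons g]
      noncomm_ring

theorem mid_mid (f : WordFun A) : mid (mid f) = 0 := by
  ext l
  rw [word_zero]
  induction l generalizing f with
  | nil => simp [mid_nil]
  | cons a l ih =>
    rcases l with _ | ⟨b, _ | ⟨c, l⟩⟩
    · simp [mid_one]
    · simp [mid_cons, mid_one]
    · have e : shift b (shift a (mid f)) = -shift (a * b) f - shift b (mid (shift a f)) := by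
        ext w; exact mid_cons f a b w
      have h := ih (shift a f)
      rw [mid_cons] at h
      rw [mid_cons, mid_cons (shift a (mid f)), e, mid_sub, word_sub, mid_neg, word_neg,
        shift_apply, mid_cons, mid_cons f, mul_assoc]
      have h' : mid (shift b (mid (shift a f))) (c :: l)
          = -mid (shift a f) (b * c :: l) := by
        rw [eq_comm, ← sub_eq_zero]; exact h
      rw [h']
      noncomm_ring

theorem iota_mul_cons (f : WordFun A) (a : A) (l : List A) : ((iota : WordFun A) * f) (a :: l) = a * f l := by
  have h : shift a (iota : WordFun A) = (⟨fun w => a * (1 : WordFun A) w⟩ : WordFun A) := by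
    ext w; cases w <;> simp [shift_apply, iota, one_nil, one_cons]
  rw [mul_cons, h, smul_left_mul, one_mul]; simp [iota]

theorem mul_iota_apply (f : WordFun A) (l : List A) (hl : l ≠ []) :
    (f * (iota : WordFun A)) l = f l.dropLast * l.getLast hl := by
  induction l generalizing f with
  | nil => exact absurd rfl hl
  | cons a l ih =>
    cases l with
    | nil => simp [mul_cons, mul_nil, iota]
    | cons b l => rw [mul_cons, ih _ (List.cons_ne_nil b l)]; simp [iota, shift_apply]

theorem differential_eq (f : WordFun A) :
    differential f = iota * f - sgn f * iota + mid f := by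
  ext l
  rw [word_add, word_sub]
  cases l with
  | nil => simp [differential, mul_nil, mid_nil, iota]
  | cons a l =>
    rw [iota_mul_cons, mul_iota_apply _ _ (List.cons_ne_nil a l)]
    simp only [differential, sgn, List.length_dropLast, List.length_cons, Nat.add_sub_cancel,
      pow_succ]
    noncomm_ring

theorem differential_add (f g : WordFun A) :
    differential (f + g) = differential f + differential g := by
  simp only [differential_eq, sgn_add, mid_add]; noncomm_ring

theorem differential_neg (f : WordFun A) : differential (-f) = -differential f := by
  simp only [differential_eq, sgn_neg, mid_neg]; noncomm_ring

theorem differential_zero : differential (0 : WordFun A) = 0 := by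
  have := differential_add (0 : WordFun A) 0
  simpa using this

theorem differential_mul (f g : WordFun A) :
    differential (f * g) = differential f * g + sgn f * differential g := by
  simp only [differential_eq, sgn_mul, mid_mul]; noncomm_ring

theorem differential_sgn (f : WordFun A) : differential (sgn f) = -sgn (differential f) := by
  simp only [differential_eq, sgn_add, sgn_sub, sgn_mul, sgn_mid, sgn_sgn, sgn_iota]
  noncomm_ring

theorem differential_differential (f : WordFun A) : differential (differential f) = 0 := by
  rw [differential_eq (differential f)]
  have h : sgn (differential f) = -differential (sgn f) := by rw [differential_sgn, neg_neg]
  rw [h]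
  simp only [differential_eq, mid_add, mid_sub, mid_mul, mid_mid, mid_iota, sgn_sgn, sgn_iota]
  noncomm_ring

theorem differential_one : differential (1 : WordFun A) = 0 := by
  have := differential_mul (1 : WordFun A) 1
  have h : sgn (1 : WordFun A) = 1 := by
    ext l; cases l <;> simp [sgn, one_nil, one_cons]
  simpa [h] using this

theorem differential_cons_cons (f : WordFun A) (a b : A) (l : List A) :
    differential f (a :: b :: l)
      = a * f (b :: l) - f (a * b :: l) + b * f (a :: l) - differential (shift a f) (b :: l) := by
  simp only [differential, mid_cons, shift_apply, List.length_cons, List.dropLast_cons_cons,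
    List.getLast_cons_cons, pow_succ]
  noncomm_ring

end Differential

/-! ### Normalized cochains and Hochschild cohomology -/

section Cohomology

variable {A : Type*} [Ring A]

/-- The elements of `⨁_p Hom((sĀ)^{⊗ p}, A)` with `Ā = A / ℤ·1`: functions of words that are
additive in every argument, vanish if an argument is `1`, and vanish on all words that are long
enough. -/
structure IsCochain (f : WordFun A) : Prop where
  map_add : ∀ (l r : List A) (a b : A), f (l ++ (a + b) :: r) = f (l ++ a :: r) + f (l ++ b :: r)
  map_one : ∀ l r : List A, f (l ++ 1 :: r) = 0
  bounded : ∃ N : ℕ, ∀ l : List A, N < l.length → f l = 0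

/-- Additivity in every argument. -/
def IsMulti (f : WordFun A) : Prop :=
  ∀ (l r : List A) (a b : A), f (l ++ (a + b) :: r) = f (l ++ a :: r) + f (l ++ b :: r)

/-- Vanishing if an argument is `1`. -/
def IsNormal (f : WordFun A) : Prop := ∀ l r : List A, f (l ++ 1 :: r) = 0

/-- Vanishing on long words. -/
def IsBdd (f : WordFun A) : Prop := ∃ N : ℕ, ∀ l : List A, N < l.length → f l = 0

theorem IsMulti.shift {f : WordFun A} (hf : IsMulti f) (c : A) : IsMulti (shift c f) :=
  fun l r a b => hf (c :: l) r a b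

theorem IsNormal.shift {f : WordFun A} (hf : IsNormal f) (c : A) : IsNormal (shift c f) :=
  fun l r => hf (c :: l) r

theorem IsMulti.shift_add {f : WordFun A} (hf : IsMulti f) (a b : A) :
    WordFun.shift (a + b) f = WordFun.shift a f + WordFun.shift b f := by
  ext l; exact hf [] l a b

theorem IsNormal.shift_one {f : WordFun A} (hf : IsNormal f) : WordFun.shift 1 f = 0 := by
  ext l; exact hf [] l

theorem IsMulti.mul {f g : WordFun A} (hf : IsMulti f) (hg : IsMulti g) : IsMulti (f * g) := by
  intro l r a b
  induction l generalizing f with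
  | nil =>
    have h := hg [] r a b
    simp only [List.nil_append] at h ⊢
    rw [mul_cons, mul_cons, mul_cons, hf.shift_add, add_mul, word_add, h, mul_add]
    abel
  | cons c l ih =>
    have h := hg (c :: l) r a b
    simp only [List.cons_append] at h ⊢
    rw [mul_cons, mul_cons, mul_cons, ih (hf.shift c), h, mul_add]
    abel

theorem IsNormal.mul {f g : WordFun A} (hf : IsNormal f) (hg : IsNormal g) :
    IsNormal (f * g) := by
  intro l r
  induction l generalizing f with
  | nil =>
    have h := hg [] r
    simp only [List.nil_append] at h ⊢
    rw [mul_cons, hf.shift_one, zero_mul, h, word_zero]; simp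
  | cons c l ih =>
    have h := hg (c :: l) r
    simp only [List.cons_append] at h ⊢
    rw [mul_cons, ih (hf.shift c), h]; simp

theorem IsBdd.mul {f g : WordFun A} (hf : IsBdd f) (hg : IsBdd g) : IsBdd (f * g) := by
  obtain ⟨M, hM⟩ := hf
  obtain ⟨N, hN⟩ := hg
  refine ⟨M + N, fun l hl => ?_⟩
  rw [word_mul]
  refine Finset.sum_eq_zero fun i hi => ?_
  rw [Finset.mem_range] at hi
  by_cases h : M < i
  · rw [hM _ (by simp; omega), zero_mul]
  · rw [hN _ (by simp; omega), mul_zero]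

theorem IsMulti.mid {f : WordFun A} (hf : IsMulti f) : IsMulti (mid f) := by
  intro l r a b
  induction l generalizing f with
  | nil =>
    cases r with
    | nil => simp [mid_one]
    | cons c r =>
      have h := hf [] r (a * c) (b * c)
      simp only [List.nil_append] at h ⊢
      rw [mid_cons, mid_cons, mid_cons, hf.shift_add, mid_add, word_add, add_mul, h]
      abel
  | cons c l ih =>
    have h1 := ih (hf.shift c)
    cases l with
    | nil =>
      have h := hf [] r (c * a) (c * b)
      simp only [List.nil_append, List.cons_append] at h h1 ⊢
      rw [mid_cons, mid_cons, mid_cons, h1, mul_add, h]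
      abel
    | cons d l =>
      have h := hf (c * d :: l) r a b
      simp only [List.cons_append] at h h1 ⊢
      rw [mid_cons, mid_cons, mid_cons, h1, h]
      abel

theorem IsMulti.sgn {f : WordFun A} (hf : IsMulti f) : IsMulti (sgn f) := by
  intro l r a b
  simp [Hochschild.sgn, hf l r a b, mul_add]

theorem IsNormal.sgn {f : WordFun A} (hf : IsNormal f) : IsNormal (sgn f) := by
  intro l r
  simp [Hochschild.sgn, hf l r]

theorem isMulti_iota : IsMulti (iota : WordFun A) := by
  intro l r a b
  rcases l with _ | ⟨c, l⟩
  · cases r <;> simp [iota]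
  · cases l <;> simp [iota]

theorem IsMulti.differential {f : WordFun A} (hf : IsMulti f) : IsMulti (differential f) := by
  intro l r a b
  have h1 := (isMulti_iota.mul hf) l r a b
  have h2 := (hf.sgn.mul isMulti_iota) l r a b
  have h3 := hf.mid l r a b
  simp only [differential_eq, word_add, word_sub, h1, h2, h3]
  abel

theorem IsNormal.differential {f : WordFun A} (hf : IsNormal f) : IsNormal (differential f) := by
  intro l r
  induction l generalizing f with
  | nil =>
    cases r with
    | nil => simp [Hochschild.differential, mid_one]
    | cons b r =>
      have h := hf [] r
      simp only [List.nil_append] at h ⊢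
      rw [differential_cons_cons, hf.shift_one, differential_zero, h, word_zero]
      simp
  | cons a l ih =>
    have h1 := ih (hf.shift a)
    cases l with
    | nil =>
      have h := hf [] r
      simp only [List.nil_append, List.cons_append] at h h1 ⊢
      rw [differential_cons_cons, h1, h]
      simp
    | cons b l =>
      have h := hf (b :: l) r
      have h' := hf (a :: l) r
      have h'' := hf (a * b :: l) r
      simp only [List.cons_append] at h h' h'' h1 ⊢
      rw [differential_cons_cons, h1, h, h', h'']
      simp

theorem IsCochain.mul {f g : WordFun A} (hf : IsCochain f) (hg : IsCochain g) :
    IsCochain (f * g) :=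
  ⟨IsMulti.mul hf.map_add hg.map_add, IsNormal.mul hf.map_one hg.map_one,
    IsBdd.mul hf.bounded hg.bounded⟩

theorem IsCochain.sgn {f : WordFun A} (hf : IsCochain f) : IsCochain (sgn f) := by
  refine ⟨IsMulti.sgn hf.map_add, IsNormal.sgn hf.map_one, ?_⟩
  obtain ⟨N, hN⟩ := hf.bounded
  exact ⟨N, fun l hl => by simp [Hochschild.sgn, hN l hl]⟩

theorem IsCochain.add {f g : WordFun A} (hf : IsCochain f) (hg : IsCochain g) :
    IsCochain (f + g) := by
  refine ⟨fun l r a b => ?_, fun l r => ?_, ?_⟩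
  · simp only [word_add, hf.map_add, hg.map_add]; abel
  · simp [word_add, hf.map_one, hg.map_one]
  · obtain ⟨M, hM⟩ := hf.bounded
    obtain ⟨N, hN⟩ := hg.bounded
    exact ⟨M + N, fun l hl => by
      rw [word_add, hM l (by omega), hN l (by omega), add_zero]⟩

theorem IsCochain.neg {f : WordFun A} (hf : IsCochain f) : IsCochain (-f) := by
  refine ⟨fun l r a b => ?_, fun l r => ?_, ?_⟩
  · simp only [word_neg, hf.map_add]; abel
  · simp [word_neg, hf.map_one]
  · obtain ⟨N, hN⟩ := hf.bounded
    exact ⟨N, fun l hl => by rw [word_neg, hN l hl, neg_zero]⟩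

theorem isCochain_zero : IsCochain (0 : WordFun A) :=
  ⟨fun _ _ _ _ => by simp [word_zero], fun _ _ => rfl, ⟨0, fun _ _ => rfl⟩⟩

theorem isCochain_one : IsCochain (1 : WordFun A) := by
  refine ⟨fun l r a b => ?_, fun l r => ?_, ⟨0, fun l hl => ?_⟩⟩
  · cases l <;> simp [one_cons]
  · cases l <;> simp [one_cons]
  · cases l
    · simp at hl
    · rfl

/-- The differential maps cochains to cochains. -/
theorem IsCochain.differential {f : WordFun A} (hf : IsCochain f) :
    IsCochain (differential f) := by
  refine ⟨IsMulti.differential hf.map_add, IsNormal.differential hf.map_one, ?_⟩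
  obtain ⟨N, hN⟩ := hf.bounded
  refine ⟨N + 1, fun l hl => ?_⟩
  cases l with
  | nil => rfl
  | cons a l =>
    simp only [List.length_cons] at hl
    have h : Hochschild.mid f (a :: l) = 0 := by
      simp only [Hochschild.mid]
      refine Finset.sum_eq_zero fun i hi => ?_
      rw [Finset.mem_range] at hi
      have hlen := length_mergeAt i (a :: l) (by omega)
      simp only [List.length_cons] at hlen
      rw [hN _ (by omega), mul_zero]
    simp only [Hochschild.differential]
    rw [h, hN l (by omega), hN _ (by simp; omega)]
    simp

variable (A) in
/-- The subring of cocycles. -/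
def cocycles : Subring (WordFun A) where
  carrier := {f | IsCochain f ∧ differential f = 0}
  mul_mem' := by
    rintro f g ⟨hf, hf'⟩ ⟨hg, hg'⟩
    exact ⟨hf.mul hg, by rw [differential_mul, hf', hg', zero_mul, mul_zero, add_zero]⟩
  one_mem' := ⟨isCochain_one, differential_one⟩
  add_mem' := by
    rintro f g ⟨hf, hf'⟩ ⟨hg, hg'⟩
    exact ⟨hf.add hg, by rw [differential_add, hf', hg', add_zero]⟩
  zero_mem' := ⟨isCochain_zero, differential_zero⟩
  neg_mem' := by
    rintro f ⟨hf, hf'⟩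
    exact ⟨hf.neg, by rw [differential_neg, hf', neg_zero]⟩

variable (A) in
/-- The ideal of coboundaries in the ring of cocycles. -/
def coboundaries : Ideal (cocycles A) where
  carrier := {z | ∃ g : WordFun A, IsCochain g ∧ differential g = z}
  add_mem' := by
    rintro _ _ ⟨g, hg, h⟩ ⟨g', hg', h'⟩
    exact ⟨g + g', hg.add hg', by rw [differential_add, h, h']; rfl⟩
  zero_mem' := ⟨0, isCochain_zero, differential_zero⟩
  smul_mem' := by
    rintro ⟨z, hz, hz'⟩ ⟨_, _⟩ ⟨g, hg, rfl⟩
    refine ⟨sgn z * g, hz.sgn.mul hg, ?_⟩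
    have h0 : sgn (0 : WordFun A) = 0 := by simpa using sgn_add (0 : WordFun A) 0
    have h : differential (sgn z * g) = z * differential g := by
      rw [differential_mul, differential_sgn, hz', sgn_sgn, h0, neg_zero, zero_mul, zero_add]
    exact h

instance : (coboundaries A).IsTwoSided where
  mul_mem_of_left := by
    rintro ⟨_, _⟩ ⟨z, hz, hz'⟩ ⟨g, hg, rfl⟩
    have h : differential (g * z) = differential g * z := by
      rw [differential_mul, hz', mul_zero, add_zero]
    exact ⟨g * z, hg.mul hz, h⟩

variable (A) in
/-- The Hochschild cohomology ring `HH^*(A; A) = ⨁_p HH^p(A; A)` of the ring `A` over `ℤ`. -/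
abbrev HH : Type _ := cocycles A ⧸ coboundaries A

variable (A) in
/-- The class of a cocycle in Hochschild cohomology. -/
def HH.mk : cocycles A →+* HH A := Ideal.Quotient.mk (coboundaries A)

/-- `f` has total degree `D` with respect to a (cohomological) grading `𝒜` of `A`: it maps
`sA_{i₁} ⊗ ⋯ ⊗ sA_{i_p}` to `A_{i₁ + ⋯ + i_p - p - D}`.  Degrees of cochains are written
homologically, so an element of `A_i = Hom(ℤ, A_i)` has degree `-i`, and the differential lowers
the degree by one. -/
def IsHomogeneous (𝒜 : ℤ → AddSubgroup A) (D : ℤ) (f : WordFun A) : Prop :=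
  ∀ w : List (ℤ × A), (∀ q ∈ w, q.2 ∈ 𝒜 q.1) →
    f (w.map Prod.snd) ∈ 𝒜 ((w.map Prod.fst).sum - w.length - D)

/-- The classes of total degree `D` in `HH^*(A; A)`, for a ring `A` graded by `𝒜`. -/
def HH.degree (𝒜 : ℤ → AddSubgroup A) (D : ℤ) : AddSubgroup (HH A) where
  carrier := {y | ∃ z : cocycles A, IsHomogeneous 𝒜 D (z : WordFun A) ∧ HH.mk A z = y}
  add_mem' := by
    rintro _ _ ⟨z, hz, rfl⟩ ⟨z', hz', rfl⟩
    exact ⟨z + z', fun w hw => (𝒜 _).add_mem (hz w hw) (hz' w hw), map_add _ _ _⟩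
  zero_mem' := ⟨0, fun w _ => (𝒜 _).zero_mem, map_zero _⟩
  neg_mem' := by
    rintro _ ⟨z, hz, rfl⟩
    exact ⟨-z, fun w hw => (𝒜 _).neg_mem (hz w hw), map_neg _ _⟩

/-- `Δ` is the operator on `HH^*(A; A)` induced by the operator `δ` on cochains: `δ` maps cocycles
to cocycles, and `Δ` maps the class of a cocycle `z` to the class of `δ z`. -/
def IsInducedBy (δ : WordFun A → WordFun A) (Δ : HH A →+ HH A) : Prop :=
  ∀ z : cocycles A, ∃ h : δ (z : WordFun A) ∈ cocycles A, Δ (HH.mk A z) = HH.mk A ⟨δ z, h⟩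

end Cohomology

end Hochschild

/-! ### Batalin-Vilkovisky algebras -/

/-- `H`, graded by `𝒢`, is a Batalin-Vilkovisky algebra (over `ℤ`) with operator `Δ`: a graded
commutative ring with an operator of degree one and square zero that satisfies the seven-term
relation. -/
structure IsBVAlgebra {H : Type*} [Ring H] (𝒢 : ℤ → AddSubgroup H) (Δ : H →+ H) : Prop where
  isInternal : DirectSum.IsInternal 𝒢
  one_mem : (1 : H) ∈ 𝒢 0
  mul_mem : ∀ (i j : ℤ) (a b : H), a ∈ 𝒢 i → b ∈ 𝒢 j → a * b ∈ 𝒢 (i + j)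
  graded_comm : ∀ (i j : ℤ) (a b : H), a ∈ 𝒢 i → b ∈ 𝒢 j →
    a * b = ((i * j).negOnePow : ℤ) • (b * a)
  map_degree : ∀ (i : ℤ) (a : H), a ∈ 𝒢 i → Δ a ∈ 𝒢 (i + 1)
  square_zero : ∀ a : H, Δ (Δ a) = 0
  seven_term : ∀ (i j : ℤ) (a b c : H), a ∈ 𝒢 i → b ∈ 𝒢 j →
    Δ (a * b * c) =
      Δ (a * b) * c + (i.negOnePow : ℤ) • (a * Δ (b * c))
        + (((i - 1) * j).negOnePow : ℤ) • (b * Δ (a * c))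
        - Δ a * b * c - (i.negOnePow : ℤ) • (a * Δ b * c)
        - ((i + j).negOnePow : ℤ) • (a * b * Δ c)

/-! ### The truncated polynomial ring -/

namespace TruncatedPolynomial

open Hochschild

/-- `ℤ[x]/(x^{n+1})`. -/
abbrev TruncPoly (n : ℕ) : Type := AdjoinRoot (Polynomial.X ^ (n + 1) : Polynomial ℤ)

/-- The generator `x` of `ℤ[x]/(x^{n+1})`. -/
noncomputable def gen (n : ℕ) : TruncPoly n := AdjoinRoot.root (Polynomial.X ^ (n + 1))

/-- The grading of `ℤ[x]/(x^{n+1})` with `|x| = 2m`. -/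
noncomputable def grading (m : ℤ) (n : ℕ) (i : ℤ) : AddSubgroup (TruncPoly n) :=
  AddSubgroup.closure {a | ∃ j : ℕ, 2 * m * j = i ∧ a = gen n ^ j}

/-- The coefficient of `x^n`.  The duality of `ℤ[x]/(x^{n+1})` is the pairing
`⟨a, b⟩ = topCoeff (a * b)`, for which `1, x, …, x^n` has the dual basis `x^n, …, x, 1`. -/
noncomputable def topCoeff (n : ℕ) (a : TruncPoly n) : ℤ :=
  (AdjoinRoot.modByMonicHom (Polynomial.monic_X_pow (n + 1)) a).coeff n

/-- The operator on Hochschild cochains of `ℤ[x]/(x^{n+1})` that is dual to Connes' boundary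
operator under the duality pairing:
`(Δ f)(a₁, …, a_p) = (-1)^{|f|} ∑ⱼ ∑ᵢ ± ⟨1, f(aᵢ, …, a_p, a₀, …, aᵢ₋₁)⟩ x^{n-j}` with `a₀ = x^j`,
`0 ≤ j ≤ n`, `0 ≤ i ≤ p`, for `f` of `p + 1` arguments.  All elements of the ring have even degree,
so every suspended element `sa` is odd, `|f|` has the parity of `p + 1`, and the Koszul sign of the
`i`-th rotation is `(-1)^{i (p + 1 - i)}`. -/
noncomputable def bvOperator (n : ℕ) (f : WordFun (TruncPoly n)) : WordFun (TruncPoly n) :=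
  ⟨fun l => (-1) ^ (l.length + 1) *
    ∑ j ∈ Finset.range (n + 1), ∑ i ∈ Finset.range (l.length + 1),
      ((-1) ^ (i * (l.length + 1 - i)) * topCoeff n (f ((gen n ^ j :: l).rotate i))) •
        gen n ^ (n - j)⟩

/-- `ℤ[x, u, t] / (x^{n+1}, u², (n+1) x^n t, u x^n)` with `x, u, t` the variables number
`0, 1, 2`.  It is also the quotient of the free graded commutative ring on `x, u, t`, since `u` is
the only generator of odd degree. -/
abbrev Model (n : ℕ) : Type :=
  MvPolynomial (Fin 3) ℤ ⧸ Ideal.span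
    ({MvPolynomial.X 0 ^ (n + 1), MvPolynomial.X 1 ^ 2,
      (n + 1 : MvPolynomial (Fin 3) ℤ) * MvPolynomial.X 0 ^ n * MvPolynomial.X 2,
      MvPolynomial.X 1 * MvPolynomial.X 0 ^ n} : Set (MvPolynomial (Fin 3) ℤ))

/-- The class of `x`. -/
noncomputable def Model.x (n : ℕ) : Model n := Ideal.Quotient.mk _ (MvPolynomial.X 0)

/-- The class of `u`. -/
noncomputable def Model.u (n : ℕ) : Model n := Ideal.Quotient.mk _ (MvPolynomial.X 1)

/-- The class of `t`. -/
noncomputable def Model.t (n : ℕ) : Model n := Ideal.Quotient.mk _ (MvPolynomial.X 2)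

/-- `f` is the cochain of no arguments with value `x`. -/
def IsXBar (n : ℕ) (f : WordFun (TruncPoly n)) : Prop :=
  f [] = gen n ∧ ∀ l : List (TruncPoly n), l.length ≠ 0 → f l = 0

/-- `f` is, among cochains, the one of one argument with `f(x^i) = i x^i`. -/
def IsUBar (n : ℕ) (f : WordFun (TruncPoly n)) : Prop :=
  (∀ i : ℕ, i ≤ n → f [gen n ^ i] = (i : ℤ) • gen n ^ i) ∧
    ∀ l : List (TruncPoly n), l.length ≠ 1 → f l = 0

/-- `f` is, among cochains, the one of two arguments with `f(x^i, x^j) = x^{i+j-(n+1)}` (which is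
`0` if the exponent is negative). -/
def IsTBar (n : ℕ) (f : WordFun (TruncPoly n)) : Prop :=
  (∀ i j : ℕ, i ≤ n → j ≤ n →
      f [gen n ^ i, gen n ^ j] = if n + 1 ≤ i + j then gen n ^ (i + j - (n + 1)) else 0) ∧
    ∀ l : List (TruncPoly n), l.length ≠ 2 → f l = 0

end TruncatedPolynomial

/-!
Hochschild cohomology of `A = ℤ[x]/(x^{n+1})` is computed from normalized cochains by an explicit
two-fold periodicity. For a cochain `f` put `(E f)(a₁, …) = ∑ᵢ x^{n-i} f(x, x^i, a₁, …)` (`reduce`).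
Then `E` commutes with the differential except on cochains of one argument, where the error is the
constant cochain `(n + 1) x^n f(x)` (`reduce_differential`), and `E (t̄ f) = f` (`reduce_tbar_mul`).
A homotopy `h` shows that every cocycle `f` is cohomologous to `t̄ E(f) + ū b + f()` with
`x b = f(x)` (`add_differential_homotopy`). By induction on the number of arguments, `x`, `u` and
`t` generate the cohomology ring, and the relations follow from the same formula. Conversely, every
element of the model can be written in Horner form `t P + u b + a` with `P` of the same kind and
`a, b ∈ A`. If it is mapped to the class of a coboundary, then the value on the empty word, the
value on the word `x`, and the cochain `E` show that `a = 0`, `u b = 0` and `t P = 0`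
(`modelHom_eq_zero`); so the model is isomorphic to the cohomology ring (`modelEquiv`).

Paired with an element of `A`, the cochain `Δ f` is a signed cyclic sum of values of `f`, and cyclic
sums intertwine the differential of the bar complex with that of the Hochschild complex
(`barDual_cyclicSum`). Hence `Δ` commutes with the differential (`bvOperator_differential`) and acts
on cohomology.

By periodicity the class of a cocycle of `2k` arguments is `t^k` times the value of `E^k` of it, so
`Δ (t^k u x^l)` is found by evaluating `E^k Δ(t̄^k ū x^l)`. This is a sum over the ways to cut a
word of `k` pairs `x, x^i` in two. The `k + 1` cuts between pairs contribute `(n - l) x^l` each, and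
the `k` cuts inside a pair contribute `(l + 1) x^l` each (`reduceFun_iterate_splitSum`,
`oddSplit_zero`, `oddSplit_one`), and `-(k + 1)(n - l) - k(l + 1) = -(k + 1) n - k + l`.
The class `Δ (t^k x^l)` vanishes for reasons of degree (`bvHom_even`).

In the model `Δ` is thus known on monomials, where `Δ² = 0` and the seven-term relation are verified
directly. The degree of monomials gives a direct sum decomposition because it is detected by a ring
homomorphism to Laurent polynomials (`weightHom`).
-/

/-! ### The ring `ℤ[x]/(x^{n+1})` -/

namespace TruncatedPolynomial

open Hochschild Hochschild.WordFun

/-- The coefficient of `x^i`. -/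
noncomputable def coord (n i : ℕ) : TruncPoly n →+ ℤ :=
  (Polynomial.lcoeff ℤ i).toAddMonoidHom.comp
    (AdjoinRoot.modByMonicHom (Polynomial.monic_X_pow (n + 1))).toAddMonoidHom

theorem topCoeff_eq_coord (n : ℕ) (a : TruncPoly n) : topCoeff n a = coord n n a := rfl

theorem gen_pow_eq_mk (n j : ℕ) :
    gen n ^ j = AdjoinRoot.mk (Polynomial.X ^ (n + 1) : Polynomial ℤ) (Polynomial.X ^ j) := by
  rw [map_pow, AdjoinRoot.mk_X]; rfl

theorem gen_pow_eq_zero {n j : ℕ} (h : n + 1 ≤ j) : gen n ^ j = 0 := by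
  rw [gen_pow_eq_mk, AdjoinRoot.mk_eq_zero]
  exact pow_dvd_pow _ h

theorem coord_gen_pow {n j : ℕ} (i : ℕ) (h : j ≤ n) :
    coord n i (gen n ^ j) = if i = j then 1 else 0 := by
  have hm : (Polynomial.X ^ j : Polynomial ℤ) %ₘ Polynomial.X ^ (n + 1) = Polynomial.X ^ j := by
    rw [Polynomial.modByMonic_eq_self_iff (Polynomial.monic_X_pow (n + 1))]
    simp only [Polynomial.degree_X_pow]
    exact_mod_cast Nat.lt_succ_of_le h
  have : coord n i (gen n ^ j) = (Polynomial.X ^ j : Polynomial ℤ).coeff i := by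
    rw [gen_pow_eq_mk]
    change ((AdjoinRoot.modByMonicHom (Polynomial.monic_X_pow (n + 1)))
      (AdjoinRoot.mk _ (Polynomial.X ^ j))).coeff i = _
    rw [AdjoinRoot.modByMonicHom_mk, hm]
  rw [this, Polynomial.coeff_X_pow]

theorem sum_coord (n : ℕ) (a : TruncPoly n) :
    ∑ i ∈ Finset.range (n + 1), coord n i a • gen n ^ i = a := by
  set p := AdjoinRoot.modByMonicHom (Polynomial.monic_X_pow (R := ℤ) (n + 1)) a with hp
  have h1 : AdjoinRoot.mk (Polynomial.X ^ (n + 1) : Polynomial ℤ) p = a :=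
    AdjoinRoot.mk_leftInverse (Polynomial.monic_X_pow (n + 1)) a
  have h2 : p.natDegree < n + 1 := by
    obtain ⟨q, rfl⟩ := AdjoinRoot.mk_surjective a
    rw [hp, AdjoinRoot.modByMonicHom_mk]
    refine (Polynomial.natDegree_modByMonic_lt q (Polynomial.monic_X_pow (n + 1)) ?_).trans_eq ?_
    · intro h
      have := congrArg Polynomial.natDegree h
      simp at this
    · simp
  rw [← h1]
  conv_rhs => rw [p.as_sum_range' (n + 1) h2, map_sum]
  refine Finset.sum_congr rfl fun i _ => ?_
  rw [h1, ← Polynomial.smul_X_eq_monomial, gen_pow_eq_mk]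
  change p.coeff i • _ = _
  rw [map_zsmul]

/-- Additive maps are determined by their values on the powers of the generator. -/
theorem addHom_ext {n : ℕ} {B : Type*} [AddCommGroup B] (φ ψ : TruncPoly n →+ B)
    (h : ∀ i, i ≤ n → φ (gen n ^ i) = ψ (gen n ^ i)) (a : TruncPoly n) : φ a = ψ a := by
  rw [← sum_coord n a, map_sum, map_sum]
  refine Finset.sum_congr rfl fun i hi => ?_
  rw [map_zsmul, map_zsmul, h i (by simpa [Nat.lt_succ_iff] using hi)]

theorem eq_of_coord_eq {n : ℕ} {a b : TruncPoly n} (h : ∀ i, i ≤ n → coord n i a = coord n i b) :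
    a = b := by
  rw [← sum_coord n a, ← sum_coord n b]
  exact Finset.sum_congr rfl fun i hi => by rw [h i (by simpa [Nat.lt_succ_iff] using hi)]

/-- The additive map with prescribed values on `1, x, …, x^n`. -/
noncomputable def extend {n : ℕ} (φ : ℕ → TruncPoly n) : TruncPoly n →+ TruncPoly n :=
  ∑ i ∈ Finset.range (n + 1), ((smulAddHom ℤ (TruncPoly n)).flip (φ i)).comp (coord n i)

theorem extend_apply {n : ℕ} (φ : ℕ → TruncPoly n) (a : TruncPoly n) :
    extend φ a = ∑ i ∈ Finset.range (n + 1), coord n i a • φ i := by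
  simp [extend]

theorem extend_gen_pow {n : ℕ} (φ : ℕ → TruncPoly n) {i : ℕ} (h : i ≤ n) :
    extend φ (gen n ^ i) = φ i := by
  rw [extend_apply, Finset.sum_eq_single i]
  · simp [coord_gen_pow i h]
  · intro j _ hj; simp [coord_gen_pow j h, hj]
  · intro hi; simp at hi; omega

theorem extend_one {n : ℕ} (φ : ℕ → TruncPoly n) : extend φ 1 = φ 0 := by
  simpa using extend_gen_pow φ (Nat.zero_le n)

theorem extend_add {n : ℕ} (φ ψ : ℕ → TruncPoly n) (a : TruncPoly n) :
    extend (fun i => φ i + ψ i) a = extend φ a + extend ψ a := by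
  simp [extend_apply, smul_add, Finset.sum_add_distrib]

theorem extend_zero {n : ℕ} (a : TruncPoly n) :
    extend (fun _ => (0 : TruncPoly n)) a = 0 := by
  simp [extend_apply]

theorem coord_mul_gen_pow {n : ℕ} (i j : ℕ) (hi : i ≤ n) (a : TruncPoly n) :
    coord n i (a * gen n ^ j) = if j ≤ i then coord n (i - j) a else 0 := by
  let φ : TruncPoly n →+ ℤ := (coord n i).comp (AddMonoidHom.mulRight (gen n ^ j))
  let ψ : TruncPoly n →+ ℤ := if j ≤ i then coord n (i - j) else 0
  have h : φ a = ψ a := by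
    refine addHom_ext φ ψ (fun k hk => ?_) a
    simp only [φ, ψ, AddMonoidHom.comp_apply, AddMonoidHom.coe_mulRight, ← pow_add]
    by_cases hkj : k + j ≤ n
    · rw [coord_gen_pow _ hkj]
      split_ifs with h1 h2 h2 <;> simp_all [coord_gen_pow] <;> omega
    · rw [gen_pow_eq_zero (by omega), map_zero]
      split_ifs with h2
      · rw [coord_gen_pow _ hk, if_neg (by omega)]
      · rfl
  simp only [φ, ψ, AddMonoidHom.comp_apply, AddMonoidHom.coe_mulRight] at h
  rw [h]; split_ifs <;> rfl

/-- The pairing `⟨a, b⟩ = topCoeff (a * b)` is nondegenerate. -/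
theorem eq_of_topCoeff_mul_eq {n : ℕ} {a b : TruncPoly n}
    (h : ∀ c, topCoeff n (c * a) = topCoeff n (c * b)) : a = b := by
  refine eq_of_coord_eq fun i hi => ?_
  have := h (gen n ^ (n - i))
  simp only [topCoeff_eq_coord, mul_comm (gen n ^ (n - i))] at this
  rwa [coord_mul_gen_pow _ _ le_rfl, coord_mul_gen_pow _ _ le_rfl, if_pos (by omega),
    if_pos (by omega), Nat.sub_sub_self hi] at this

/-- The quotient by `x`, up to the constant coefficient. -/
noncomputable def divX {n : ℕ} (a : TruncPoly n) : TruncPoly n :=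
  ∑ l ∈ Finset.range n, coord n (l + 1) a • gen n ^ l

theorem divX_mul_gen {n : ℕ} (a : TruncPoly n) (h : coord n 0 a = 0) : divX a * gen n = a := by
  conv_rhs => rw [← sum_coord n a, Finset.sum_range_succ', h]
  simp [divX, Finset.sum_mul, pow_succ, mul_assoc]

/-- The annihilator of `x` is generated by `x^n`. -/
theorem eq_zsmul_of_mul_gen_eq_zero {n : ℕ} {a : TruncPoly n} (h : a * gen n = 0) :
    a = coord n n a • gen n ^ n := by
  refine eq_of_coord_eq fun i hi => ?_
  rw [map_zsmul, coord_gen_pow i le_rfl]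
  split_ifs with hn
  · simp [hn]
  · have := congrArg (coord n (i + 1)) h
    rw [← pow_one (gen n), coord_mul_gen_pow _ _ (by omega), if_pos (by omega)] at this
    simpa using this

/-- The annihilator of `(n + 1) x^n` consists of the elements without constant coefficient. -/
theorem coord_zero_of_mul_eq_zero {n : ℕ} {a : TruncPoly n}
    (h : (n + 1 : TruncPoly n) * gen n ^ n * a = 0) : coord n 0 a = 0 := by
  have h1 : (n + 1 : TruncPoly n) * gen n ^ n * a = (n + 1 : ℤ) • (a * gen n ^ n) := by
    rw [zsmul_eq_mul]; push_cast; ring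
  have h2 := congrArg (coord n n) h
  rw [h1, map_zsmul, coord_mul_gen_pow _ _ le_rfl, if_pos le_rfl] at h2
  simp only [Nat.sub_self, map_zero, smul_eq_mul, mul_eq_zero] at h2
  exact h2.resolve_left (by positivity)

/-! ### The grading of `ℤ[x]/(x^{n+1})` -/

theorem gen_pow_mem_grading (m : ℤ) (n j : ℕ) : gen n ^ j ∈ grading m n (2 * m * j) :=
  AddSubgroup.subset_closure ⟨j, rfl, rfl⟩

theorem mem_grading_of_eq {m : ℤ} {n : ℕ} {i j : ℤ} {a : TruncPoly n} (h : a ∈ grading m n i)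
    (hij : i = j) : a ∈ grading m n j := hij ▸ h

theorem mul_mem_grading {m : ℤ} {n : ℕ} {i j : ℤ} {a b : TruncPoly n} (ha : a ∈ grading m n i)
    (hb : b ∈ grading m n j) : a * b ∈ grading m n (i + j) := by
  induction ha using AddSubgroup.closure_induction with
  | mem a h =>
    obtain ⟨k, rfl, rfl⟩ := h
    induction hb using AddSubgroup.closure_induction with
    | mem b h =>
      obtain ⟨l, rfl, rfl⟩ := h
      rw [← pow_add]
      exact mem_grading_of_eq (gen_pow_mem_grading m n _) (by push_cast; ring)
    | zero => rw [mul_zero]; exact zero_mem _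
    | add b b' _ _ h h' => rw [mul_add]; exact add_mem h h'
    | neg b _ h => rw [mul_neg]; exact neg_mem h
  | zero => rw [zero_mul]; exact zero_mem _
  | add b b' _ _ h h' => rw [add_mul]; exact add_mem h h'
  | neg b _ h => rw [neg_mul]; exact neg_mem h

theorem coord_eq_zero_of_mem_grading {m : ℤ} {n : ℕ} {i : ℤ} {a : TruncPoly n}
    (ha : a ∈ grading m n i) {j : ℕ} (h : 2 * m * j ≠ i) : coord n j a = 0 := by
  induction ha using AddSubgroup.closure_induction with
  | mem a ha =>
    obtain ⟨k, hk, rfl⟩ := ha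
    by_cases hkn : k ≤ n
    · rw [coord_gen_pow _ hkn, if_neg]
      rintro rfl; exact h hk
    · rw [gen_pow_eq_zero (by omega), map_zero]
  | zero => exact map_zero _
  | add b b' _ _ h h' => rw [map_add, h, h', add_zero]
  | neg b _ h => rw [map_neg, h, neg_zero]

end TruncatedPolynomial

/-! ### Cochains of few arguments -/

namespace Hochschild

open WordFun

section Const

variable {A : Type*} [CommRing A]

/-- An element of `A`, as a cochain of no arguments. -/
def const (a : A) : WordFun A := ⟨fun l => if l = [] then a else 0⟩

theorem const_nil (a : A) : const a [] = a := rfl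
theorem const_cons (a b : A) (l : List A) : const a (b :: l) = 0 := rfl

theorem shift_const (a b : A) : shift b (const a) = 0 := rfl

theorem const_mul_apply (a : A) (f : WordFun A) (l : List A) : (const a * f) l = a * f l := by
  cases l with
  | nil => rw [mul_nil, const_nil]
  | cons b l => rw [mul_cons, shift_const, zero_mul, const_nil, word_zero, add_zero]

theorem mul_const_apply (f : WordFun A) (a : A) (l : List A) : (f * const a) l = f l * a := by
  induction l generalizing f with
  | nil => rw [mul_nil, const_nil]
  | cons b l ih => rw [mul_cons, ih, const_cons, mul_zero, zero_add, shift_apply]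

theorem const_mul_comm (a : A) (f : WordFun A) : const a * f = f * const a := by
  ext l; rw [const_mul_apply, mul_const_apply, mul_comm]

theorem const_one : const (1 : A) = 1 := rfl

theorem const_add (a b : A) : const (a + b) = const a + const b := by
  ext l; cases l <;> simp [word_add, const_nil, const_cons]

theorem const_zero : const (0 : A) = 0 := by
  ext l; cases l <;> rfl

theorem const_mul (a b : A) : const (a * b) = const a * const b := by
  ext l; cases l <;> simp [const_mul_apply, const_nil, const_cons]

theorem IsCochain.const (a : A) : IsCochain (const a) := by
  refine ⟨fun l r b c => ?_, fun l r => ?_, ⟨0, fun l hl => ?_⟩⟩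
  · cases l <;> simp [const_cons]
  · cases l <;> simp [const_cons]
  · cases l
    · simp at hl
    · rfl

theorem differential_single (f : WordFun A) (a : A) : differential f [a] = 0 := by
  simp [differential, mid_one, mul_comm]

/-- The differential of a function of `p` arguments is a function of `p + 1` arguments. -/
theorem differential_apply_eq_zero {f : WordFun A} {p : ℕ}
    (hf : ∀ l : List A, l.length ≠ p → f l = 0) {l : List A} (hl : l.length ≠ p + 1) :
    differential f l = 0 := by
  cases l with
  | nil => rfl
  | cons a l =>
    simp only [List.length_cons, ne_eq, Nat.add_right_cancel_iff] at hl
    have h : mid f (a :: l) = 0 := by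
      simp only [mid]
      refine Finset.sum_eq_zero fun i hi => ?_
      rw [Finset.mem_range] at hi
      have hlen := length_mergeAt i (a :: l) (by omega)
      simp only [List.length_cons] at hlen
      rw [hf _ (by omega), mul_zero]
    simp only [differential]
    rw [h, hf l hl, hf _ (by simpa using hl)]
    simp

theorem differential_const (a : A) : differential (const a) = 0 := by
  ext l
  by_cases h : l.length = 1
  · obtain ⟨b, rfl⟩ := List.length_eq_one_iff.mp h
    exact differential_single _ _
  · refine differential_apply_eq_zero (p := 0) (fun l hl => ?_) h
    cases l
    · simp at hl
    · rfl

/-- An additive map, as a function of one argument. -/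
def linear (φ : A →+ A) : WordFun A where
  eval
    | [a] => φ a
    | _ => 0

theorem linear_apply_eq_zero (φ : A →+ A) {l : List A} (hl : l.length ≠ 1) : linear φ l = 0 := by
  rcases l with _ | ⟨a, _ | ⟨b, l⟩⟩
  · rfl
  · simp at hl
  · rfl

theorem IsCochain.linear {φ : A →+ A} (h : φ 1 = 0) : IsCochain (linear φ) := by
  refine ⟨fun l r a b => ?_, fun l r => ?_, ⟨1, fun l hl => linear_apply_eq_zero φ hl.ne'⟩⟩
  · rcases l with _ | ⟨c, _ | ⟨d, l⟩⟩ <;> cases r <;> simp [Hochschild.linear]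
  · rcases l with _ | ⟨c, _ | ⟨d, l⟩⟩ <;> cases r <;> simp [Hochschild.linear, h]

theorem linear_mul_cons (φ : A →+ A) (f : WordFun A) (a : A) (l : List A) :
    (linear φ * f) (a :: l) = φ a * f l := by
  have h : shift a (linear φ) = const (φ a) := by ext w; cases w <;> rfl
  rw [mul_cons, h, const_mul_apply]; simp [linear]

theorem differential_linear {φ : A →+ A} (h : ∀ a b, φ (a * b) = a * φ b + b * φ a) :
    differential (linear φ) = 0 := by
  ext l
  by_cases hl : l.length = 2
  · obtain ⟨a, b, rfl⟩ := List.length_eq_two.mp hl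
    rw [differential_cons_cons, differential_single]
    simp [linear, h, word_zero]
  · exact differential_apply_eq_zero (p := 1) (fun l => linear_apply_eq_zero φ) hl

/-- A biadditive map, as a function of two arguments. -/
def bilinear (φ : A →+ A →+ A) : WordFun A where
  eval
    | [a, b] => φ a b
    | _ => 0

theorem bilinear_apply_eq_zero (φ : A →+ A →+ A) {l : List A} (hl : l.length ≠ 2) :
    bilinear φ l = 0 := by
  rcases l with _ | ⟨a, _ | ⟨b, _ | ⟨c, l⟩⟩⟩
  · rfl
  · rfl
  · simp at hl
  · rfl

theorem IsCochain.bilinear {φ : A →+ A →+ A} (h : φ 1 = 0) (h' : ∀ a, φ a 1 = 0) :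
    IsCochain (bilinear φ) := by
  refine ⟨fun l r a b => ?_, fun l r => ?_, ⟨2, fun l hl => bilinear_apply_eq_zero φ hl.ne'⟩⟩
  · rcases l with _ | ⟨c, _ | ⟨d, _ | ⟨e, l⟩⟩⟩ <;> rcases r with _ | ⟨c', _ | ⟨d', r⟩⟩ <;>
      simp [Hochschild.bilinear]
  · rcases l with _ | ⟨c, _ | ⟨d, _ | ⟨e, l⟩⟩⟩ <;> rcases r with _ | ⟨c', _ | ⟨d', r⟩⟩ <;>
      simp [Hochschild.bilinear, h, h']

theorem bilinear_mul_nil (φ : A →+ A →+ A) (f : WordFun A) : (bilinear φ * f) [] = 0 := by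
  simp [mul_nil, bilinear]

theorem bilinear_mul_single (φ : A →+ A →+ A) (f : WordFun A) (a : A) :
    (bilinear φ * f) [a] = 0 := by
  simp [mul_cons, mul_nil, bilinear, shift_apply]

theorem bilinear_mul_cons_cons (φ : A →+ A →+ A) (f : WordFun A) (a b : A) (l : List A) :
    (bilinear φ * f) (a :: b :: l) = φ a b * f l := by
  have h : shift b (shift a (bilinear φ)) = const (φ a b) := by ext w; cases w <;> rfl
  rw [mul_cons, mul_cons, h, const_mul_apply]; simp [bilinear, shift_apply]

end Const

section Multi

variable {A : Type*} [Ring A]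

/-- A multiadditive function, as an additive map in one of its arguments. -/
def IsCochain.argHom {f : WordFun A} (hf : IsCochain f) (l r : List A) : A →+ A :=
  AddMonoidHom.mk' (fun a => f (l ++ a :: r)) fun a b => hf.map_add l r a b

theorem IsCochain.map_cons_zero {f : WordFun A} (hf : IsCochain f) (r : List A) :
    f (0 :: r) = 0 := (hf.argHom [] r).map_zero

theorem IsCochain.map_cons_cons_zero {f : WordFun A} (hf : IsCochain f) (a : A) (r : List A) :
    f (a :: 0 :: r) = 0 := (hf.argHom [a] r).map_zero

theorem IsCochain.map_cons_one {f : WordFun A} (hf : IsCochain f) (r : List A) :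
    f (1 :: r) = 0 := hf.map_one [] r

theorem IsCochain.map_cons_cons_one {f : WordFun A} (hf : IsCochain f) (a : A) (r : List A) :
    f (a :: 1 :: r) = 0 := hf.map_one [a] r

end Multi

end Hochschild

namespace TruncatedPolynomial

open Hochschild Hochschild.WordFun

/-- In the first two arguments, cochains are determined by their values on powers of `x`. -/
theorem eq_of_cons_cons {n : ℕ} {f g : WordFun (TruncPoly n)} (hf : IsCochain f) (hg : IsCochain g)
    (l : List (TruncPoly n))
    (h : ∀ i j, i ≤ n → j ≤ n → f (gen n ^ i :: gen n ^ j :: l) = g (gen n ^ i :: gen n ^ j :: l))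
    (a b : TruncPoly n) : f (a :: b :: l) = g (a :: b :: l) := by
  refine addHom_ext (hf.argHom [] (b :: l)) (hg.argHom [] (b :: l)) (fun i hi => ?_) a
  refine addHom_ext (hf.argHom [gen n ^ i] l) (hg.argHom [gen n ^ i] l) (fun j hj => ?_) b
  exact h i j hi hj

/-- The derivation `x d/dx`. -/
noncomputable def euler (n : ℕ) : TruncPoly n →+ TruncPoly n :=
  extend fun i => (i : ℤ) • gen n ^ i

theorem euler_gen_pow (n i : ℕ) : euler n (gen n ^ i) = (i : ℤ) • gen n ^ i := by
  by_cases h : i ≤ n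
  · exact extend_gen_pow _ h
  · rw [gen_pow_eq_zero (by omega), map_zero, smul_zero]

theorem euler_one (n : ℕ) : euler n 1 = 0 := by
  simpa using euler_gen_pow n 0

theorem euler_mul (n : ℕ) (a b : TruncPoly n) :
    euler n (a * b) = a * euler n b + b * euler n a := by
  let φ : TruncPoly n →+ TruncPoly n →+ TruncPoly n :=
    AddMonoidHom.mul.compr₂ (euler n)
  let ψ : TruncPoly n →+ TruncPoly n →+ TruncPoly n :=
    AddMonoidHom.mul.compl₂ (euler n) + (AddMonoidHom.mul.compl₂ (euler n)).flip
  have h : φ a = ψ a := by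
    refine addHom_ext φ ψ (fun i _ => ?_) a
    ext b
    refine addHom_ext (φ (gen n ^ i)) (ψ (gen n ^ i)) (fun j _ => ?_) b
    simp only [φ, ψ, AddMonoidHom.compr₂_apply, AddMonoidHom.coe_mul, AddMonoidHom.coe_mulLeft,
      AddMonoidHom.add_apply, AddMonoidHom.compl₂_apply, AddMonoidHom.flip_apply, ← pow_add,
      euler_gen_pow, zsmul_eq_mul]
    push_cast
    ring
  exact DFunLike.congr_fun h b

/-- The exponent rule of the cocycle `t̄`. -/
noncomputable def carry (n i j : ℕ) : TruncPoly n :=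
  if n + 1 ≤ i + j then gen n ^ (i + j - (n + 1)) else 0

/-- The biadditive map `x^i, x^j ↦ x^{i+j-(n+1)}`. -/
noncomputable def carryHom (n : ℕ) : TruncPoly n →+ TruncPoly n →+ TruncPoly n :=
  AddMonoidHom.mk' (fun a => AddMonoidHom.mk' (fun b => extend (fun i => extend (carry n i) b) a)
    (fun b b' => by simp only [map_add, extend_add]))
    (fun a a' => by ext b; simp)

theorem carryHom_apply (n : ℕ) (a b : TruncPoly n) :
    carryHom n a b = extend (fun i => extend (carry n i) b) a := rfl

theorem carryHom_gen_pow {n i j : ℕ} (hi : i ≤ n) (hj : j ≤ n) :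
    carryHom n (gen n ^ i) (gen n ^ j) = carry n i j := by
  rw [carryHom_apply, extend_gen_pow _ hi, extend_gen_pow _ hj]

theorem carryHom_gen_pow' (n i j : ℕ) :
    carryHom n (gen n ^ i) (gen n ^ j) = if i ≤ n ∧ j ≤ n then carry n i j else 0 := by
  split_ifs with h
  · exact carryHom_gen_pow h.1 h.2
  · by_cases hi : i ≤ n
    · rw [gen_pow_eq_zero (j := j) (by omega), map_zero]
    · rw [gen_pow_eq_zero (j := i) (by omega), map_zero, AddMonoidHom.zero_apply]

theorem carryHom_one_left (n : ℕ) : carryHom n 1 = 0 := by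
  ext b
  refine addHom_ext (carryHom n 1) 0 (fun j hj => ?_) b
  rw [← pow_zero (gen n), carryHom_gen_pow (Nat.zero_le n) hj, carry, if_neg (by omega)]
  rfl

theorem carryHom_one_right (n : ℕ) (a : TruncPoly n) : carryHom n a 1 = 0 := by
  refine addHom_ext ((carryHom n).flip 1) 0 (fun j hj => ?_) a
  rw [AddMonoidHom.flip_apply, ← pow_zero (gen n), carryHom_gen_pow hj (Nat.zero_le n), carry,
    if_neg (by omega)]
  rfl

theorem carryHom_gen_left {n : ℕ} (hn : 1 ≤ n) {i : ℕ} (hi : i ≤ n) :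
    carryHom n (gen n) (gen n ^ i) = if i = n then 1 else 0 := by
  conv_lhs => rw [← pow_one (gen n)]
  rw [← pow_mul, one_mul, carryHom_gen_pow hn hi, carry]
  split_ifs with h1 h2 h2
  · simp [h2, add_comm]
  · omega
  · omega
  · rfl

theorem carryHom_gen_right {n : ℕ} (hn : 1 ≤ n) {i : ℕ} (hi : i ≤ n) :
    carryHom n (gen n ^ i) (gen n) = if i = n then 1 else 0 := by
  have : gen n = gen n ^ 1 := (pow_one _).symm
  conv_lhs => rw [this]
  rw [← pow_mul, one_mul, carryHom_gen_pow hi hn, carry]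
  split_ifs with h1 h2 h2
  · simp [h2]
  · omega
  · omega
  · rfl

/-- The cochain `ū`. -/
noncomputable def ubar (n : ℕ) : WordFun (TruncPoly n) := linear (euler n)

/-- The cochain `t̄`. -/
noncomputable def tbar (n : ℕ) : WordFun (TruncPoly n) := bilinear (carryHom n)

theorem isCochain_ubar (n : ℕ) : IsCochain (ubar n) := IsCochain.linear (euler_one n)

theorem isCochain_tbar (n : ℕ) : IsCochain (tbar n) :=
  IsCochain.bilinear (carryHom_one_left n) (carryHom_one_right n)

theorem differential_ubar (n : ℕ) : differential (ubar n) = 0 :=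
  differential_linear (euler_mul n)

theorem differential_tbar (n : ℕ) : differential (tbar n) = 0 := by
  have hc := (isCochain_tbar n).differential
  ext l
  by_cases hl : l.length = 3
  · obtain ⟨a, b, c, rfl⟩ := List.length_eq_three.mp hl
    refine eq_of_cons_cons hc isCochain_zero [c] (fun i j hi hj => ?_) a b
    refine addHom_ext (hc.argHom [gen n ^ i, gen n ^ j] []) 0 (fun k hk => ?_) c
    change differential (tbar n) [gen n ^ i, gen n ^ j, gen n ^ k] = 0
    rw [differential_cons_cons, differential_cons_cons, differential_single]
    simp only [tbar, bilinear, shift_apply, ← pow_add, carryHom_gen_pow', carry, mul_ite, mul_zero]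
    by_cases h1 : n + 1 ≤ i + j <;> by_cases h2 : n + 1 ≤ j + k
    · have e1 : ¬ (i + j ≤ n) := by omega
      have e2 : ¬ (j + k ≤ n) := by omega
      simp only [h1, h2, hi, hj, hk, e1, e2, and_true, if_true, if_false, and_false]
      have e : i + (j + k - (n + 1)) = k + (i + j - (n + 1)) := by omega
      rw [e]; ring
    · have e1 : ¬ (i + j ≤ n) := by omega
      have e2 : (j + k ≤ n) := by omega
      have e3 : n + 1 ≤ i + (j + k) := by omega
      simp only [h1, h2, hi, hj, hk, e1, e2, e3, and_true, if_true, if_false]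
      have e : i + (j + k) - (n + 1) = k + (i + j - (n + 1)) := by omega
      rw [e]; simp
    · have e1 : (i + j ≤ n) := by omega
      have e2 : ¬ (j + k ≤ n) := by omega
      have e3 : n + 1 ≤ i + j + k := by omega
      simp only [h1, h2, hi, hj, hk, e1, e2, e3, and_true, if_true, if_false, and_false]
      have e : i + (j + k - (n + 1)) = i + j + k - (n + 1) := by omega
      rw [e]; simp
    · have e1 : (i + j ≤ n) := by omega
      have e2 : (j + k ≤ n) := by omega
      simp only [h1, h2, hi, hj, hk, e1, e2, and_true, if_true, if_false, add_assoc]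
      ring
  · exact differential_apply_eq_zero (p := 2) (fun l => bilinear_apply_eq_zero _) hl

theorem tbar_mul_cons_cons {n : ℕ} (f : WordFun (TruncPoly n)) (a b : TruncPoly n)
    (l : List (TruncPoly n)) : (tbar n * f) (a :: b :: l) = carryHom n a b * f l :=
  bilinear_mul_cons_cons _ _ _ _ _

/-! ### Periodicity -/

/-- The cochain `(E f)(a₁, …, a_p) = ∑ᵢ x^{n-i} f(x, x^i, a₁, …, a_p)`. The comparison map from
the two-periodic resolution of `ℤ[x]/(x^{n+1})` to the bar resolution sends the generator of degree
two to `∑ᵢ x^{n-i} [x | x^i]`, so `E` is one step of the periodicity of Hochschild cohomology. -/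
noncomputable def reduce {n : ℕ} (f : WordFun (TruncPoly n)) : WordFun (TruncPoly n) :=
  ⟨fun l => ∑ i ∈ Finset.range (n + 1), gen n ^ (n - i) * f (gen n :: gen n ^ i :: l)⟩

theorem reduce_apply {n : ℕ} (f : WordFun (TruncPoly n)) (l : List (TruncPoly n)) :
    reduce f l
      = ∑ i ∈ Finset.range (n + 1), gen n ^ (n - i) * f (gen n :: gen n ^ i :: l) := rfl

theorem reduce_zero (n : ℕ) : reduce (0 : WordFun (TruncPoly n)) = 0 := by
  ext l; simp [reduce_apply, word_zero]

theorem reduce_add {n : ℕ} (f g : WordFun (TruncPoly n)) :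
    reduce (f + g) = reduce f + reduce g := by
  ext l; simp [reduce_apply, word_add, mul_add, Finset.sum_add_distrib]

theorem reduce_const {n : ℕ} (a : TruncPoly n) : reduce (const a) = 0 := by
  ext l; simp [reduce_apply, const_cons, word_zero]

theorem reduce_ubar_mul_const {n : ℕ} (a : TruncPoly n) : reduce (ubar n * const a) = 0 := by
  ext l; simp [reduce_apply, mul_const_apply, word_zero, ubar, linear]

/-- `E` is a left inverse of the multiplication by `t̄`. -/
theorem reduce_tbar_mul {n : ℕ} (hn : 1 ≤ n) (f : WordFun (TruncPoly n)) :
    reduce (tbar n * f) = f := by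
  ext l
  rw [reduce_apply, Finset.sum_eq_single n]
  · rw [tbar_mul_cons_cons, carryHom_gen_left hn le_rfl]; simp
  · intro i hi hin
    rw [tbar_mul_cons_cons, carryHom_gen_left hn (by simp at hi; omega), if_neg hin]; simp
  · simp

theorem isCochain_reduce {n : ℕ} {f : WordFun (TruncPoly n)} (hf : IsCochain f) :
    IsCochain (reduce f) := by
  refine ⟨fun l r a b => ?_, fun l r => ?_, ?_⟩
  · simp only [reduce_apply, ← Finset.sum_add_distrib, ← mul_add]
    exact Finset.sum_congr rfl fun i _ =>
      congrArg _ (hf.map_add (gen n :: gen n ^ i :: l) r a b)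
  · rw [reduce_apply]
    exact Finset.sum_eq_zero fun i _ => by
      rw [show f (gen n :: gen n ^ i :: (l ++ 1 :: r)) = 0 from
        hf.map_one (gen n :: gen n ^ i :: l) r, mul_zero]
  · obtain ⟨N, hN⟩ := hf.bounded
    refine ⟨N, fun l hl => ?_⟩
    rw [reduce_apply]
    exact Finset.sum_eq_zero fun i _ => by rw [hN _ (by simp; omega), mul_zero]

/-- `E` commutes with the differential, except for the cochains of one argument. -/
theorem reduce_differential {n : ℕ} {g : WordFun (TruncPoly n)} (hg : IsCochain g) :
    reduce (differential g)
      = differential (reduce g) + const ((n + 1 : TruncPoly n) * gen n ^ n * g [gen n]) := by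
  -- the sums telescope, because `x^{n+1} = 0`
  have tele : ∀ (φ : TruncPoly n →+ TruncPoly n) (c : ℕ),
      ∑ i ∈ Finset.range (n + 1), gen n ^ (n - i) * φ (gen n ^ (i + c))
        = ∑ i ∈ Finset.range (n + 1), gen n ^ (n - i) * (gen n ^ c * φ (gen n ^ i)) := by
    intro φ c
    have key : ∀ c, ∑ i ∈ Finset.range (n + 1), gen n ^ (n - i) * φ (gen n ^ (i + c))
        = ∑ i ∈ Finset.range (n + 1),
          if c ≤ i then gen n ^ (n - (i - c)) * φ (gen n ^ i) else 0 := by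
      intro c
      rw [← Finset.sum_filter]
      rw [← Finset.sum_filter_of_ne (p := fun i => i + c ≤ n)]
      · refine Finset.sum_bij' (fun i _ => i + c) (fun i _ => i - c) ?_ ?_ ?_ ?_ ?_ <;>
          simp only [Finset.mem_filter, Finset.mem_range]
        · intro i hi; omega
        · intro i hi; omega
        · intro i hi; omega
        · intro i hi; omega
        · intro i hi; rw [Nat.add_sub_cancel]
      · intro i _ h
        by_contra hc
        rw [gen_pow_eq_zero (j := i + c) (by omega), map_zero, mul_zero] at h
        exact h rfl
    rw [key]
    refine Finset.sum_congr rfl fun i hi => ?_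
    rw [Finset.mem_range] at hi
    rw [← mul_assoc, ← pow_add]
    split_ifs with h
    · congr 2; omega
    · rw [gen_pow_eq_zero (j := n - i + c) (by omega), zero_mul]
  have const_sum : ∀ y : TruncPoly n,
      ∑ i ∈ Finset.range (n + 1), gen n ^ (n - i) * (gen n ^ i * y)
        = (n + 1 : TruncPoly n) * gen n ^ n * y := by
    intro y
    rw [Finset.sum_congr rfl (g := fun _ => gen n ^ n * y)]
    · rw [Finset.sum_const, Finset.card_range, nsmul_eq_mul]; push_cast; ring
    · intro i hi
      rw [← mul_assoc, ← pow_add]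
      simp only [Finset.mem_range] at hi
      congr 2; omega
  ext l
  rw [word_add]
  have first : reduce (differential g) l = (n + 1 : TruncPoly n) * gen n ^ n * g (gen n :: l)
      - ∑ i ∈ Finset.range (n + 1),
        gen n ^ (n - i) * differential (shift (gen n) g) (gen n ^ i :: l) := by
    rw [reduce_apply]
    simp only [differential_cons_cons, mul_sub, mul_add, Finset.sum_sub_distrib,
      Finset.sum_add_distrib]
    rw [const_sum]
    have := tele (hg.argHom [] l) 1
    simp only [pow_one] at this
    change ∑ i ∈ Finset.range (n + 1), gen n ^ (n - i) * g (gen n ^ (i + 1) :: l)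
      = ∑ i ∈ Finset.range (n + 1), gen n ^ (n - i) * (gen n * g (gen n ^ i :: l)) at this
    simp only [← pow_succ', this, sub_self, zero_add]
  rw [first]
  cases l with
  | nil =>
    simp only [differential_single, mul_zero, Finset.sum_const_zero, sub_zero, const_nil]
    exact (zero_add _).symm
  | cons b l =>
    rw [const_cons, add_zero]
    -- both sides are additive in the next letter, which may be taken to be a power of `x`
    refine addHom_ext (n := n)
      (((AddMonoidHom.mulLeft ((n + 1 : TruncPoly n) * gen n ^ n)).comp (hg.argHom [gen n] l))
        - ∑ i ∈ Finset.range (n + 1), (AddMonoidHom.mulLeft (gen n ^ (n - i))).comp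
          (AddMonoidHom.mk' (fun b => differential (shift (gen n) g) (gen n ^ i :: b :: l))
            (IsMulti.differential (IsMulti.shift hg.map_add (gen n)) [gen n ^ i] l)))
      ((isCochain_reduce hg).differential.argHom [] l) (fun c _ => ?_) b |> Eq.trans ?_
    · simp [IsCochain.argHom]
    · simp only [AddMonoidHom.sub_apply, AddMonoidHom.finsetSum_apply, AddMonoidHom.comp_apply,
        AddMonoidHom.coe_mulLeft, AddMonoidHom.mk'_apply, IsCochain.argHom, List.nil_append,
        List.cons_append]
      have e2 : differential (reduce g) (gen n ^ c :: l) = ∑ i ∈ Finset.range (n + 1),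
          gen n ^ (n - i) *
            differential (shift (gen n ^ i) (shift (gen n) g)) (gen n ^ c :: l) := by
        simp only [differential, mid, shift_apply, reduce_apply, Finset.mul_sum, Finset.sum_mul,
          mul_add, Finset.sum_add_distrib]
        congr 1
        · congr 1
          · refine Finset.sum_congr rfl fun i _ => by ring
          · rw [Finset.sum_comm]
            refine Finset.sum_congr rfl fun i _ => Finset.sum_congr rfl fun i _ => by ring
        · refine Finset.sum_congr rfl fun i _ => by ring
      have := tele (hg.argHom [gen n] l) c
      simp only [IsCochain.argHom, AddMonoidHom.mk'_apply, List.cons_append,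
        List.nil_append] at this
      simp only [differential_cons_cons, mul_sub, mul_add, Finset.sum_sub_distrib,
        Finset.sum_add_distrib, shift_apply, ← pow_add, this, const_sum, e2]
      ring

/-- The homotopy `(h f)(x^b, a₂, …, a_p) = ∑_{i<b} x^{b-1-i} f(x, x^i, a₂, …, a_p)`. -/
noncomputable def homotopy {n : ℕ} (f : WordFun (TruncPoly n)) : WordFun (TruncPoly n) where
  eval
    | [] => 0
    | a :: l =>
      extend (fun b => ∑ i ∈ Finset.range b, gen n ^ (b - 1 - i) * f (gen n :: gen n ^ i :: l)) a

theorem homotopy_cons {n : ℕ} (f : WordFun (TruncPoly n)) (a : TruncPoly n)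
    (l : List (TruncPoly n)) : homotopy f (a :: l) =
      extend (fun b => ∑ i ∈ Finset.range b, gen n ^ (b - 1 - i) * f (gen n :: gen n ^ i :: l)) a :=
  rfl

theorem isCochain_homotopy {n : ℕ} {f : WordFun (TruncPoly n)} (hf : IsCochain f) :
    IsCochain (homotopy f) := by
  refine ⟨fun l r a b => ?_, fun l r => ?_, ?_⟩
  · cases l with
    | nil => simp only [List.nil_append, homotopy_cons, map_add]
    | cons c l =>
      simp only [List.cons_append, homotopy_cons, ← extend_add, ← Finset.sum_add_distrib,
        ← mul_add]
      congr 2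
      ext k
      exact Finset.sum_congr rfl fun i _ =>
        congrArg _ (hf.map_add (gen n :: gen n ^ i :: l) r a b)
  · cases l with
    | nil => simp [homotopy_cons, extend_one]
    | cons c l =>
      have : ∀ i, f (gen n :: gen n ^ i :: (l ++ 1 :: r)) = 0 := fun i =>
        hf.map_one (gen n :: gen n ^ i :: l) r
      simp [List.cons_append, homotopy_cons, this, extend_zero]
  · obtain ⟨N, hN⟩ := hf.bounded
    refine ⟨N, fun l hl => ?_⟩
    cases l with
    | nil => rfl
    | cons c l =>
      have : ∀ i, f (gen n :: gen n ^ i :: l) = 0 := fun i => hN _ (by simp at hl ⊢; omega)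
      simp [homotopy_cons, this, extend_zero]

theorem homotopy_gen_pow {n : ℕ} (f : WordFun (TruncPoly n)) {b : ℕ} (hb : b ≤ n)
    (l : List (TruncPoly n)) : homotopy f (gen n ^ b :: l) =
      ∑ i ∈ Finset.range b, gen n ^ (b - 1 - i) * f (gen n :: gen n ^ i :: l) := by
  rw [homotopy_cons, extend_gen_pow _ hb]

theorem shift_gen_homotopy {n : ℕ} {f : WordFun (TruncPoly n)} (hf : IsCochain f) :
    shift (gen n) (homotopy f) = 0 := by
  ext l
  rw [shift_apply, word_zero]
  rcases Nat.eq_zero_or_pos n with rfl | hn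
  · have : gen 0 = 0 := by simpa using gen_pow_eq_zero (n := 0) (j := 1) le_rfl
    rw [homotopy_cons, this, map_zero]
  · have := homotopy_gen_pow f hn l
    rw [Nat.succ_eq_add_one, zero_add, pow_one] at this
    rw [this]
    simp [hf.map_cons_cons_one]

/-- The cochain `f + d (h f)`, with `d` the differential, vanishes on words `x, x^b, …` with
`b ≠ n`, and for `b = n` its value is that of `E f`. -/
theorem differential_homotopy_gen {n : ℕ} {f : WordFun (TruncPoly n)} (hf : IsCochain f) {b : ℕ}
    (hb : b ≤ n) (l : List (TruncPoly n)) :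
    f (gen n :: gen n ^ b :: l) + differential (homotopy f) (gen n :: gen n ^ b :: l)
      = if b = n then reduce f l else 0 := by
  have h0 : homotopy f (gen n :: l) = 0 := congrArg (fun g => g.eval l) (shift_gen_homotopy hf)
  have step : ∀ b, gen n * ∑ i ∈ Finset.range b, gen n ^ (b - 1 - i) * f (gen n :: gen n ^ i :: l)
      = ∑ i ∈ Finset.range b, gen n ^ (b - i) * f (gen n :: gen n ^ i :: l) := by
    intro b
    rw [Finset.mul_sum]
    refine Finset.sum_congr rfl fun i hi => ?_
    rw [Finset.mem_range] at hi
    rw [← mul_assoc, ← pow_succ']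
    congr 2; omega
  rw [differential_cons_cons, shift_gen_homotopy hf, differential_zero, word_zero, h0, mul_zero,
    ← pow_succ', homotopy_gen_pow _ hb, step]
  split_ifs with h
  · subst h
    rw [gen_pow_eq_zero le_rfl, (isCochain_homotopy hf).map_cons_zero, reduce_apply,
      Finset.sum_range_succ, Nat.sub_self, pow_zero, one_mul]
    ring
  · rw [homotopy_gen_pow _ (show b + 1 ≤ n by omega), Finset.sum_range_succ]
    simp

/-- The values of a cocycle on words of one letter form a derivation `D`, which satisfies
`x D(x^i) = i x^i D(x)`. -/
theorem apply_gen_pow_of_differential_eq_zero {n : ℕ} {f : WordFun (TruncPoly n)}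
    (hf : IsCochain f) (hf' : differential f = 0) (i : ℕ) :
    gen n * f [gen n ^ i] = (i : ℤ) • (gen n ^ i * f [gen n]) := by
  induction i with
  | zero => simp [hf.map_cons_one]
  | succ i ih =>
    have h : differential f [gen n, gen n ^ i] = 0 := by rw [hf']; rfl
    rw [differential_cons_cons, differential_single, sub_zero, ← pow_succ'] at h
    have h' : f [gen n ^ (i + 1)] = gen n * f [gen n ^ i] + gen n ^ i * f [gen n] := by
      linear_combination -h
    rw [h', ih, zsmul_eq_mul, zsmul_eq_mul]; push_cast; ring

theorem apply_gen_pow_succ_of_differential_eq_zero {n : ℕ} {f : WordFun (TruncPoly n)}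
    (hf : IsCochain f) (hf' : differential f = 0) (i : ℕ) :
    f [gen n ^ (i + 1)] = ((i + 1 : ℕ) : ℤ) • (gen n ^ i * f [gen n]) := by
  have h : differential f [gen n, gen n ^ i] = 0 := by rw [hf']; rfl
  rw [differential_cons_cons, differential_single, sub_zero, ← pow_succ'] at h
  have h' := apply_gen_pow_of_differential_eq_zero hf hf' i
  rw [zsmul_eq_mul] at h' ⊢
  push_cast at h' ⊢
  linear_combination h' - h

/-- The derivation `D` of a cocycle kills `x^{n+1} = 0`, so `(n + 1) x^n D(x) = 0`. -/
theorem coord_zero_apply_gen {n : ℕ} {f : WordFun (TruncPoly n)}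
    (hf : IsCochain f) (hf' : differential f = 0) : coord n 0 (f [gen n]) = 0 := by
  refine coord_zero_of_mul_eq_zero ?_
  have := apply_gen_pow_succ_of_differential_eq_zero hf hf' n
  rw [gen_pow_eq_zero le_rfl, hf.map_cons_zero, zsmul_eq_mul] at this
  push_cast at this
  linear_combination -this

/-- `E` maps cocycles to cocycles: the error term in `reduce_differential` vanishes because the
cocycle has a derivation as its part of one argument. -/
theorem differential_reduce {n : ℕ} {f : WordFun (TruncPoly n)}
    (hf : IsCochain f) (hf' : differential f = 0) : differential (reduce f) = 0 := by
  have h := reduce_differential hf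
  have h0 := congrArg (fun g => g.eval []) h
  have h0' : ((n + 1 : TruncPoly n) * gen n ^ n * f [gen n]) = 0 := by
    rw [hf', reduce_zero] at h0
    simp only [word_add] at h0
    change 0 = 0 + _ at h0
    rw [zero_add] at h0
    exact h0.symm
  rwa [hf', reduce_zero, h0', const_zero, add_zero, eq_comm] at h

/-- Every cocycle `f` is cohomologous to `t̄ E(f) + ū b + f()` with `x b = f(x)`. -/
theorem add_differential_homotopy {n : ℕ} {f : WordFun (TruncPoly n)}
    (hf : IsCochain f) (hf' : differential f = 0) :
    f + differential (homotopy f)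
      = tbar n * reduce f + ubar n * const (divX (f [gen n])) + const (f []) := by
  set f' := f + differential (homotopy f) with hdef
  have hc : IsCochain f' := hf.add (isCochain_homotopy hf).differential
  have hd : differential f' = 0 := by
    rw [hdef, differential_add, hf', differential_differential, add_zero]
  ext l
  rcases l with _ | ⟨a, _ | ⟨b, l⟩⟩
  · simp only [word_add, const_nil, mul_nil, hdef]
    simp [tbar, ubar, bilinear, linear, differential]
  · rw [hdef, word_add, word_add, word_add, differential_single, mul_const_apply, const_cons,
      tbar, bilinear_mul_single, add_zero, add_zero, zero_add]
    refine addHom_ext (hf.argHom [] []) ((AddMonoidHom.mulRight (divX (f [gen n]))).comp (euler n))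
      (fun i hi => ?_) a
    change f [gen n ^ i] = euler n (gen n ^ i) * divX (f [gen n])
    rw [euler_gen_pow]
    cases i with
    | zero => simp [hf.map_cons_one]
    | succ i =>
      rw [apply_gen_pow_succ_of_differential_eq_zero hf hf']
      conv_lhs => rw [← divX_mul_gen _ (coord_zero_apply_gen hf hf')]
      simp only [zsmul_eq_mul]; ring
  · rw [word_add (_ + _) (const _), word_add (tbar n * _), tbar_mul_cons_cons, const_cons,
      mul_const_apply, add_zero, ubar,
      linear_apply_eq_zero _ (by simp), zero_mul, add_zero]
    have hg := (isCochain_tbar n).mul (isCochain_reduce hf)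
    rw [← tbar_mul_cons_cons]
    refine eq_of_cons_cons hc hg l (fun i j hi hj => ?_) a b
    rw [tbar_mul_cons_cons, carryHom_gen_pow hi hj]
    -- the values on words `x, x^k, …`; the cocycle condition propagates them to `x^i, x^j, …`
    have base : ∀ k, shift (gen n) f' (gen n ^ k :: l) = if k = n then reduce f l else 0 := by
      intro k
      by_cases hk : k ≤ n
      · exact differential_homotopy_gen hf hk l
      · rw [gen_pow_eq_zero (by omega), shift_apply, hc.map_cons_cons_zero, if_neg (by omega)]
    have vanish : ∀ k, k < n → shift (gen n ^ k) (shift (gen n) f') = 0 := by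
      intro k hk
      ext w
      exact (differential_homotopy_gen hf hk.le w).trans (if_neg hk.ne)
    induction i with
    | zero => rw [pow_zero, hc.map_cons_one, carry, if_neg (by omega), zero_mul]
    | succ i ih =>
      have h : differential f' (gen n :: gen n ^ i :: gen n ^ j :: l) = 0 := by rw [hd]; rfl
      rw [differential_cons_cons, ih (by omega), ← pow_succ', differential_cons_cons,
        vanish i (by omega), differential_zero, word_zero, ← pow_add, base, base, base,
        if_neg (show i ≠ n by omega)] at h
      have hb : f' (gen n :: gen n ^ j :: l) = if j = n then reduce f l else 0 := base j
      rw [hb] at h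
      have e : carry n (i + 1) j = gen n * carry n i j + if i + j = n then 1 else 0 := by
        simp only [carry]
        split_ifs with h1 h2 h3 h3
        · omega
        · rw [← pow_succ', add_zero]; congr 1; omega
        · have : i + 1 + j - (n + 1) = 0 := by omega
          simp [this]
        · omega
        · omega
        · omega
        · omega
        · simp
      rw [e]
      have h2 : (if i + j = n then reduce f l else 0)
          = (if i + j = n then 1 else 0) * reduce f l := by split_ifs <;> simp
      rw [h2] at h
      linear_combination -h

end TruncatedPolynomial

/-! ### The cohomology ring -/

namespace TruncatedPolynomial

open Hochschild Hochschild.WordFun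

variable {n : ℕ}

/-- The element `a` of the ring, as a cocycle of no arguments. -/
noncomputable def constHom (n : ℕ) : TruncPoly n →+* cocycles (TruncPoly n) where
  toFun a := ⟨const a, IsCochain.const a, differential_const a⟩
  map_zero' := Subtype.ext const_zero
  map_one' := Subtype.ext const_one
  map_add' a b := Subtype.ext (const_add a b)
  map_mul' a b := Subtype.ext (const_mul a b)

theorem coe_constHom (a : TruncPoly n) : (constHom n a : WordFun (TruncPoly n)) = const a := rfl

/-- The cocycle `ū`. -/
noncomputable def uCocycle (n : ℕ) : cocycles (TruncPoly n) :=
  ⟨ubar n, isCochain_ubar n, differential_ubar n⟩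

/-- The cocycle `t̄`. -/
noncomputable def tCocycle (n : ℕ) : cocycles (TruncPoly n) :=
  ⟨tbar n, isCochain_tbar n, differential_tbar n⟩

/-- `E` on cocycles. -/
noncomputable def reduceCocycle (z : cocycles (TruncPoly n)) : cocycles (TruncPoly n) :=
  ⟨reduce z, isCochain_reduce z.2.1, differential_reduce z.2.1 z.2.2⟩

theorem coe_reduceCocycle (z : cocycles (TruncPoly n)) :
    (reduceCocycle z : WordFun (TruncPoly n)) = reduce z := rfl

/-- The class of an element of the ring. -/
noncomputable def constClass (n : ℕ) : TruncPoly n →+* HH (TruncPoly n) :=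
  (HH.mk (TruncPoly n)).comp (constHom n)

/-- The class `u`. -/
noncomputable def uClass (n : ℕ) : HH (TruncPoly n) := HH.mk _ (uCocycle n)

/-- The class `t`. -/
noncomputable def tClass (n : ℕ) : HH (TruncPoly n) := HH.mk _ (tCocycle n)

theorem mk_surjective : Function.Surjective (HH.mk (TruncPoly n)) := Ideal.Quotient.mk_surjective

theorem mk_eq_zero_iff {z : cocycles (TruncPoly n)} :
    HH.mk (TruncPoly n) z = 0 ↔ ∃ g, IsCochain g ∧ differential g = (z : WordFun (TruncPoly n)) :=
  Ideal.Quotient.eq_zero_iff_mem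

/-- The class of a cocycle `z` is `t [E z] + u b + z()` with `x b = z(x)`. -/
theorem mk_eq (z : cocycles (TruncPoly n)) :
    HH.mk _ z = tClass n * HH.mk _ (reduceCocycle z)
      + uClass n * constClass n (divX ((z : WordFun (TruncPoly n)) [gen n]))
      + constClass n ((z : WordFun (TruncPoly n)) []) := by
  have h := add_differential_homotopy z.2.1 z.2.2
  symm
  simp only [tClass, uClass, constClass, RingHom.comp_apply, ← map_mul, ← map_add]
  rw [← sub_eq_zero, ← map_sub, mk_eq_zero_iff]
  refine ⟨homotopy z, isCochain_homotopy z.2.1, ?_⟩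
  change _ = tbar n * reduce z + ubar n * const _ + const _ - (z : WordFun (TruncPoly n))
  rw [← h, add_sub_cancel_left]

/-- The class of a cocycle of `2k` arguments. -/
theorem mk_eq_of_even (k : ℕ) (z : cocycles (TruncPoly n))
    (h : ∀ l, l.length ≠ 2 * k → (z : WordFun (TruncPoly n)) l = 0) :
    HH.mk _ z = tClass n ^ k * constClass n ((reduce^[k] (z : WordFun (TruncPoly n))) []) := by
  induction k generalizing z with
  | zero =>
    have h1 : reduceCocycle z = 0 := by
      refine Subtype.ext (WordFun.ext fun l => ?_)
      rw [coe_reduceCocycle, reduce_apply]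
      exact Finset.sum_eq_zero fun i _ => by rw [h _ (by simp), mul_zero]
    rw [mk_eq, h1, h [gen n] (by simp)]
    simp [divX]
  | succ k ih =>
    rw [mk_eq, h [gen n] (by simp; omega), h [] (by simp), ih (reduceCocycle z)]
    · simp [divX, coe_reduceCocycle, pow_succ', mul_assoc]
    · intro l hl
      rw [coe_reduceCocycle, reduce_apply]
      exact Finset.sum_eq_zero fun i _ => by rw [h _ (by simp; omega), mul_zero]

/-- The class of a cocycle of `2k + 1` arguments. -/
theorem mk_eq_of_odd (k : ℕ) (z : cocycles (TruncPoly n))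
    (h : ∀ l, l.length ≠ 2 * k + 1 → (z : WordFun (TruncPoly n)) l = 0) :
    HH.mk _ z = tClass n ^ k *
      (uClass n * constClass n (divX ((reduce^[k] (z : WordFun (TruncPoly n))) [gen n]))) := by
  induction k generalizing z with
  | zero =>
    have h1 : reduceCocycle z = 0 := by
      refine Subtype.ext (WordFun.ext fun l => ?_)
      rw [coe_reduceCocycle, reduce_apply]
      exact Finset.sum_eq_zero fun i _ => by rw [h _ (by simp), mul_zero]
    rw [mk_eq, h1, h [] (by simp)]
    simp
  | succ k ih =>
    rw [mk_eq, h [gen n] (by simp), h [] (by simp), ih (reduceCocycle z)]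
    · simp [divX, coe_reduceCocycle, pow_succ', mul_assoc]
    · intro l hl
      rw [coe_reduceCocycle, reduce_apply]
      exact Finset.sum_eq_zero fun i _ => by rw [h _ (by simp; omega), mul_zero]

/-- The elements of the ring and the classes `u` and `t` generate the cohomology ring. -/
theorem mem_subring (S : Subring (HH (TruncPoly n))) (ht : tClass n ∈ S) (hu : uClass n ∈ S)
    (hc : ∀ a, constClass n a ∈ S) (y : HH (TruncPoly n)) : y ∈ S := by
  obtain ⟨z, rfl⟩ := mk_surjective y
  obtain ⟨N, hN⟩ := z.2.1.bounded
  replace hN : ∀ l, N + 1 ≤ l.length → (z : WordFun (TruncPoly n)) l = 0 := fun l hl => hN l hl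
  generalize N + 1 = M at hN
  induction M generalizing z with
  | zero =>
    have : z = 0 := Subtype.ext (WordFun.ext fun l => hN l (Nat.zero_le _))
    rw [this, map_zero]; exact S.zero_mem
  | succ M ih =>
    rw [mk_eq]
    refine S.add_mem (S.add_mem (S.mul_mem ht (ih _ fun l hl => ?_)) (S.mul_mem hu (hc _))) (hc _)
    rw [coe_reduceCocycle, reduce_apply]
    exact Finset.sum_eq_zero fun i _ => by rw [hN _ (by simp; omega), mul_zero]

/-- For `n = 0` the ring is `ℤ`, and there are no normalized cochains with arguments. -/
theorem apply_cons_eq_zero_of_trivial {f : WordFun (TruncPoly 0)} (hf : IsCochain f)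
    (a : TruncPoly 0) (l : List (TruncPoly 0)) : f (a :: l) = 0 := by
  refine addHom_ext (hf.argHom [] l) 0 (fun i hi => ?_) a
  obtain rfl : i = 0 := by omega
  rw [pow_zero]; exact hf.map_cons_one l

theorem uClass_eq_zero : uClass 0 = 0 := by
  have : uCocycle 0 = 0 := by
    refine Subtype.ext (WordFun.ext fun l => ?_)
    cases l with
    | nil => rfl
    | cons a l => exact apply_cons_eq_zero_of_trivial (isCochain_ubar 0) a l
  rw [uClass, this, map_zero]

theorem tClass_eq_zero : tClass 0 = 0 := by
  have : tCocycle 0 = 0 := by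
    refine Subtype.ext (WordFun.ext fun l => ?_)
    cases l with
    | nil => rfl
    | cons a l => exact apply_cons_eq_zero_of_trivial (isCochain_tbar 0) a l
  rw [tClass, this, map_zero]

/-! ### The relations in the cohomology ring -/

theorem constClass_mul_comm (a : TruncPoly n) (y : HH (TruncPoly n)) :
    constClass n a * y = y * constClass n a := by
  obtain ⟨z, rfl⟩ := mk_surjective y
  have : constHom n a * z = z * constHom n a := Subtype.ext (const_mul_comm a _)
  rw [constClass, RingHom.comp_apply, ← map_mul, ← map_mul, this]

theorem ubar_mul_apply_nil (f : WordFun (TruncPoly n)) : (ubar n * f) [] = 0 := by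
  simp [mul_nil, ubar, linear]

theorem ubar_mul_cons (f : WordFun (TruncPoly n)) (a : TruncPoly n) (l : List (TruncPoly n)) :
    (ubar n * f) (a :: l) = euler n a * f l := linear_mul_cons _ _ _ _

theorem euler_gen (n : ℕ) : euler n (gen n) = gen n := by
  simpa using euler_gen_pow n 1

theorem divX_zero : divX (0 : TruncPoly n) = 0 := by simp [divX]

theorem divX_gen (hn : 1 ≤ n) : divX (gen n) = 1 := by
  have h : ∀ i, coord n (i + 1) (gen n) = if i = 0 then 1 else 0 := fun i => by
    have := coord_gen_pow (i + 1) hn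
    simpa using this
  simp only [divX, h]
  rw [Finset.sum_eq_single 0]
  · simp
  · intro i _ hi; simp [hi]
  · intro h; simp at h; omega

/-- Both `ū t̄` and `t̄ ū` have `E`-image cohomologous to `ū`. -/
theorem uClass_mul_tClass : uClass n * tClass n = tClass n * uClass n := by
  rcases Nat.eq_zero_or_pos n with rfl | hn
  · rw [uClass_eq_zero, zero_mul, mul_zero]
  · have hw : ∀ l, (reduceCocycle (uCocycle n * tCocycle n) : WordFun (TruncPoly n)) l
        = ∑ i ∈ Finset.range (n + 1), gen n ^ (n - i) * (gen n * tbar n (gen n ^ i :: l)) := by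
      intro l
      rw [coe_reduceCocycle, reduce_apply]
      refine Finset.sum_congr rfl fun i _ => ?_
      change _ * (ubar n * tbar n) _ = _
      rw [ubar_mul_cons, euler_gen]
    have hlen : ∀ l, l.length ≠ 2 * 0 + 1 →
        (reduceCocycle (uCocycle n * tCocycle n) : WordFun (TruncPoly n)) l = 0 := by
      intro l hl
      rw [hw]
      refine Finset.sum_eq_zero fun i _ => ?_
      rw [tbar, bilinear_apply_eq_zero _ (by simpa using hl), mul_zero, mul_zero]
    have hval : (reduceCocycle (uCocycle n * tCocycle n) : WordFun (TruncPoly n)) [gen n]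
        = gen n := by
      rw [hw, Finset.sum_eq_single n]
      · change _ * (_ * carryHom n (gen n ^ n) (gen n)) = _
        rw [carryHom_gen_right hn le_rfl]; simp
      · intro i hi hin
        change _ * (_ * carryHom n (gen n ^ i) (gen n)) = _
        rw [carryHom_gen_right hn (by simp at hi; omega), if_neg hin, mul_zero, mul_zero]
      · simp
    have h1 := mk_eq_of_odd 0 _ hlen
    rw [Function.iterate_zero, id, hval, divX_gen hn, map_one, mul_one, pow_zero, one_mul] at h1
    have h0 : (uCocycle n * tCocycle n : WordFun (TruncPoly n)) [gen n] = 0 := by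
      change (ubar n * tbar n) [gen n] = 0
      rw [ubar_mul_cons]; exact mul_zero _
    have h00 : (uCocycle n * tCocycle n : WordFun (TruncPoly n)) [] = 0 := ubar_mul_apply_nil _
    have h := mk_eq (uCocycle n * tCocycle n)
    rw [h1, Subring.coe_mul, h0, h00, divX_zero, map_zero, mul_zero, add_zero, add_zero,
      map_mul] at h
    exact h

theorem uClass_sq : uClass n ^ 2 = 0 := by
  have hw : reduceCocycle (uCocycle n * uCocycle n) = 0 := by
    refine Subtype.ext (WordFun.ext fun l => ?_)
    rw [coe_reduceCocycle, reduce_apply]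
    refine Finset.sum_eq_zero fun i hi => ?_
    change _ * (ubar n * ubar n) _ = 0
    rw [ubar_mul_cons, euler_gen]
    cases l with
    | nil =>
      change _ * (_ * euler n (gen n ^ i)) = 0
      rw [Finset.mem_range] at hi
      rw [euler_gen_pow, zsmul_eq_mul]
      have : gen n ^ (n - i) * (gen n * gen n ^ i) = 0 := by
        rw [← pow_succ', ← pow_add]; exact gen_pow_eq_zero (by omega)
      linear_combination ((i : ℤ) : TruncPoly n) * this
    | cons a l =>
      rw [ubar, linear_apply_eq_zero _ (by simp), mul_zero, mul_zero]
  have h := mk_eq (uCocycle n * uCocycle n)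
  have h0 : (uCocycle n * uCocycle n : WordFun (TruncPoly n)) [gen n] = 0 := by
    change (ubar n * ubar n) [gen n] = 0
    rw [ubar_mul_cons]; exact mul_zero _
  have h00 : (uCocycle n * uCocycle n : WordFun (TruncPoly n)) [] = 0 := ubar_mul_apply_nil _
  rw [hw, Subring.coe_mul, h0, h00, divX_zero, map_zero, map_zero, mul_zero, mul_zero, add_zero,
      add_zero, map_mul] at h
  rw [sq]; exact h

theorem uClass_mul_constClass : uClass n * constClass n (gen n ^ n) = 0 := by
  have : uCocycle n * constHom n (gen n ^ n) = 0 := by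
    refine Subtype.ext (WordFun.ext fun l => ?_)
    change (ubar n * const (gen n ^ n)) l = 0
    rw [mul_const_apply]
    rcases l with _ | ⟨a, _ | ⟨b, l⟩⟩
    · exact zero_mul _
    · refine addHom_ext ((AddMonoidHom.mulRight (gen n ^ n)).comp (euler n)) 0 (fun i _ => ?_) a
      change euler n (gen n ^ i) * gen n ^ n = 0
      rw [euler_gen_pow]
      cases i with
      | zero => simp
      | succ i => rw [smul_mul_assoc, ← pow_add, gen_pow_eq_zero (by omega), smul_zero]
    · exact zero_mul _
  rw [uClass, constClass, RingHom.comp_apply, ← map_mul, this, map_zero]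

/-- `(n + 1) x^n t = 0`, because `t̄ (n + 1) x^n` is, up to a coboundary, the differential of
`x^i ↦ i x^{i-1}`. -/
theorem tClass_mul_constClass :
    tClass n * constClass n ((n + 1 : TruncPoly n) * gen n ^ n) = 0 := by
  rcases Nat.eq_zero_or_pos n with rfl | hn
  · rw [tClass_eq_zero, zero_mul]
  · -- the differential of `d/dx`, which is no derivation of the truncated ring
    let g : WordFun (TruncPoly n) := linear (extend fun i => (i : ℤ) • gen n ^ (i - 1))
    have hg : IsCochain g := IsCochain.linear (by rw [extend_one]; simp)
    have hgx : g [gen n] = 1 := by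
      have := extend_gen_pow (fun i => (i : ℤ) • gen n ^ (i - 1)) hn
      simp only [Nat.succ_eq_add_one, zero_add, pow_one] at this
      change extend _ (gen n) = 1
      rw [this]; simp
    have hr : reduce g = 0 := by
      ext l
      rw [reduce_apply]
      exact Finset.sum_eq_zero fun i _ => by
        rw [linear_apply_eq_zero _ (by simp), mul_zero]
    let z : cocycles (TruncPoly n) :=
      ⟨differential g, hg.differential, differential_differential g⟩
    have hz : HH.mk _ z = 0 := mk_eq_zero_iff.mpr ⟨g, hg, rfl⟩
    have h1 : reduceCocycle z = constHom n ((n + 1 : TruncPoly n) * gen n ^ n) := by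
      refine Subtype.ext ?_
      rw [coe_reduceCocycle, coe_constHom]
      change reduce (differential g) = _
      rw [reduce_differential hg, hr, differential_zero, zero_add, hgx, mul_one]
    have h := mk_eq z
    have h0 : (z : WordFun (TruncPoly n)) [gen n] = 0 := differential_single g _
    have h00 : (z : WordFun (TruncPoly n)) [] = 0 := rfl
    rw [hz, h1, h0, h00, divX_zero, map_zero, mul_zero, add_zero, add_zero] at h
    exact h.symm

theorem tClass_mul_comm (y : HH (TruncPoly n)) : tClass n * y = y * tClass n := by
  have := mem_subring (Subring.centralizer {tClass n})
    (by simp [Subring.mem_centralizer_iff])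
    (by simp [Subring.mem_centralizer_iff, uClass_mul_tClass])
    (fun a => by simp [Subring.mem_centralizer_iff, constClass_mul_comm]) y
  simpa [Subring.mem_centralizer_iff] using this

theorem uClass_mul_comm (y : HH (TruncPoly n)) : uClass n * y = y * uClass n := by
  have := mem_subring (Subring.centralizer {uClass n})
    (by simp [Subring.mem_centralizer_iff, uClass_mul_tClass])
    (by simp [Subring.mem_centralizer_iff])
    (fun a => by simp [Subring.mem_centralizer_iff, constClass_mul_comm]) y
  simpa [Subring.mem_centralizer_iff] using this

/-- The cohomology ring is commutative, since its generators commute with each other. -/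
theorem mem_center (y : HH (TruncPoly n)) : y ∈ Subring.center (HH (TruncPoly n)) :=
  mem_subring _ (by rw [Subring.mem_center_iff]; exact fun y => (tClass_mul_comm y).symm)
    (by rw [Subring.mem_center_iff]; exact fun y => (uClass_mul_comm y).symm)
    (fun a => by rw [Subring.mem_center_iff]; exact fun y => (constClass_mul_comm a y).symm) y

/-! ### The isomorphism with the model -/

/-- The variables of the model, as elements of the cohomology ring.  The values are taken in the
center, which is the whole ring, because it comes with a commutative ring structure. -/
noncomputable def evalHom (n : ℕ) :
    MvPolynomial (Fin 3) ℤ →+* Subring.center (HH (TruncPoly n)) :=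
  MvPolynomial.eval₂Hom (Int.castRingHom _)
    ![⟨constClass n (gen n), mem_center _⟩, ⟨uClass n, mem_center _⟩, ⟨tClass n, mem_center _⟩]

/-- The ring homomorphism from the model to Hochschild cohomology. -/
noncomputable def modelHom (n : ℕ) : Model n →+* HH (TruncPoly n) :=
  (Subring.center (HH (TruncPoly n))).subtype.comp <|
    Ideal.Quotient.lift _ (evalHom n) <| by
      suffices h : Ideal.span _ ≤ RingHom.ker (evalHom n) from fun a ha => h ha
      rw [Ideal.span_le]
      rintro a (rfl | rfl | rfl | rfl) <;> rw [SetLike.mem_coe, RingHom.mem_ker] <;>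
        refine Subtype.ext ?_ <;> simp [evalHom]
      · rw [← map_pow, gen_pow_eq_zero le_rfl, map_zero]
      · exact uClass_sq
      · have h := tClass_mul_constClass (n := n)
        rw [tClass_mul_comm] at h
        simpa using h
      · rw [← map_pow]; exact uClass_mul_constClass

theorem modelHom_x : modelHom n (Model.x n) = constClass n (gen n) := by
  simp [modelHom, Model.x, evalHom]

theorem modelHom_u : modelHom n (Model.u n) = uClass n := by
  simp [modelHom, Model.u, evalHom]

theorem modelHom_t : modelHom n (Model.t n) = tClass n := by
  simp [modelHom, Model.t, evalHom]

theorem Model.x_pow (n : ℕ) : Model.x n ^ (n + 1) = 0 := by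
  rw [Model.x, ← map_pow, Ideal.Quotient.eq_zero_iff_mem]
  exact Ideal.subset_span (by simp)

theorem Model.u_sq (n : ℕ) : Model.u n ^ 2 = 0 := by
  rw [Model.u, ← map_pow, Ideal.Quotient.eq_zero_iff_mem]
  exact Ideal.subset_span (by simp)

theorem Model.x_pow_mul_t (n : ℕ) : (n + 1 : Model n) * Model.x n ^ n * Model.t n = 0 := by
  have : (n + 1 : Model n) * Model.x n ^ n * Model.t n = Ideal.Quotient.mk _
      ((n + 1 : MvPolynomial (Fin 3) ℤ) * MvPolynomial.X 0 ^ n * MvPolynomial.X 2) := by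
    simp [Model.x, Model.t]
  rw [this, Ideal.Quotient.eq_zero_iff_mem]
  exact Ideal.subset_span (by simp)

theorem Model.u_mul_x_pow (n : ℕ) : Model.u n * Model.x n ^ n = 0 := by
  rw [Model.x, Model.u, ← map_pow, ← map_mul, Ideal.Quotient.eq_zero_iff_mem]
  exact Ideal.subset_span (by simp)

/-- The inclusion of `ℤ[x]/(x^{n+1})` in the model. -/
noncomputable def Model.const (n : ℕ) : TruncPoly n →+* Model n :=
  AdjoinRoot.lift (Int.castRingHom _) (Model.x n) (by simp [Model.x_pow])

theorem Model.const_gen (n : ℕ) : Model.const n (gen n) = Model.x n := AdjoinRoot.lift_root _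

theorem modelHom_const (a : TruncPoly n) : modelHom n (Model.const n a) = constClass n a := by
  refine addHom_ext ((modelHom n).comp (Model.const n)).toAddMonoidHom
    (constClass n).toAddMonoidHom (fun i _ => ?_) a
  simp [Model.const_gen, modelHom_x]

/-- The elements of the model that are obtained from `0` by finitely many steps
`P ↦ t P + u b + a` with `a, b ∈ ℤ[x]/(x^{n+1})`. -/
inductive IsHorner (n : ℕ) : Model n → Prop
  | zero : IsHorner n 0
  | step (P : Model n) (b a : TruncPoly n) (h : IsHorner n P) :
      IsHorner n (Model.t n * P + Model.u n * Model.const n b + Model.const n a)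

theorem IsHorner.add {P Q : Model n} (hP : IsHorner n P) (hQ : IsHorner n Q) :
    IsHorner n (P + Q) := by
  induction hP generalizing Q with
  | zero => rwa [zero_add]
  | step P b a h ih =>
    cases hQ with
    | zero => rw [add_zero]; exact .step P b a h
    | step Q b' a' h' =>
      convert IsHorner.step (P + Q) (b + b') (a + a') (ih h') using 1
      rw [map_add, map_add]; ring

theorem IsHorner.x_mul {P : Model n} (hP : IsHorner n P) : IsHorner n (Model.x n * P) := by
  induction hP with
  | zero => rw [mul_zero]; exact .zero
  | step P b a h ih =>
    convert IsHorner.step _ (gen n * b) (gen n * a) ih using 1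
    rw [map_mul, map_mul, Model.const_gen]; ring

theorem IsHorner.u_mul {P : Model n} (hP : IsHorner n P) : IsHorner n (Model.u n * P) := by
  induction hP with
  | zero => rw [mul_zero]; exact .zero
  | step P b a h ih =>
    convert IsHorner.step _ a 0 ih using 1
    rw [map_zero]; linear_combination Model.const n b * Model.u_sq n

theorem IsHorner.t_mul {P : Model n} (hP : IsHorner n P) : IsHorner n (Model.t n * P) := by
  convert IsHorner.step _ 0 0 hP using 1
  rw [map_zero]; ring

/-- Every element of the model has a Horner form. -/
theorem isHorner (P : Model n) : IsHorner n P := by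
  obtain ⟨p, rfl⟩ := Ideal.Quotient.mk_surjective P
  induction p using MvPolynomial.induction_on with
  | C a =>
    convert IsHorner.step 0 0 (a : TruncPoly n) .zero using 1
    simp
  | add p q hp hq => rw [map_add]; exact hp.add hq
  | mul_X p i hp =>
    rw [map_mul, mul_comm]
    fin_cases i
    · exact hp.x_mul
    · exact hp.u_mul
    · exact hp.t_mul

theorem constClass_eq_zero {a : TruncPoly n} (h : constClass n a = 0) : a = 0 := by
  obtain ⟨g, -, hg⟩ := mk_eq_zero_iff.mp h
  have := congrArg (fun f => f.eval []) hg
  exact this.symm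

/-- Injectivity of the map from the model, by induction on the Horner form. If `t z + u b + a` is
the differential of `g`, then its value on the empty word gives `a = 0`, its value on `x` gives
`x b = 0`, and applying `E` shows that `z - (n + 1) x^n g(x)` is a coboundary. The summand `c`
absorbs this correction. -/
theorem modelHom_eq_zero {P : Model n} (hP : IsHorner n P) :
    ∀ c, modelHom n (P + Model.const n c) = 0 → P + Model.const n c = 0 := by
  induction hP with
  | zero =>
    intro c hc
    rw [zero_add, modelHom_const] at hc
    rw [constClass_eq_zero hc, map_zero, zero_add]
  | step P b a _ ih =>
    intro c hc
    obtain ⟨z, hz⟩ := mk_surjective (modelHom n P)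
    have h : HH.mk _ (tCocycle n * z + uCocycle n * constHom n b + constHom n (a + c)) = 0 := by
      simp only [map_add, map_mul, modelHom_t, modelHom_u, modelHom_const] at hc
      rw [← hc, ← hz]
      simp only [tClass, uClass, constClass, RingHom.comp_apply, ← map_mul, ← map_add]
      rw [map_add (constHom n) a c, ← add_assoc]
    obtain ⟨g, hg, hgz⟩ := mk_eq_zero_iff.mp h
    change differential g = tbar n * z + ubar n * const b + const (a + c) at hgz
    have hac : a + c = 0 := by
      have := congrArg (fun f => f.eval []) hgz
      simp only [word_add, tbar, bilinear_mul_nil, ubar_mul_apply_nil, const_nil] at this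
      rw [zero_add, zero_add] at this
      exact this.symm
    have hac' : Model.const n a + Model.const n c = 0 := by rw [← map_add, hac, map_zero]
    have hub : Model.u n * Model.const n b = 0 := by
      have := congrArg (fun f => f.eval [gen n]) hgz
      simp only [word_add, tbar, bilinear_mul_single, ubar_mul_cons, const_nil, const_cons,
        euler_gen, differential_single] at this
      rw [zero_add, add_zero, mul_comm, eq_comm] at this
      rw [eq_zsmul_of_mul_gen_eq_zero this, map_zsmul, map_pow, Model.const_gen, mul_smul_comm,
        Model.u_mul_x_pow, smul_zero]
    have htP : Model.t n * P = 0 := by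
      rcases Nat.eq_zero_or_pos n with rfl | hn
      · have := Model.x_pow_mul_t 0
        simp only [Nat.cast_zero, zero_add, pow_zero, mul_one, one_mul] at this
        rw [this, zero_mul]
      · have h1 := congrArg reduce hgz
        rw [reduce_add, reduce_add, reduce_tbar_mul hn, reduce_const, reduce_ubar_mul_const,
          add_zero, add_zero, reduce_differential hg] at h1
        have h2 : modelHom n (P + Model.const n (-((n + 1 : TruncPoly n) * gen n ^ n * g [gen n])))
            = 0 := by
          rw [map_add, modelHom_const, map_neg, ← hz, constClass, RingHom.comp_apply,
            ← sub_eq_add_neg, ← map_sub, mk_eq_zero_iff]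
          refine ⟨reduce g, isCochain_reduce hg, ?_⟩
          change _ = (z : WordFun (TruncPoly n)) - const _
          rw [← h1, add_sub_cancel_right]
        have h3 := ih _ h2
        rw [map_neg, map_mul, map_mul, map_pow, Model.const_gen] at h3
        have h4 : Model.const n (n + 1 : TruncPoly n) = (n + 1 : Model n) := by simp
        rw [h4] at h3
        linear_combination Model.t n * h3 + Model.const n (g [gen n]) * Model.x_pow_mul_t n
    rw [htP, hub, add_zero, zero_add, hac']

theorem modelHom_injective (n : ℕ) : Function.Injective (modelHom n) := by
  rw [injective_iff_map_eq_zero]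
  intro P hP
  have := modelHom_eq_zero (isHorner P) 0
  simpa using this (by simpa using hP)

theorem modelHom_surjective (n : ℕ) : Function.Surjective (modelHom n) := fun y =>
  mem_subring (modelHom n).range ⟨_, modelHom_t⟩ ⟨_, modelHom_u⟩ (fun _ => ⟨_, modelHom_const _⟩) y

/-- The isomorphism of the model with Hochschild cohomology. -/
noncomputable def modelEquiv (n : ℕ) : Model n ≃+* HH (TruncPoly n) :=
  RingEquiv.ofBijective (modelHom n) ⟨modelHom_injective n, modelHom_surjective n⟩

end TruncatedPolynomial

/-! ### Cyclic sums -/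

namespace Hochschild

open WordFun

theorem neg_one_pow_eq_of_even_add {a b : ℕ} (h : Even (a + b)) : (-1 : ℤ) ^ a = (-1) ^ b := by
  have h' : Even a ↔ Even b := Nat.even_add.mp h
  by_cases ha : Even a
  · rw [ha.neg_one_pow, (h'.mp ha).neg_one_pow]
  · rw [(Nat.not_even_iff_odd.mp ha).neg_one_pow,
      (Nat.not_even_iff_odd.mp fun hb => ha (h'.mpr hb)).neg_one_pow]

theorem sum_range_add_of_periodic {r : ℕ} {φ : ℕ → ℤ} (h : ∀ i, φ (i + r) = φ i) (j : ℕ) :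
    ∑ i ∈ Finset.range r, φ (i + j) = ∑ i ∈ Finset.range r, φ i := by
  induction j with
  | zero => rfl
  | succ j ih =>
    rw [← ih]
    have h1 := Finset.sum_range_succ (fun i => φ (i + j)) r
    have h2 := Finset.sum_range_succ' (fun i => φ (i + j)) r
    rw [h1] at h2
    have h3 : φ (r + j) = φ (0 + j) := by rw [zero_add, add_comm, h]
    rw [h3, add_left_inj] at h2
    rw [h2]
    exact Finset.sum_congr rfl fun i _ => by congr 1; ring

/-- A rotation of a word moves a letter to a place that does not depend on the letter. -/
theorem exists_rotate_append_cons {A : Type*} (i : ℕ) (l r : List A) :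
    ∃ l' r' : List A, ∀ c, (l ++ c :: r).rotate i = l' ++ c :: r' := by
  induction i with
  | zero => exact ⟨l, r, fun c => List.rotate_zero _⟩
  | succ i ih =>
    obtain ⟨l', r', h⟩ := ih
    have hs : ∀ c, (l ++ c :: r).rotate (i + 1) = (l' ++ c :: r').rotate 1 := fun c => by
      rw [← h c, List.rotate_rotate]
    cases l' with
    | nil => exact ⟨r', [], fun c => by rw [hs]; simp⟩
    | cons d l' => exact ⟨l', r' ++ [d], fun c => by rw [hs]; simp⟩

/-- The signed sum of a function over the rotations of a word. -/
def cyclicSum {A : Type*} (G : List A → ℤ) (w : List A) : ℤ :=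
  ∑ i ∈ Finset.range w.length, (-1) ^ (i * (w.length - 1)) * G (w.rotate i)

theorem cyclicSum_periodic {A : Type*} (G : List A → ℤ) (w : List A) (i : ℕ) :
    (-1) ^ ((i + w.length) * (w.length - 1)) * G (w.rotate (i + w.length))
      = (-1) ^ (i * (w.length - 1)) * G (w.rotate i) := by
  have h1 : w.rotate (i + w.length) = w.rotate i := by
    rw [add_comm, ← List.rotate_rotate, List.rotate_length]
  rw [h1, add_mul, pow_add, (Nat.even_mul_pred_self w.length).neg_one_pow, mul_one]

theorem cyclicSum_eq_sum_add {A : Type*} (G : List A → ℤ) (w : List A) (j : ℕ) :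
    cyclicSum G w = ∑ i ∈ Finset.range w.length,
      (-1) ^ ((i + j) * (w.length - 1)) * G (w.rotate (i + j)) :=
  (sum_range_add_of_periodic (φ := fun i => (-1) ^ (i * (w.length - 1)) * G (w.rotate i))
    (cyclicSum_periodic G w) j).symm

theorem cyclicSum_rotate {A : Type*} (G : List A → ℤ) (w : List A) (j : ℕ) :
    cyclicSum G (w.rotate j) = (-1) ^ (j * (w.length - 1)) * cyclicSum G w := by
  rw [cyclicSum_eq_sum_add G w j, cyclicSum, List.length_rotate, Finset.mul_sum]
  refine Finset.sum_congr rfl fun i _ => ?_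
  rw [List.rotate_rotate, add_comm j i, ← mul_assoc, ← pow_add]
  congr 1
  exact neg_one_pow_eq_of_even_add ⟨(i + j) * (w.length - 1), by ring⟩

section

variable {A : Type*} [Ring A]

theorem rotate_mergeAt {i : ℕ} {w : List A} (h : i + 1 < w.length) :
    (mergeAt i w).rotate i = mergeAt 0 (w.rotate i) := by
  have aux : ∀ (u : List A) (a b : A) (v : List A),
      mergeAt u.length (u ++ a :: b :: v) = u ++ (a * b) :: v := by
    intro u a b v
    induction u with
    | nil => rfl
    | cons c u ih => simp [mergeAt, ih]
  obtain ⟨u, a, b, v, rfl, rfl⟩ : ∃ u a b v, w = u ++ a :: b :: v ∧ u.length = i := by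
    refine ⟨w.take i, w[i], w[i + 1], w.drop (i + 2), ?_, ?_⟩
    · rw [List.getElem_cons_drop, List.getElem_cons_drop, List.take_append_drop]
    · simp; omega
  rw [aux, List.rotate_append_length_eq, List.rotate_append_length_eq]
  rfl

/-- The signed sum over the ways to multiply two neighbouring letters. -/
def barDual (G : List A → ℤ) (w : List A) : ℤ :=
  ∑ j ∈ Finset.range (w.length - 1), (-1) ^ j * G (mergeAt j w)

theorem length_mergeAt_zero {w : List A} {q : ℕ} (hq : 1 ≤ q) (hw : w.length = q + 1) :
    (mergeAt 0 w).length = q := by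
  have := length_mergeAt 0 w (by omega)
  omega

/-- Every summand on the left multiplies two neighbours of a rotation of `w`; a further rotation
moves them to the front. Sorting the summands by that rotation gives the right-hand side. -/
theorem cyclicSum_barDual (G : List A → ℤ) {w : List A} {q : ℕ} (hq : 1 ≤ q)
    (hw : w.length = q + 1) :
    cyclicSum (barDual G) w
      = ∑ i ∈ Finset.range (q + 1), (-1) ^ (i * q) * cyclicSum G (mergeAt 0 (w.rotate i)) := by
  have hlen : ∀ i, (mergeAt 0 (w.rotate i)).length = q := fun i =>
    length_mergeAt_zero hq (by rw [List.length_rotate, hw])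
  have inner : ∀ v : List A, v.length = q → cyclicSum G v
      = ∑ j ∈ Finset.range q, (-1) ^ (j + j * q) * G (v.rotate (q - j)) := by
    intro v hv
    rw [cyclicSum_eq_sum_add G v 1, hv,
      ← Finset.sum_range_reflect (fun j => (-1) ^ (j + j * q) * G (v.rotate (q - j)))]
    refine Finset.sum_congr rfl fun j hj => ?_
    rw [Finset.mem_range] at hj
    obtain ⟨s, rfl⟩ : ∃ s, q = j + 1 + s := ⟨q - j - 1, by omega⟩
    have e1 : j + 1 + s - (j + 1 + s - 1 - j) = j + 1 := by omega
    have e2 : j + 1 + s - 1 - j = s := by omega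
    have e3 : j + 1 + s - 1 = j + s := by omega
    rw [e1, e2, e3]
    congr 1
    refine neg_one_pow_eq_of_even_add ?_
    simp only [parity_simps]
    tauto
  have term : ∀ i j, j ∈ Finset.range q → G (mergeAt j (w.rotate i))
      = G ((mergeAt 0 (w.rotate (i + j))).rotate (q - j)) := by
    intro i j hj
    rw [Finset.mem_range] at hj
    have hl : j + 1 < (w.rotate i).length := by rw [List.length_rotate, hw]; omega
    have hm := length_mergeAt j _ hl
    rw [List.length_rotate, hw] at hm
    have := rotate_mergeAt hl
    rw [List.rotate_rotate] at this
    rw [← this, List.rotate_rotate, show j + (q - j) = (mergeAt j (w.rotate i)).length by omega,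
      List.rotate_length]
  have h1 : cyclicSum (barDual G) w = ∑ j ∈ Finset.range q, ∑ i ∈ Finset.range (q + 1),
      (-1) ^ (j + j * q) *
        ((-1) ^ ((i + j) * q) * G ((mergeAt 0 (w.rotate (i + j))).rotate (q - j))) := by
    rw [Finset.sum_comm]
    simp only [cyclicSum, barDual, List.length_rotate, hw, Nat.add_sub_cancel, Finset.mul_sum]
    refine Finset.sum_congr rfl fun i _ => Finset.sum_congr rfl fun j hj => ?_
    rw [term i j hj, ← mul_assoc, ← mul_assoc, ← pow_add, ← pow_add]
    congr 1
    exact neg_one_pow_eq_of_even_add ⟨i * q + j + j * q, by ring⟩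
  rw [h1]
  have h2 : ∀ j, ∑ i ∈ Finset.range (q + 1), (-1) ^ (j + j * q) *
        ((-1) ^ ((i + j) * q) * G ((mergeAt 0 (w.rotate (i + j))).rotate (q - j)))
      = ∑ i ∈ Finset.range (q + 1), (-1) ^ (j + j * q) *
        ((-1) ^ (i * q) * G ((mergeAt 0 (w.rotate i)).rotate (q - j))) := by
    intro j
    rw [← Finset.mul_sum, ← Finset.mul_sum]
    congr 1
    refine sum_range_add_of_periodic
      (φ := fun i => (-1) ^ (i * q) * G ((mergeAt 0 (w.rotate i)).rotate (q - j))) (fun i => ?_) j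
    have := cyclicSum_periodic (fun w => G ((mergeAt 0 w).rotate (q - j))) w i
    simpa only [hw, Nat.add_sub_cancel] using this
  rw [Finset.sum_congr rfl fun j _ => h2 j, Finset.sum_comm]
  refine Finset.sum_congr rfl fun i _ => ?_
  rw [inner _ (hlen i), Finset.mul_sum]
  exact Finset.sum_congr rfl fun j _ => by ring

/-- The cyclic sum intertwines the differential of the bar complex and that of the Hochschild
complex. -/
theorem barDual_cyclicSum (G : List A → ℤ) {w : List A} {q : ℕ} (hq : 1 ≤ q)
    (hw : w.length = q + 1) :
    barDual (cyclicSum G) w + (-1) ^ q * cyclicSum G (mergeAt 0 (w.rotate q))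
      = cyclicSum (barDual G) w := by
  rw [cyclicSum_barDual G hq hw, Finset.sum_range_succ, barDual, hw, Nat.add_sub_cancel]
  congr 1
  · refine Finset.sum_congr rfl fun j hj => ?_
    rw [Finset.mem_range] at hj
    have hl : j + 1 < w.length := by omega
    have hm := length_mergeAt j _ hl
    have hm' : (mergeAt j w).length = q := by omega
    rw [← rotate_mergeAt hl, cyclicSum_rotate, hm', ← mul_assoc, ← pow_add]
    congr 1
    obtain ⟨s, rfl⟩ : ∃ s, q = s + 1 := ⟨q - 1, by omega⟩
    rw [Nat.add_sub_cancel]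
    refine neg_one_pow_eq_of_even_add ⟨j * (s + 1), by ring⟩
  · congr 1
    refine neg_one_pow_eq_of_even_add ?_
    simp only [parity_simps]
    tauto

end

end Hochschild

/-! ### The operator `Δ` on cochains -/

namespace TruncatedPolynomial

open Hochschild Hochschild.WordFun

variable {n : ℕ}

theorem isCochain_bvOperator {f : WordFun (TruncPoly n)} (hf : IsCochain f) :
    IsCochain (bvOperator n f) := by
  refine ⟨fun l r a b => ?_, fun l r => ?_, ?_⟩
  · simp only [bvOperator, List.length_append, List.length_cons, ← mul_add,
      ← Finset.sum_add_distrib, ← add_smul]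
    congr 1
    refine Finset.sum_congr rfl fun j _ => Finset.sum_congr rfl fun i _ => ?_
    congr 2
    obtain ⟨l', r', h⟩ := exists_rotate_append_cons i (gen n ^ j :: l) r
    simp only [List.cons_append] at h
    rw [h, h, h, hf.map_add, topCoeff_eq_coord, map_add]
    rfl
  · have : ∀ i j, f ((gen n ^ j :: (l ++ 1 :: r)).rotate i) = 0 := by
      intro i j
      obtain ⟨l', r', h⟩ := exists_rotate_append_cons i (gen n ^ j :: l) r
      simp only [List.cons_append] at h
      rw [h, hf.map_one]
    simp [bvOperator, this, topCoeff_eq_coord]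
  · obtain ⟨N, hN⟩ := hf.bounded
    refine ⟨N, fun l hl => ?_⟩
    have : ∀ i j, f ((gen n ^ j :: l).rotate i) = 0 := fun i j => hN _ (by simp; omega)
    simp [bvOperator, this, topCoeff_eq_coord]

theorem coord_neg_one_pow_mul (i k : ℕ) (a : TruncPoly n) :
    coord n i ((-1) ^ k * a) = (-1) ^ k * coord n i a := by
  rcases Nat.even_or_odd k with h | h <;> simp [h.neg_one_pow]

/-- `⟨a, (Δ f)(l)⟩` is a cyclic sum, up to sign. -/
theorem topCoeff_mul_bvOperator {f : WordFun (TruncPoly n)} (hf : IsCochain f) (a : TruncPoly n)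
    (l : List (TruncPoly n)) :
    topCoeff n (a * bvOperator n f l)
      = (-1) ^ (l.length + 1) * cyclicSum (fun w => topCoeff n (f w)) (a :: l) := by
  choose L R hLR using fun i => exists_rotate_append_cons i ([] : List (TruncPoly n)) l
  simp only [List.nil_append] at hLR
  let φ : TruncPoly n →+ ℤ := (coord n n).comp (AddMonoidHom.mulRight (bvOperator n f l))
  let ψ : TruncPoly n →+ ℤ := ∑ i ∈ Finset.range (l.length + 1),
    (AddMonoidHom.mulLeft ((-1 : ℤ) ^ (l.length + 1) * (-1) ^ (i * l.length))).comp
      ((coord n n).comp (hf.argHom (L i) (R i)))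
  have hψ : ∀ a, ψ a = (-1) ^ (l.length + 1) * cyclicSum (fun w => topCoeff n (f w)) (a :: l) := by
    intro a
    simp only [ψ, AddMonoidHom.finsetSum_apply, AddMonoidHom.comp_apply, AddMonoidHom.coe_mulLeft,
      cyclicSum, List.length_cons, Nat.add_sub_cancel, Finset.mul_sum]
    refine Finset.sum_congr rfl fun i _ => ?_
    rw [hLR, mul_assoc]
    rfl
  rw [← hψ]
  refine addHom_ext φ ψ (fun k hk => ?_) a
  rw [hψ]
  have h1 : bvOperator n f l = ∑ j ∈ Finset.range (n + 1),
      ((-1) ^ (l.length + 1) * cyclicSum (fun w => topCoeff n (f w)) (gen n ^ j :: l)) •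
        gen n ^ (n - j) := by
    simp only [bvOperator, cyclicSum, List.length_cons, Nat.add_sub_cancel, Finset.mul_sum,
      Finset.sum_smul]
    refine Finset.sum_congr rfl fun j _ => Finset.sum_congr rfl fun i hi => ?_
    rw [Finset.mem_range] at hi
    have hsign : (-1 : ℤ) ^ (i * (l.length + 1 - i)) = (-1) ^ (i * l.length) := by
      obtain ⟨s, hs⟩ : ∃ s, l.length = i + s := ⟨l.length - i, by omega⟩
      rw [hs, show i + s + 1 - i = s + 1 by omega]
      refine neg_one_pow_eq_of_even_add ?_
      simp only [parity_simps]
      tauto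
    rw [hsign, zsmul_eq_mul, zsmul_eq_mul]
    push_cast
    ring
  simp only [φ, AddMonoidHom.comp_apply, AddMonoidHom.coe_mulRight]
  rw [h1, Finset.mul_sum, map_sum, Finset.sum_eq_single k]
  · rw [mul_smul_comm, ← pow_add, map_zsmul, show k + (n - k) = n by omega,
      coord_gen_pow n le_rfl, if_pos rfl, smul_eq_mul, mul_one]
  · intro j hj hjk
    rw [mul_smul_comm, ← pow_add, map_zsmul]
    by_cases h : k + (n - j) ≤ n
    · rw [coord_gen_pow n h, if_neg, smul_zero]
      simp at hj; omega
    · rw [gen_pow_eq_zero (j := k + (n - j)) (by omega), map_zero, smul_zero]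
  · intro h; simp at h; omega

/-- `Δ` commutes with the differential. Paired with `a₀`, both sides are cyclic sums over the word
`a₀, …`, and `barDual_cyclicSum` compares them. -/
theorem bvOperator_differential {f : WordFun (TruncPoly n)} (hf : IsCochain f) :
    bvOperator n (differential f) = differential (bvOperator n f) := by
  ext l
  cases l with
  | nil =>
    have h : differential (bvOperator n f) [] = 0 := rfl
    rw [h]
    simp only [bvOperator, List.length_nil, zero_add, Finset.sum_range_one, List.rotate_zero,
      differential_single, topCoeff_eq_coord, map_zero, mul_zero, zero_smul, Finset.sum_const_zero]
  | cons a₁ l =>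
    refine eq_of_topCoeff_mul_eq fun a₀ => ?_
    set G : List (TruncPoly n) → ℤ := fun w => topCoeff n (f w) with hG
    set w := a₀ :: a₁ :: l with hw
    set q := l.length + 1 with hq
    have hwl : w.length = q + 1 := by simp [hw, hq]
    have hlast : ∀ (b : TruncPoly n) (v : List (TruncPoly n)), (b :: v).rotate v.length
        = (b :: v).getLast (List.cons_ne_nil b v) :: (b :: v).dropLast := by
      intro b v
      conv_lhs => rw [← List.dropLast_append_getLast (List.cons_ne_nil b v)]
      have hlen : v.length = ((b :: v).dropLast).length := by simp
      rw [hlen, List.rotate_append_length_eq]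
      rfl
    -- the left-hand side: the two outer terms of the differential cancel in the cyclic sum
    have lhs : topCoeff n (a₀ * bvOperator n (differential f) (a₁ :: l))
        = (-1) ^ q * cyclicSum (barDual G) w := by
      rw [topCoeff_mul_bvOperator hf.differential]
      let F : List (TruncPoly n) → ℤ := fun v =>
        match v with
        | [] => 0
        | b :: v => topCoeff n (b * f v)
      have hF : ∀ i, topCoeff n (differential f (w.rotate i))
          = F (w.rotate i) - barDual G (w.rotate i)
            + (-1) ^ (q + 1) * F (w.rotate (i + q)) := by
        intro i
        have hlen : (w.rotate i).length = q + 1 := by rw [List.length_rotate, hwl]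
        rw [← List.rotate_rotate]
        generalize w.rotate i = v at hlen
        cases v with
        | nil => simp at hlen
        | cons b v =>
          have hv : v.length = q := by simpa using hlen
          have hr := hlast b v
          rw [hv] at hr
          rw [hr]
          simp only [F, differential, hv]
          rw [topCoeff_eq_coord, map_add, map_add, sub_eq_add_neg]
          congr 1
          · congr 1
            simp only [mid, barDual, map_sum, ← Finset.sum_neg_distrib, hG, topCoeff_eq_coord]
            refine Finset.sum_congr rfl fun i _ => ?_
            rw [coord_neg_one_pow_mul, pow_succ]; ring
          · rw [mul_assoc, coord_neg_one_pow_mul, topCoeff_eq_coord, mul_comm (f _)]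
      have hcyc : cyclicSum (fun v => topCoeff n (differential f v)) w
          = cyclicSum F w - cyclicSum (barDual G) w + (-1) ^ (q + 1) *
            ∑ i ∈ Finset.range (q + 1), (-1) ^ (i * q) * F (w.rotate (i + q)) := by
        simp only [cyclicSum, hF, hwl, Nat.add_sub_cancel, mul_add, mul_sub,
          Finset.sum_add_distrib, Finset.sum_sub_distrib]
        congr 1
        rw [Finset.mul_sum]
        exact Finset.sum_congr rfl fun i _ => by ring
      have hshift : ∑ i ∈ Finset.range (q + 1), (-1) ^ (i * q) * F (w.rotate (i + q))
          = (-1) ^ q * cyclicSum F w := by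
        rw [cyclicSum_eq_sum_add F w q, hwl, Nat.add_sub_cancel, Finset.mul_sum]
        refine Finset.sum_congr rfl fun i _ => ?_
        rw [← mul_assoc, ← pow_add]
        congr 1
        refine neg_one_pow_eq_of_even_add ?_
        simp only [parity_simps]
        tauto
      rw [hcyc, hshift, ← mul_assoc, ← pow_add,
        (show Odd (q + 1 + q) from ⟨q, by ring⟩).neg_one_pow, List.length_cons, ← hq, pow_succ]
      ring
    -- the right-hand side: the last term of the differential completes the sum over the bar terms
    have rhs : topCoeff n (a₀ * differential (bvOperator n f) (a₁ :: l))
        = (-1) ^ q * (barDual (cyclicSum G) w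
            + (-1) ^ q * cyclicSum G (mergeAt 0 (w.rotate q))) := by
      have hr : mergeAt 0 (w.rotate q)
          = ((a₁ :: l).getLast (List.cons_ne_nil a₁ l) * a₀) :: (a₁ :: l).dropLast := by
        have := hlast a₀ (a₁ :: l)
        rw [List.length_cons] at this
        rw [hw, hq, this]
        rfl
      have hK : ∀ (a : TruncPoly n) (v : List (TruncPoly n)), v.length = l.length →
          coord n n (a * bvOperator n f v) = (-1) ^ q * cyclicSum G (a :: v) := by
        intro a v hv
        have := topCoeff_mul_bvOperator hf a v
        rwa [hv] at this
      have hmid : coord n n (a₀ * mid (bvOperator n f) (a₁ :: l)) = (-1) ^ q *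
          ∑ i ∈ Finset.range l.length, (-1) ^ (i + 1) * cyclicSum G (mergeAt (i + 1) w) := by
        simp only [mid, Finset.mul_sum, map_sum, List.length_cons, Nat.add_sub_cancel]
        refine Finset.sum_congr rfl fun i hi => ?_
        rw [Finset.mem_range] at hi
        have hlen := length_mergeAt i (a₁ :: l) (by simpa using hi)
        rw [mul_left_comm, coord_neg_one_pow_mul, hK _ _ (by simpa using hlen)]
        change _ = (-1) ^ q * ((-1) ^ (i + 1) * cyclicSum G (a₀ :: mergeAt i (a₁ :: l)))
        ring
      have hbar : barDual (cyclicSum G) w = cyclicSum G ((a₀ * a₁) :: l)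
          + ∑ i ∈ Finset.range l.length, (-1) ^ (i + 1) * cyclicSum G (mergeAt (i + 1) w) := by
        rw [barDual, hwl, Nat.add_sub_cancel, hq, Finset.sum_range_succ', add_comm]
        simp [hw, mergeAt]
      have hlast' : ∀ b c : TruncPoly n, a₀ * ((-1) ^ q * b * c) = (-1) ^ q * (c * a₀ * b) := by
        intro b c; ring
      rw [topCoeff_eq_coord]
      simp only [differential]
      rw [mul_add, mul_add, map_add, map_add, hmid, ← mul_assoc, hK _ _ rfl, hbar, hr, hlast',
        coord_neg_one_pow_mul, hK _ _ (by simp)]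
      ring
    rw [lhs, rhs, barDual_cyclicSum G (by omega) hwl]

end TruncatedPolynomial

/-! ### The operator `Δ` on the monomials -/

namespace TruncatedPolynomial

open Hochschild Hochschild.WordFun

variable {n : ℕ}

/-- `E`, for arbitrary functions of words. -/
noncomputable def reduceFun (g : List (TruncPoly n) → TruncPoly n) (w : List (TruncPoly n)) :
    TruncPoly n :=
  ∑ i ∈ Finset.range (n + 1), gen n ^ (n - i) * g (gen n :: gen n ^ i :: w)

theorem reduce_iterate_apply (k : ℕ) (f : WordFun (TruncPoly n)) (w : List (TruncPoly n)) :
    (reduce^[k] f) w = reduceFun^[k] f.eval w := by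
  induction k generalizing f with
  | zero => rfl
  | succ k ih => rw [Function.iterate_succ_apply, ih]; rfl

theorem reduceFun_iterate_congr (k : ℕ) {g g' : List (TruncPoly n) → TruncPoly n}
    {v : List (TruncPoly n)} (h : ∀ w, w.length = v.length + 2 * k → g w = g' w) :
    reduceFun^[k] g v = reduceFun^[k] g' v := by
  induction k generalizing g g' with
  | zero => exact h v (by simp)
  | succ k ih =>
    rw [Function.iterate_succ_apply, Function.iterate_succ_apply]
    refine ih fun w hw => ?_
    exact Finset.sum_congr rfl fun i _ => by rw [h _ (by simp; omega)]

theorem reduceFun_add (g g' : List (TruncPoly n) → TruncPoly n) :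
    reduceFun (g + g') = reduceFun g + reduceFun g' := by
  ext w; simp [reduceFun, mul_add, Finset.sum_add_distrib]

theorem reduceFun_neg (g : List (TruncPoly n) → TruncPoly n) :
    reduceFun (-g) = -reduceFun g := by
  ext w; simp [reduceFun]

theorem reduceFun_iterate_add (k : ℕ) (g g' : List (TruncPoly n) → TruncPoly n) :
    reduceFun^[k] (g + g') = reduceFun^[k] g + reduceFun^[k] g' := by
  induction k generalizing g g' with
  | zero => rfl
  | succ k ih => simp only [Function.iterate_succ_apply, reduceFun_add, ih]

theorem reduceFun_iterate_neg (k : ℕ) (g : List (TruncPoly n) → TruncPoly n) :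
    reduceFun^[k] (-g) = -reduceFun^[k] g := by
  induction k generalizing g with
  | zero => rfl
  | succ k ih => simp only [Function.iterate_succ_apply, reduceFun_neg, ih]

/-- The sum of a function of two words over the ways to split a word in two. -/
def splitSum {A : Type*} [AddCommMonoid A] : (List A → List A → A) → List A → A
  | H, [] => H [] []
  | H, a :: w => H [] (a :: w) + splitSum (fun u v => H (a :: u) v) w

theorem splitSum_eq_sum {A : Type*} [AddCommMonoid A] (H : List A → List A → A) (w : List A) :
    splitSum H w = ∑ r ∈ Finset.range (w.length + 1), H (w.take r) (w.drop r) := by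
  induction w generalizing H with
  | nil => simp [splitSum]
  | cons a w ih =>
    rw [splitSum, ih, List.length_cons, Finset.sum_range_succ' _ (w.length + 1), add_comm]
    simp

/-- `E` in the first of two words. -/
noncomputable def reduceFst (H : List (TruncPoly n) → List (TruncPoly n) → TruncPoly n)
    (u v : List (TruncPoly n)) : TruncPoly n := reduceFun (fun u => H u v) u

/-- `E` in the second of two words. -/
noncomputable def reduceSnd (H : List (TruncPoly n) → List (TruncPoly n) → TruncPoly n)
    (u v : List (TruncPoly n)) : TruncPoly n := reduceFun (fun v => H u v) v

/-- The part of `E` in which only the letters `x^i` are inserted, in the second of two words. It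
occurs when a splitting separates the letters `x` and `x^i`. -/
noncomputable def halfReduceSnd (H : List (TruncPoly n) → List (TruncPoly n) → TruncPoly n)
    (u v : List (TruncPoly n)) : TruncPoly n :=
  ∑ i ∈ Finset.range (n + 1), gen n ^ (n - i) * H u (gen n ^ i :: v)

theorem splitSum_sum_mul (g : ℕ → TruncPoly n)
    (H : ℕ → List (TruncPoly n) → List (TruncPoly n) → TruncPoly n) (w : List (TruncPoly n)) :
    splitSum (fun u v => ∑ i ∈ Finset.range (n + 1), g i * H i u v) w
      = ∑ i ∈ Finset.range (n + 1), g i * splitSum (H i) w := by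
  simp only [splitSum_eq_sum, Finset.mul_sum]
  exact Finset.sum_comm

/-- The first two letters of a word lie in its second part, are separated by the splitting, or lie
in its first part. -/
theorem reduceFun_splitSum (H : List (TruncPoly n) → List (TruncPoly n) → TruncPoly n) :
    reduceFun (splitSum H)
      = reduceSnd H [] + halfReduceSnd H [gen n] + splitSum (reduceFst H) := by
  ext w
  have h := splitSum_sum_mul (n := n) (fun i => gen n ^ (n - i))
    (fun i u v => H (gen n :: gen n ^ i :: u) v) w
  change splitSum (reduceFst H) w = _ at h
  simp only [Pi.add_apply, h, reduceSnd, halfReduceSnd, reduceFun, splitSum, mul_add,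
    Finset.sum_add_distrib]
  ring

theorem reduceFst_reduceSnd (H : List (TruncPoly n) → List (TruncPoly n) → TruncPoly n) :
    reduceSnd (reduceFst H) = reduceFst (reduceSnd H) := by
  ext u v
  simp only [reduceFst, reduceSnd, reduceFun, Finset.mul_sum]
  rw [Finset.sum_comm]
  exact Finset.sum_congr rfl fun i _ => Finset.sum_congr rfl fun j _ => by ring

theorem reduceFst_halfReduceSnd (H : List (TruncPoly n) → List (TruncPoly n) → TruncPoly n) :
    halfReduceSnd (reduceFst H) = reduceFst (halfReduceSnd H) := by
  ext u v
  simp only [reduceFst, halfReduceSnd, reduceFun, Finset.mul_sum]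
  rw [Finset.sum_comm]
  exact Finset.sum_congr rfl fun i _ => Finset.sum_congr rfl fun j _ => by ring

theorem reduceFst_congr {H H' : List (TruncPoly n) → List (TruncPoly n) → TruncPoly n}
    {v : List (TruncPoly n)} (h : ∀ u, H u v = H' u v) (u : List (TruncPoly n)) :
    reduceFst H u v = reduceFst H' u v := by
  simp only [reduceFst, reduceFun, h]

/-- The value of `E^k` on a sum over splittings, for a sequence of functions `H k` such that `E`
maps `H (k + 1)` to `H k`, whether it is applied in the first or the second word. A word of `k`
pairs `x, x^i` is split between two pairs in `k + 1` ways, and inside a pair in `k` ways. -/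
theorem reduceFun_iterate_splitSum (k : ℕ)
    (H : ℕ → List (TruncPoly n) → List (TruncPoly n) → TruncPoly n)
    (hsnd : ∀ k, reduceSnd (H (k + 1)) = H k)
    (hfst : ∀ k u, reduceFst (H (k + 1)) u [] = H k u [])
    (hsnd' : ∀ k, reduceSnd (halfReduceSnd (H (k + 1))) = halfReduceSnd (H k))
    (hfst' : ∀ k u, reduceFst (halfReduceSnd (H (k + 2))) u [] = halfReduceSnd (H (k + 1)) u []) :
    reduceFun^[k] (splitSum (H k)) []
      = (k + 1 : ℤ) • H 0 [] [] + (k : ℤ) • halfReduceSnd (H 1) [gen n] [] := by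
  induction k generalizing H with
  | zero => simp [splitSum]
  | succ k ih =>
    have h1 : ∀ k, reduceFun^[k] (H k []) [] = H 0 [] [] := by
      intro k
      induction k with
      | zero => rfl
      | succ k ih =>
        have : reduceFun (H (k + 1) []) = H k [] := congrFun (hsnd k) []
        rw [Function.iterate_succ_apply, this, ih]
    have h2 : ∀ k, reduceFun^[k] (halfReduceSnd (H (k + 1)) [gen n]) []
        = halfReduceSnd (H 1) [gen n] [] := by
      intro k
      induction k with
      | zero => rfl
      | succ k ih =>
        have : reduceFun (halfReduceSnd (H (k + 1 + 1)) [gen n])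
            = halfReduceSnd (H (k + 1)) [gen n] := congrFun (hsnd' (k + 1)) _
        rw [Function.iterate_succ_apply, this, ih]
    have h3 := ih (fun k => reduceFst (H (k + 1)))
      (fun k => by rw [reduceFst_reduceSnd, hsnd])
      (fun k u => reduceFst_congr (hfst (k + 1)) u)
      (fun k => by
        rw [reduceFst_halfReduceSnd, reduceFst_reduceSnd, hsnd', reduceFst_halfReduceSnd])
      (fun k u => by
        rw [reduceFst_halfReduceSnd, reduceFst_halfReduceSnd]
        exact reduceFst_congr (hfst' (k + 1)) u)
    rw [Function.iterate_succ_apply, reduceFun_splitSum, reduceFun_iterate_add,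
      reduceFun_iterate_add, hsnd, Pi.add_apply, Pi.add_apply, h1, h2, h3, hfst,
      reduceFst_halfReduceSnd, hfst' 0]
    simp only [zsmul_eq_mul]
    push_cast
    ring

/-- The cochain `t̄^k ū x^l`. -/
noncomputable def oddCochain (n l k : ℕ) : WordFun (TruncPoly n) :=
  tbar n ^ k * (ubar n * const (gen n ^ l))

theorem oddCochain_succ_cons_cons (l k : ℕ) (a b : TruncPoly n) (w : List (TruncPoly n)) :
    oddCochain n l (k + 1) (a :: b :: w) = carryHom n a b * oddCochain n l k w := by
  rw [oddCochain, pow_succ' (tbar n) k, mul_assoc, tbar_mul_cons_cons]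
  rfl

theorem oddCochain_zero_single (l i : ℕ) :
    oddCochain n l 0 [gen n ^ i] = (i : ℤ) • gen n ^ (i + l) := by
  rw [oddCochain, pow_zero, one_mul, ubar_mul_cons, euler_gen_pow, const_nil, smul_mul_assoc,
    pow_add (gen n)]

/-- The sum over `j` of the coefficient of `x^n` in `t̄^k ū x^l (v, x^j, u)`, times `x^{n-j}`. -/
noncomputable def oddSplit (n l k : ℕ) (u v : List (TruncPoly n)) : TruncPoly n :=
  ∑ j ∈ Finset.range (n + 1), coord n n (oddCochain n l k (v ++ gen n ^ j :: u)) • gen n ^ (n - j)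

theorem oddCochain_gen_left (hn : 1 ≤ n) (l k i : ℕ) (hi : i ∈ Finset.range (n + 1))
    (w : List (TruncPoly n)) : oddCochain n l (k + 1) (gen n :: gen n ^ i :: w)
      = if i = n then oddCochain n l k w else 0 := by
  rw [oddCochain_succ_cons_cons, carryHom_gen_left hn (by simp at hi; omega)]
  split_ifs <;> simp

theorem oddCochain_gen_right (hn : 1 ≤ n) (l k i : ℕ) (hi : i ∈ Finset.range (n + 1))
    (w : List (TruncPoly n)) : oddCochain n l (k + 1) (gen n ^ i :: gen n :: w)
      = if i = n then oddCochain n l k w else 0 := by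
  rw [oddCochain_succ_cons_cons, carryHom_gen_right hn (by simp at hi; omega)]
  split_ifs <;> simp

theorem sum_mul_ite_eq (g : ℕ → TruncPoly n) (hg : ∀ i ∈ Finset.range (n + 1), i ≠ n → g i = 0) :
    ∑ i ∈ Finset.range (n + 1), gen n ^ (n - i) * g i = g n := by
  rw [Finset.sum_eq_single n]
  · simp
  · intro i hi hin; rw [hg i hi hin, mul_zero]
  · simp

theorem oddSplit_reduceSnd (hn : 1 ≤ n) (l k : ℕ) :
    reduceSnd (oddSplit n l (k + 1)) = oddSplit n l k := by
  ext u v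
  rw [reduceSnd, reduceFun, sum_mul_ite_eq]
  · refine Finset.sum_congr rfl fun j _ => ?_
    rw [List.cons_append, List.cons_append, oddCochain_gen_left hn _ _ _ (by simp), if_pos rfl]
  · intro i hi hin
    refine Finset.sum_eq_zero fun j _ => ?_
    rw [List.cons_append, List.cons_append, oddCochain_gen_left hn _ _ _ hi, if_neg hin, map_zero,
      zero_smul]

theorem oddSplit_reduceFst (hn : 1 ≤ n) (l k : ℕ) (u : List (TruncPoly n)) :
    reduceFst (oddSplit n l (k + 1)) u [] = oddSplit n l k u [] := by
  rw [reduceFst, reduceFun, oddSplit]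
  refine Finset.sum_congr rfl fun i _ => ?_
  rw [oddSplit, Finset.sum_eq_single n]
  · rw [List.nil_append, oddCochain_gen_right hn _ _ _ (by simp), if_pos rfl, Nat.sub_self,
      pow_zero, List.nil_append, mul_smul_comm, mul_one]
  · intro j hj hjn
    rw [List.nil_append, oddCochain_gen_right hn _ _ _ hj, if_neg hjn, map_zero, zero_smul]
  · simp

theorem oddSplit_reduceSnd_half (hn : 1 ≤ n) (l k : ℕ) :
    reduceSnd (halfReduceSnd (oddSplit n l (k + 1))) = halfReduceSnd (oddSplit n l k) := by
  ext u v
  rw [reduceSnd, reduceFun, halfReduceSnd]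
  refine Finset.sum_congr rfl fun i _ => ?_
  congr 1
  rw [halfReduceSnd, sum_mul_ite_eq]
  · refine Finset.sum_congr rfl fun j _ => ?_
    rw [List.cons_append, List.cons_append, oddCochain_gen_right hn _ _ _ (by simp), if_pos rfl]
  · intro j hj hjn
    refine Finset.sum_eq_zero fun j _ => ?_
    rw [List.cons_append, List.cons_append, oddCochain_gen_right hn _ _ _ hj, if_neg hjn, map_zero,
      zero_smul]

theorem oddSplit_reduceFst_half (hn : 1 ≤ n) (l k : ℕ) (u : List (TruncPoly n)) :
    reduceFst (halfReduceSnd (oddSplit n l (k + 2))) u []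
      = halfReduceSnd (oddSplit n l (k + 1)) u [] := by
  have key : ∀ a b w, oddCochain n l (k + 2) (a :: b :: gen n :: w)
      = carryHom n a b * oddCochain n l (k + 1) (gen n :: w) := fun a b w =>
    oddCochain_succ_cons_cons l (k + 1) a b _
  rw [reduceFst, reduceFun, sum_mul_ite_eq]
  · refine Finset.sum_congr rfl fun i _ => ?_
    congr 1
    refine Finset.sum_congr rfl fun j _ => ?_
    simp only [List.cons_append, List.nil_append]
    rw [key, oddCochain_gen_left hn _ _ _ (by simp), if_pos rfl, oddCochain_succ_cons_cons]
  · intro i hi hin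
    refine Finset.sum_eq_zero fun a _ => ?_
    rw [oddSplit, Finset.sum_eq_zero, mul_zero]
    intro j _
    simp only [List.cons_append, List.nil_append]
    rw [key, oddCochain_gen_left hn _ _ _ hi, if_neg hin, mul_zero, map_zero, zero_smul]

/-- Only `j = n - l` contributes, with coefficient `n - l`. -/
theorem oddSplit_zero {l : ℕ} (hl : l ≤ n) :
    oddSplit n l 0 [] [] = ((n : ℤ) - l) • gen n ^ l := by
  rw [oddSplit, Finset.sum_eq_single (n - l)]
  · rw [List.nil_append, oddCochain_zero_single, Nat.sub_add_cancel hl, map_zsmul,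
      coord_gen_pow n le_rfl, if_pos rfl, Nat.sub_sub_self hl, Nat.cast_sub hl]
    simp
  · intro j hj hjl
    rw [List.nil_append, oddCochain_zero_single, map_zsmul]
    by_cases h : j + l ≤ n
    · rw [coord_gen_pow n h, if_neg (by omega)]; simp
    · rw [gen_pow_eq_zero (by omega)]; simp
  · intro h; simp at h

/-- Each of the `l + 1` exponents `i ≥ n - l` contributes `x^l`. -/
theorem oddSplit_one {l : ℕ} (hl : l < n) :
    halfReduceSnd (oddSplit n l 1) [gen n] [] = ((l : ℤ) + 1) • gen n ^ l := by
  have h0 : oddCochain n l 0 [gen n] = gen n ^ (1 + l) := by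
    simpa using oddCochain_zero_single (n := n) l 1
  have hval : ∀ i j, i ≤ n → j ≤ n →
      coord n n (oddCochain n l 1 [gen n ^ i, gen n ^ j, gen n])
        = if i + j + l = 2 * n then 1 else 0 := by
    intro i j hi hj
    rw [oddCochain_succ_cons_cons, h0, carryHom_gen_pow hi hj, carry]
    split_ifs with h1 h2 h2
    · rw [← pow_add, coord_gen_pow n (by omega), if_pos (by omega)]
    · rw [← pow_add]
      by_cases h : i + j - (n + 1) + (1 + l) ≤ n
      · rw [coord_gen_pow n h, if_neg (by omega)]
      · rw [gen_pow_eq_zero (by omega), map_zero]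
    · omega
    · simp
  have hsum : ∀ i ∈ Finset.range (n + 1),
      gen n ^ (n - i) * oddSplit n l 1 [gen n] [gen n ^ i]
        = if n - l ≤ i then gen n ^ l else 0 := by
    intro i hi
    rw [Finset.mem_range] at hi
    rw [oddSplit]
    split_ifs with h
    · rw [Finset.sum_eq_single (2 * n - l - i)]
      · rw [List.cons_append, List.nil_append, hval _ _ (by omega) (by omega), if_pos (by omega),
          one_smul, ← pow_add]
        congr 1; omega
      · intro j hj hjl
        rw [Finset.mem_range] at hj
        rw [List.cons_append, List.nil_append, hval _ _ (by omega) (by omega), if_neg (by omega),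
          zero_smul]
      · intro h'; simp at h'; omega
    · rw [Finset.sum_eq_zero, mul_zero]
      intro j hj
      rw [Finset.mem_range] at hj
      rw [List.cons_append, List.nil_append, hval _ _ (by omega) (by omega), if_neg (by omega),
        zero_smul]
  rw [halfReduceSnd, Finset.sum_congr rfl hsum, ← Finset.sum_filter, Finset.sum_const]
  have hcard : (Finset.filter (fun i => n - l ≤ i) (Finset.range (n + 1))).card = l + 1 := by
    have : Finset.filter (fun i => n - l ≤ i) (Finset.range (n + 1))
        = Finset.Ico (n - l) (n + 1) := by
      ext i; simp; omega
    rw [this, Nat.card_Ico]; omega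
  rw [hcard, nsmul_eq_mul, zsmul_eq_mul]
  push_cast
  ring

/-- For a word of odd length all signs in the cyclic sum are positive. -/
theorem sum_rotate_cons {A : Type*} (G : List A → ℤ) (a : A) {w : List A} (hw : Even w.length) :
    ∑ i ∈ Finset.range (w.length + 1),
        (-1) ^ (i * (w.length + 1 - i)) * G ((a :: w).rotate i)
      = ∑ r ∈ Finset.range (w.length + 1), G (w.drop r ++ a :: w.take r) := by
  have hsign : ∀ i ∈ Finset.range (w.length + 1),
      (-1 : ℤ) ^ (i * (w.length + 1 - i)) * G ((a :: w).rotate i) = G ((a :: w).rotate i) := by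
    intro i hi
    rw [Finset.mem_range] at hi
    obtain ⟨s, hs⟩ : ∃ s, w.length = i + s := ⟨w.length - i, by omega⟩
    have he : Even (i * (s + 1)) := by
      rw [hs] at hw
      simp only [parity_simps] at hw ⊢
      tauto
    rw [hs, show i + s + 1 - i = s + 1 by omega, he.neg_one_pow, one_mul]
  rw [Finset.sum_congr rfl hsign, Finset.sum_range_succ', Finset.sum_range_succ]
  have hlast : w.drop w.length ++ a :: w.take w.length = (a :: w).rotate 0 := by simp
  rw [hlast]
  congr 1
  refine Finset.sum_congr rfl fun r hr => ?_
  rw [Finset.mem_range] at hr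
  rw [List.rotate_eq_drop_append_take (by simpa using hr.le)]
  simp

/-- The rotations of `x^j, w` correspond to the splittings of `w`. -/
theorem bvOperator_oddCochain_apply (l k : ℕ) {w : List (TruncPoly n)} (hw : Even w.length) :
    bvOperator n (oddCochain n l k) w = -splitSum (oddSplit n l k) w := by
  have h1 : splitSum (oddSplit n l k) w = ∑ j ∈ Finset.range (n + 1),
      ∑ r ∈ Finset.range (w.length + 1),
        coord n n (oddCochain n l k (w.drop r ++ gen n ^ j :: w.take r)) • gen n ^ (n - j) := by
    rw [splitSum_eq_sum]
    exact Finset.sum_comm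
  rw [h1]
  simp only [bvOperator]
  rw [hw.add_one.neg_one_pow, neg_one_mul]
  refine congrArg Neg.neg (Finset.sum_congr rfl fun j _ => ?_)
  rw [← Finset.sum_smul, ← Finset.sum_smul]
  exact congrArg (· • gen n ^ (n - j))
    (sum_rotate_cons (fun v => topCoeff n (oddCochain n l k v)) (gen n ^ j) hw)

theorem reduce_iterate_bvOperator_oddCochain (hn : 1 ≤ n) {l : ℕ} (hl : l < n) (k : ℕ) :
    (reduce^[k] (bvOperator n (oddCochain n l k))) []
      = (-((k : ℤ) + 1) * n - k + l) • gen n ^ l := by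
  rw [reduce_iterate_apply, reduceFun_iterate_congr (g' := -splitSum (oddSplit n l k)),
    reduceFun_iterate_neg, Pi.neg_apply, reduceFun_iterate_splitSum k (oddSplit n l)
      (oddSplit_reduceSnd hn l) (oddSplit_reduceFst hn l) (oddSplit_reduceSnd_half hn l)
      (oddSplit_reduceFst_half hn l), oddSplit_zero hl.le, oddSplit_one hl]
  · simp only [zsmul_eq_mul]
    push_cast
    ring
  · intro w hw
    exact bvOperator_oddCochain_apply l k (by rw [hw]; simp)

/-! ### The operator `Δ` on cohomology -/

theorem mul_apply_eq_zero {A : Type*} [Ring A] {f g : WordFun A} {p q : ℕ}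
    (hf : ∀ l : List A, l.length ≠ p → f l = 0) (hg : ∀ l : List A, l.length ≠ q → g l = 0)
    {l : List A} (hl : l.length ≠ p + q) : (f * g) l = 0 := by
  rw [word_mul]
  refine Finset.sum_eq_zero fun i hi => ?_
  rw [Finset.mem_range] at hi
  by_cases h : i = p
  · rw [hg _ (by simp; omega), mul_zero]
  · rw [hf _ (by simp; omega), zero_mul]

theorem tbar_pow_apply_eq_zero (k : ℕ) {l : List (TruncPoly n)} (hl : l.length ≠ 2 * k) :
    (tbar n ^ k) l = 0 := by
  induction k generalizing l with
  | zero =>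
    cases l with
    | nil => simp at hl
    | cons a l => rfl
  | succ k ih =>
    rw [pow_succ']
    exact mul_apply_eq_zero (p := 2) (q := 2 * k) (fun l => bilinear_apply_eq_zero _)
      (fun l => ih) (by omega)

theorem const_apply_eq_zero {A : Type*} [CommRing A] (a : A) {l : List A} (hl : l.length ≠ 0) :
    const a l = 0 := by
  cases l with
  | nil => simp at hl
  | cons b l => rfl

theorem bvOperator_apply_eq_zero {f : WordFun (TruncPoly n)} {p : ℕ}
    (hf : ∀ l : List (TruncPoly n), l.length ≠ p → f l = 0) {l : List (TruncPoly n)}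
    (hl : l.length + 1 ≠ p) : bvOperator n f l = 0 := by
  have : ∀ i j, f ((gen n ^ j :: l).rotate i) = 0 := fun i j => hf _ (by simpa using hl)
  simp [bvOperator, this, topCoeff_eq_coord]

theorem bvOperator_add (f g : WordFun (TruncPoly n)) :
    bvOperator n (f + g) = bvOperator n f + bvOperator n g := by
  ext l
  simp only [bvOperator, word_add, topCoeff_eq_coord, map_add, mul_add, add_smul,
    Finset.sum_add_distrib]

theorem bvOperator_mem {z : WordFun (TruncPoly n)} (hz : z ∈ cocycles (TruncPoly n)) :
    bvOperator n z ∈ cocycles (TruncPoly n) := by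
  refine ⟨isCochain_bvOperator hz.1, ?_⟩
  rw [← bvOperator_differential hz.1, hz.2]
  ext l
  exact bvOperator_apply_eq_zero (p := l.length) (fun _ _ => rfl) (by omega)

/-- `Δ` on cocycles, with values in cohomology. -/
noncomputable def bvCocycleHom (n : ℕ) : cocycles (TruncPoly n) →+ HH (TruncPoly n) :=
  AddMonoidHom.mk' (fun z => HH.mk _ ⟨bvOperator n z, bvOperator_mem z.2⟩) fun z z' => by
    rw [← map_add]
    exact congrArg _ (Subtype.ext (bvOperator_add _ _))

/-- The operator `Δ` on Hochschild cohomology. -/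
noncomputable def bvHom (n : ℕ) : HH (TruncPoly n) →+ HH (TruncPoly n) :=
  AddMonoidHom.liftOfSurjective (HH.mk (TruncPoly n)).toAddMonoidHom mk_surjective
    ⟨bvCocycleHom n, fun z hz => by
      obtain ⟨g, hg, h⟩ := mk_eq_zero_iff.mp hz
      refine mk_eq_zero_iff.mpr ⟨bvOperator n g, isCochain_bvOperator hg, ?_⟩
      rw [← bvOperator_differential hg, h]⟩

theorem bvHom_mk (z : cocycles (TruncPoly n)) :
    bvHom n (HH.mk _ z) = HH.mk _ ⟨bvOperator n z, bvOperator_mem z.2⟩ :=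
  AddMonoidHom.liftOfRightInverse_comp_apply _ _ _ ⟨bvCocycleHom n, _⟩ z

theorem isInducedBy_bvHom (n : ℕ) : IsInducedBy (bvOperator n) (bvHom n) := fun z =>
  ⟨bvOperator_mem z.2, bvHom_mk z⟩

theorem constClass_pow_eq_zero {l : ℕ} (hl : n + 1 ≤ l) : constClass n (gen n) ^ l = 0 := by
  rw [← map_pow, gen_pow_eq_zero hl, map_zero]

/-- `Δ (t^k u x^l)`. For `l = n` the class is zero, and the right-hand side vanishes as a multiple
of `(n + 1) t x^n`, or as `0` if `k = 0`. -/
theorem bvHom_odd (k l : ℕ) :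
    bvHom n (tClass n ^ k * uClass n * constClass n (gen n) ^ l)
      = (-((k : ℤ) + 1) * n - k + l) • (tClass n ^ k * constClass n (gen n) ^ l) := by
  rcases lt_trichotomy l n with hl | rfl | hl
  · let z : cocycles (TruncPoly n) := tCocycle n ^ k * (uCocycle n * constHom n (gen n ^ l))
    have hz : (z : WordFun (TruncPoly n)) = oddCochain n l k := rfl
    have hzc : HH.mk _ z = tClass n ^ k * uClass n * constClass n (gen n) ^ l := by
      simp only [z, map_mul, map_pow, tClass, uClass, constClass, RingHom.comp_apply, mul_assoc]
    rw [← hzc, bvHom_mk, mk_eq_of_even k, ← map_pow, ← mul_smul_comm, ← map_zsmul]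
    · change _ * constClass n ((reduce^[k] (bvOperator n z)) []) = _
      rw [hz, reduce_iterate_bvOperator_oddCochain (by omega) hl]
    · intro w hw
      refine bvOperator_apply_eq_zero (p := 2 * k + 1) (fun w hw => ?_) (by omega)
      rw [hz]
      refine mul_apply_eq_zero (fun l => tbar_pow_apply_eq_zero k) (q := 1) (fun v hv => ?_) hw
      exact mul_apply_eq_zero (p := 1) (q := 0) (fun v => linear_apply_eq_zero _)
        (fun v => const_apply_eq_zero _) hv
  · rw [mul_assoc, ← map_pow, uClass_mul_constClass, mul_zero, map_zero]
    cases k with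
    | zero => simp
    | succ k =>
      have h := tClass_mul_constClass (n := l)
      have h1 : constClass l ((l + 1 : TruncPoly l) * gen l ^ l)
          = ((l : ℤ) + 1) • constClass l (gen l ^ l) := by
        rw [map_mul, zsmul_eq_mul]; simp
      have h2 : (-(((k + 1 : ℕ) : ℤ) + 1) * l - (k + 1 : ℕ) + l)
          = (-((k : ℤ) + 1)) * (l + 1) := by push_cast; ring
      rw [h1] at h
      rw [h2, mul_smul, ← mul_smul_comm, pow_succ (tClass l), mul_assoc, h, mul_zero, smul_zero]
  · rw [constClass_pow_eq_zero hl, mul_zero, mul_zero, map_zero, smul_zero]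

/-! ### Homogeneous cochains -/

theorem isHomogeneous_const {m : ℤ} {i : ℤ} {a : TruncPoly n} (ha : a ∈ grading m n i) :
    IsHomogeneous (grading m n) (-i) (const a) := by
  intro w _
  cases w with
  | nil => exact mem_grading_of_eq ha (by simp)
  | cons q w => exact zero_mem _

theorem euler_mem_grading {m i : ℤ} {a : TruncPoly n} (ha : a ∈ grading m n i) :
    euler n a ∈ grading m n i := by
  induction ha using AddSubgroup.closure_induction with
  | mem a h =>
    obtain ⟨j, hj, rfl⟩ := h
    rw [euler_gen_pow]
    exact zsmul_mem (mem_grading_of_eq (gen_pow_mem_grading m n j) hj) _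
  | zero => rw [map_zero]; exact zero_mem _
  | add a b _ _ h h' => rw [map_add]; exact add_mem h h'
  | neg a _ h => rw [map_neg]; exact neg_mem h

theorem isHomogeneous_ubar (m : ℤ) (n : ℕ) : IsHomogeneous (grading m n) (-1) (ubar n) := by
  intro w hw
  rcases w with _ | ⟨q, _ | ⟨q', w⟩⟩
  · exact zero_mem _
  · have hq := hw q (by simp)
    change euler n q.2 ∈ _
    exact mem_grading_of_eq (euler_mem_grading hq) (by simp)
  · exact zero_mem _

theorem carryHom_mem_grading {m i j : ℤ} {a b : TruncPoly n} (ha : a ∈ grading m n i)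
    (hb : b ∈ grading m n j) : carryHom n a b ∈ grading m n (i + j - 2 * m * (n + 1)) := by
  induction ha using AddSubgroup.closure_induction with
  | mem a h =>
    obtain ⟨k, rfl, rfl⟩ := h
    induction hb using AddSubgroup.closure_induction with
    | mem b h =>
      obtain ⟨l, rfl, rfl⟩ := h
      rw [carryHom_gen_pow', carry]
      split_ifs with h1 h2
      · refine mem_grading_of_eq (gen_pow_mem_grading m n _) ?_
        rw [Nat.cast_sub h2]; push_cast; ring
      · exact zero_mem _
      · exact zero_mem _
    | zero => rw [map_zero]; exact zero_mem _
    | add b b' _ _ h h' => rw [map_add]; exact add_mem h h'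
    | neg b _ h => rw [map_neg]; exact neg_mem h
  | zero => rw [map_zero]; exact zero_mem _
  | add b b' _ _ h h' => rw [map_add]; exact add_mem h h'
  | neg b _ h => rw [map_neg]; exact neg_mem h

theorem isHomogeneous_tbar (m : ℤ) (n : ℕ) :
    IsHomogeneous (grading m n) (2 * m * n + 2 * (m - 1)) (tbar n) := by
  intro w hw
  rcases w with _ | ⟨q, _ | ⟨q', _ | ⟨q'', w⟩⟩⟩
  · exact zero_mem _
  · exact zero_mem _
  · refine mem_grading_of_eq (carryHom_mem_grading (hw q (by simp)) (hw q' (by simp))) ?_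
    simp only [List.map_cons, List.map_nil, List.sum_cons, List.sum_nil, List.length_cons,
      List.length_nil]
    push_cast; ring
  · exact zero_mem _

theorem isHomogeneous_mul {m D D' : ℤ} {f g : WordFun (TruncPoly n)}
    (hf : IsHomogeneous (grading m n) D f) (hg : IsHomogeneous (grading m n) D' g) :
    IsHomogeneous (grading m n) (D + D') (f * g) := by
  intro w hw
  rw [word_mul]
  refine sum_mem fun i hi => ?_
  have h1 := hf (w.take i) fun q hq => hw q (List.mem_of_mem_take hq)
  have h2 := hg (w.drop i) fun q hq => hw q (List.mem_of_mem_drop hq)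
  rw [← List.map_take, ← List.map_drop]
  refine mem_grading_of_eq (mul_mem_grading h1 h2) ?_
  have h3 : (w.map Prod.fst).sum
      = ((w.take i).map Prod.fst).sum + ((w.drop i).map Prod.fst).sum := by
    rw [← List.sum_append, ← List.map_append, List.take_append_drop]
  have h4 : w.length = (w.take i).length + (w.drop i).length := by
    rw [← List.length_append, List.take_append_drop]
  rw [h3, h4]; push_cast; ring

theorem isHomogeneous_one (m : ℤ) (n : ℕ) :
    IsHomogeneous (grading m n) 0 (1 : WordFun (TruncPoly n)) := by
  have := isHomogeneous_const (gen_pow_mem_grading m n 0)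
  simpa [const_one] using this

theorem isHomogeneous_pow {m D : ℤ} {f : WordFun (TruncPoly n)}
    (hf : IsHomogeneous (grading m n) D f) (k : ℕ) :
    IsHomogeneous (grading m n) (k * D) (f ^ k) := by
  induction k with
  | zero => simpa using isHomogeneous_one m n
  | succ k ih =>
    rw [pow_succ f]
    have := isHomogeneous_mul ih hf
    rwa [show ((k + 1 : ℕ) : ℤ) * D = k * D + D by push_cast; ring]

theorem isHomogeneous_reduce {m D : ℤ} {f : WordFun (TruncPoly n)}
    (hf : IsHomogeneous (grading m n) D f) :
    IsHomogeneous (grading m n) (D - (2 * m * n + 2 * (m - 1))) (reduce f) := by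
  intro w hw
  rw [reduce_apply]
  refine sum_mem fun i hi => ?_
  rw [Finset.mem_range] at hi
  have h1 := hf ((2 * m * (1 : ℕ), gen n ^ 1) :: (2 * m * i, gen n ^ i) :: w) (by
    intro q hq
    rcases List.mem_cons.mp hq with rfl | hq
    · exact gen_pow_mem_grading m n 1
    · rcases List.mem_cons.mp hq with rfl | hq
      · exact gen_pow_mem_grading m n i
      · exact hw q hq)
  rw [List.map_cons, List.map_cons, pow_one] at h1
  refine mem_grading_of_eq (mul_mem_grading (gen_pow_mem_grading m n (n - i)) h1) ?_
  simp only [List.sum_cons, List.length_cons]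
  rw [Nat.cast_sub (by omega)]; push_cast; ring

theorem isHomogeneous_bvOperator {m D : ℤ} {f : WordFun (TruncPoly n)}
    (hf : IsHomogeneous (grading m n) D f) :
    IsHomogeneous (grading m n) (D + 1) (bvOperator n f) := by
  intro w hw
  simp only [bvOperator]
  have hsgn : ∀ {i : ℤ} (k : ℕ) {a : TruncPoly n}, a ∈ grading m n i →
      (-1) ^ k * a ∈ grading m n i := by
    intro i k a ha
    rcases neg_one_pow_eq_or (TruncPoly n) k with h | h
    · rwa [h, one_mul]
    · rw [h, neg_one_mul]; exact neg_mem ha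
  refine hsgn _ (sum_mem fun j hj => sum_mem fun i _ => ?_)
  rw [Finset.mem_range] at hj
  have h1 := hf (((2 * m * j, gen n ^ j) :: w).rotate i) (by
    intro q hq
    rw [List.mem_rotate] at hq
    rcases List.mem_cons.mp hq with rfl | hq
    · exact gen_pow_mem_grading m n j
    · exact hw q hq)
  rw [List.map_rotate, List.map_rotate, List.length_rotate, (List.rotate_perm _ _).sum_eq] at h1
  simp only [List.map_cons, List.sum_cons, List.length_cons] at h1
  rw [topCoeff_eq_coord]
  by_cases h : 2 * m * n = 2 * m * j + (w.map Prod.fst).sum - ((w.length + 1 : ℕ) : ℤ) - D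
  · refine zsmul_mem (mem_grading_of_eq (gen_pow_mem_grading m n (n - j)) ?_) _
    rw [Nat.cast_sub (by omega)]
    push_cast at h ⊢
    linear_combination h
  · rw [coord_eq_zero_of_mem_grading h1 h, mul_zero, zero_smul]
    exact zero_mem _

theorem isHomogeneous_reduce_iterate {m D : ℤ} {f : WordFun (TruncPoly n)}
    (hf : IsHomogeneous (grading m n) D f) (k : ℕ) :
    IsHomogeneous (grading m n) (D - k * (2 * m * n + 2 * (m - 1)))
      (reduce^[k] f) := by
  induction k with
  | zero => simpa using hf
  | succ k ih =>
    rw [Function.iterate_succ_apply']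
    have := isHomogeneous_reduce ih
    rwa [show D - ((k + 1 : ℕ) : ℤ) * (2 * m * n + 2 * (m - 1))
      = D - k * (2 * m * n + 2 * (m - 1)) - (2 * m * n + 2 * (m - 1)) by push_cast; ring]

/-- `Δ (t^k x^l)` vanishes: neither the class nor `Δ` involves `m`, and for the grading with `m = 1`
there is no nonzero class of the degree of `Δ (t^k x^l)` with the same number of arguments. -/
theorem bvHom_even (k l : ℕ) : bvHom n (tClass n ^ k * constClass n (gen n) ^ l) = 0 := by
  rcases Nat.lt_or_ge n l with hl | hl
  · rw [constClass_pow_eq_zero hl, mul_zero, map_zero]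
  let z : cocycles (TruncPoly n) := tCocycle n ^ k * constHom n (gen n ^ l)
  have hz : (z : WordFun (TruncPoly n)) = tbar n ^ k * const (gen n ^ l) := rfl
  have hzs : ∀ w, w.length ≠ 2 * k → (z : WordFun (TruncPoly n)) w = 0 := by
    intro w hw
    rw [hz]
    exact mul_apply_eq_zero (fun l => tbar_pow_apply_eq_zero k) (q := 0)
      (fun v => const_apply_eq_zero _) hw
  have hzc : HH.mk _ z = tClass n ^ k * constClass n (gen n) ^ l := by
    simp only [z, map_mul, map_pow, tClass, constClass, RingHom.comp_apply]
  rw [← hzc, bvHom_mk]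
  cases k with
  | zero =>
    rw [mk_eq_zero_iff]
    refine ⟨0, isCochain_zero, ?_⟩
    rw [differential_zero]
    ext w
    exact (bvOperator_apply_eq_zero hzs (by omega)).symm
  | succ k =>
    rw [mk_eq_of_odd k]
    · change _ * (_ * constClass n (divX ((reduce^[k] (bvOperator n z)) [gen n]))) = 0
      have h1 := isHomogeneous_reduce_iterate (isHomogeneous_bvOperator
        (isHomogeneous_mul (isHomogeneous_pow (isHomogeneous_tbar 1 n) (k + 1))
          (isHomogeneous_const (gen_pow_mem_grading 1 n l)))) k
          [(2 * 1 * (1 : ℕ), gen n ^ 1)] (by simpa using gen_pow_mem_grading 1 n 1)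
      rw [← hz] at h1
      simp only [List.map_cons, List.map_nil, pow_one] at h1
      have h2 : divX ((reduce^[k] (bvOperator n (z : WordFun (TruncPoly n)))) [gen n]) = 0 := by
        refine Finset.sum_eq_zero fun i _ => ?_
        rw [coord_eq_zero_of_mem_grading h1, zero_smul]
        simp only [List.sum_cons, List.sum_nil, List.length_cons,
          List.length_nil]
        push_cast
        intro h
        have h3 : (l : ℤ) = n + i + 1 := by linarith
        omega
      rw [h2, map_zero, mul_zero, mul_zero]
    · intro w hw
      exact bvOperator_apply_eq_zero hzs (by omega)

end TruncatedPolynomial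

/-! ### The Batalin-Vilkovisky structure -/

namespace TruncatedPolynomial

open Hochschild Hochschild.WordFun
open LaurentPolynomial (C T T_add T_pow single_eq_C_mul_T)

variable {n : ℕ}

/-! As an ideal quotient, the model would get its addition from the quotient of modules and its
multiplication from the quotient of rings. The local instances below make both those of one
commutative ring, so that the lemmas on rings apply. -/

noncomputable local instance : CommRing (Model n) := Ideal.Quotient.commRing _
noncomputable local instance : CommSemiring (Model n) := CommRing.toCommSemiring
noncomputable local instance : Semiring (Model n) := CommSemiring.toSemiring
noncomputable local instance : Ring (Model n) := CommRing.toRing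
noncomputable local instance : AddCommGroup (Model n) := Ring.toAddCommGroup
noncomputable local instance : AddGroup (Model n) := AddCommGroup.toAddGroup
noncomputable local instance : Neg (Model n) := Ring.toNeg

/-- The monomial `t^k x^l`. -/
noncomputable def evenMono (n k l : ℕ) : Model n := Model.t n ^ k * Model.x n ^ l

/-- The monomial `t^k u x^l`. -/
noncomputable def oddMono (n k l : ℕ) : Model n := Model.t n ^ k * Model.u n * Model.x n ^ l

theorem evenMono_mul_evenMono (k l k' l' : ℕ) :
    evenMono n k l * evenMono n k' l' = evenMono n (k + k') (l + l') := by
  simp only [evenMono]; ring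

theorem evenMono_mul_oddMono (k l k' l' : ℕ) :
    evenMono n k l * oddMono n k' l' = oddMono n (k + k') (l + l') := by
  simp only [evenMono, oddMono]; ring

theorem oddMono_mul_evenMono (k l k' l' : ℕ) :
    oddMono n k l * evenMono n k' l' = oddMono n (k + k') (l + l') := by
  simp only [evenMono, oddMono]; ring

theorem oddMono_mul_oddMono (k l k' l' : ℕ) : oddMono n k l * oddMono n k' l' = 0 := by
  have : oddMono n k l * oddMono n k' l'
      = Model.t n ^ (k + k') * Model.x n ^ (l + l') * Model.u n ^ 2 := by
    simp only [oddMono]; ring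
  rw [this, Model.u_sq, mul_zero]

/-- The span of the monomials of degree `D` in the model, where `|x| = -2m`, `|u| = -1` and
`|t| = 2mn + 2(m-1)`. -/
noncomputable def modelDegree (m : ℤ) (n : ℕ) (D : ℤ) : AddSubgroup (Model n) :=
  AddSubgroup.closure
    ({P | ∃ k l : ℕ, k * (2 * m * n + 2 * (m - 1)) - 2 * m * l = D ∧ P = evenMono n k l} ∪
      {P | ∃ k l : ℕ, k * (2 * m * n + 2 * (m - 1)) - 1 - 2 * m * l = D ∧ P = oddMono n k l})

theorem evenMono_mem {m D : ℤ} {k l : ℕ} (h : k * (2 * m * n + 2 * (m - 1)) - 2 * m * l = D) :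
    evenMono n k l ∈ modelDegree m n D :=
  AddSubgroup.subset_closure (Or.inl ⟨k, l, h, rfl⟩)

theorem oddMono_mem {m D : ℤ} {k l : ℕ} (h : k * (2 * m * n + 2 * (m - 1)) - 1 - 2 * m * l = D) :
    oddMono n k l ∈ modelDegree m n D :=
  AddSubgroup.subset_closure (Or.inr ⟨k, l, h, rfl⟩)

theorem modelDegree_induction {m D : ℤ} {p : ∀ P, P ∈ modelDegree m n D → Prop}
    (even : ∀ (k l : ℕ) (h : k * (2 * m * n + 2 * (m - 1)) - 2 * m * l = D),
      p (evenMono n k l) (evenMono_mem h))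
    (odd : ∀ (k l : ℕ) (h : k * (2 * m * n + 2 * (m - 1)) - 1 - 2 * m * l = D),
      p (oddMono n k l) (oddMono_mem h))
    (zero : p 0 (zero_mem _)) (add : ∀ P Q hP hQ, p P hP → p Q hQ → p (P + Q) (add_mem hP hQ))
    (neg : ∀ P hP, p P hP → p (-P) (neg_mem hP)) {P : Model n} (hP : P ∈ modelDegree m n D) :
    p P hP := by
  induction hP using AddSubgroup.closure_induction with
  | mem P h =>
    rcases h with ⟨k, l, h, rfl⟩ | ⟨k, l, h, rfl⟩
    · exact even k l h
    · exact odd k l h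
  | zero => exact zero
  | add P Q hP hQ h h' => exact add P Q hP hQ h h'
  | neg P hP h => exact neg P hP h

theorem t_mul_mem_modelDegree {m D : ℤ} {P : Model n}
    (hP : P ∈ modelDegree m n (D - (2 * m * n + 2 * (m - 1)))) :
    Model.t n * P ∈ modelDegree m n D := by
  induction hP using modelDegree_induction with
  | even k l h =>
    have : Model.t n * evenMono n k l = evenMono n (k + 1) l := by simp only [evenMono]; ring
    rw [this]
    refine evenMono_mem ?_
    push_cast; linear_combination h
  | odd k l h =>
    have : Model.t n * oddMono n k l = oddMono n (k + 1) l := by simp only [oddMono]; ring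
    rw [this]
    refine oddMono_mem ?_
    push_cast; linear_combination h
  | zero => rw [mul_zero]; exact zero_mem _
  | add P Q _ _ h h' => rw [mul_add]; exact add_mem h h'
  | neg P _ h => rw [mul_neg]; exact neg_mem h

theorem const_mem_modelDegree {m i : ℤ} {a : TruncPoly n} (ha : a ∈ grading m n i) :
    Model.const n a ∈ modelDegree m n (-i) := by
  induction ha using AddSubgroup.closure_induction with
  | mem a h =>
    obtain ⟨j, rfl, rfl⟩ := h
    have : Model.const n (gen n ^ j) = evenMono n 0 j := by
      rw [map_pow, Model.const_gen, evenMono, pow_zero, one_mul]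
    rw [this]
    refine evenMono_mem ?_
    push_cast; ring
  | zero => rw [map_zero]; exact zero_mem _
  | add a b _ _ h h' => rw [map_add]; exact add_mem h h'
  | neg a _ h => rw [map_neg]; exact neg_mem h

theorem u_mul_const_divX (a : TruncPoly n) : Model.u n * Model.const n (divX a)
    = ∑ l ∈ Finset.range n, coord n (l + 1) a • oddMono n 0 l := by
  rw [divX, map_sum, Finset.mul_sum]
  refine Finset.sum_congr rfl fun l _ => ?_
  rw [map_zsmul, map_pow, Model.const_gen, mul_smul_comm, oddMono, pow_zero, one_mul]

/-- The homogeneous classes are the linear combinations of monomials of the same degree. -/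
theorem exists_of_mem_degree {m D : ℤ} {y : HH (TruncPoly n)}
    (hy : y ∈ HH.degree (grading m n) D) : ∃ P ∈ modelDegree m n D, modelHom n P = y := by
  obtain ⟨z, hz, rfl⟩ := hy
  obtain ⟨N, hN⟩ := z.2.1.bounded
  replace hN : ∀ l, N + 1 ≤ l.length → (z : WordFun (TruncPoly n)) l = 0 := fun l hl => hN l hl
  generalize N + 1 = M at hN
  induction M generalizing z D with
  | zero =>
    have : z = 0 := Subtype.ext (WordFun.ext fun l => hN l (Nat.zero_le _))
    exact ⟨0, zero_mem _, by rw [this, map_zero, map_zero]⟩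
  | succ M ih =>
    obtain ⟨P, hP, hPz⟩ := ih (reduceCocycle z) (isHomogeneous_reduce hz) (fun l hl => by
      rw [coe_reduceCocycle, reduce_apply]
      exact Finset.sum_eq_zero fun i _ => by rw [hN _ (by simp; omega), mul_zero])
    have h0 : (z : WordFun (TruncPoly n)) [] ∈ grading m n (-D) := by
      simpa using hz [] (by simp)
    have h1 := hz [(2 * m * (1 : ℕ), gen n ^ 1)] (by simpa using gen_pow_mem_grading m n 1)
    simp only [List.map_cons, List.map_nil, pow_one, List.sum_cons, List.sum_nil,
      List.length_cons, List.length_nil] at h1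
    refine ⟨Model.t n * P + Model.u n * Model.const n (divX ((z : WordFun (TruncPoly n)) [gen n]))
      + Model.const n ((z : WordFun (TruncPoly n)) []),
      add_mem (add_mem (t_mul_mem_modelDegree hP) ?_) ?_, ?_⟩
    · rw [u_mul_const_divX]
      refine sum_mem fun l _ => ?_
      by_cases h : 2 * m * ((l + 1 : ℕ) : ℤ)
          = 2 * m * ((1 : ℕ) : ℤ) + 0 - ((0 + 1 : ℕ) : ℤ) - D
      · refine zsmul_mem (oddMono_mem ?_) _
        push_cast at h ⊢
        linear_combination -h
      · rw [coord_eq_zero_of_mem_grading h1 h, zero_smul]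
        exact zero_mem _
    · simpa using const_mem_modelDegree h0
    · rw [mk_eq z]
      simp only [map_add, map_mul, modelHom_t, modelHom_u, modelHom_const, hPz]

theorem modelHom_evenMono (k l : ℕ) :
    modelHom n (evenMono n k l) = tClass n ^ k * constClass n (gen n) ^ l := by
  simp only [evenMono, map_mul, map_pow, modelHom_t, modelHom_x]

theorem modelHom_oddMono (k l : ℕ) :
    modelHom n (oddMono n k l) = tClass n ^ k * uClass n * constClass n (gen n) ^ l := by
  simp only [oddMono, map_mul, map_pow, modelHom_t, modelHom_u, modelHom_x]

theorem mem_degree_of_eq {m D D' : ℤ} {y : HH (TruncPoly n)}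
    (hy : y ∈ HH.degree (grading m n) D) (h : D = D') : y ∈ HH.degree (grading m n) D' := h ▸ hy

theorem mul_mem_degree {m D D' : ℤ} {y y' : HH (TruncPoly n)}
    (hy : y ∈ HH.degree (grading m n) D) (hy' : y' ∈ HH.degree (grading m n) D') :
    y * y' ∈ HH.degree (grading m n) (D + D') := by
  obtain ⟨z, hz, rfl⟩ := hy
  obtain ⟨z', hz', rfl⟩ := hy'
  exact ⟨z * z', isHomogeneous_mul hz hz', map_mul _ _ _⟩

theorem one_mem_degree (m : ℤ) (n : ℕ) : (1 : HH (TruncPoly n)) ∈ HH.degree (grading m n) 0 :=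
  ⟨1, isHomogeneous_one m n, map_one _⟩

theorem pow_mem_degree {m D : ℤ} {y : HH (TruncPoly n)} (hy : y ∈ HH.degree (grading m n) D)
    (k : ℕ) : y ^ k ∈ HH.degree (grading m n) (k * D) := by
  induction k with
  | zero => simpa using one_mem_degree m n
  | succ k ih =>
    rw [pow_succ y]
    refine mem_degree_of_eq (mul_mem_degree ih hy) ?_
    push_cast; ring

theorem tClass_mem_degree (m : ℤ) (n : ℕ) :
    tClass n ∈ HH.degree (grading m n) (2 * m * n + 2 * (m - 1)) :=
  ⟨tCocycle n, isHomogeneous_tbar m n, rfl⟩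

theorem uClass_mem_degree (m : ℤ) (n : ℕ) : uClass n ∈ HH.degree (grading m n) (-1) :=
  ⟨uCocycle n, isHomogeneous_ubar m n, rfl⟩

theorem xClass_mem_degree (m : ℤ) (n : ℕ) :
    constClass n (gen n) ∈ HH.degree (grading m n) (-2 * m) := by
  refine ⟨constHom n (gen n), ?_, rfl⟩
  have := isHomogeneous_const (gen_pow_mem_grading m n 1)
  rw [pow_one] at this
  have h : -(2 * m * ((1 : ℕ) : ℤ)) = -2 * m := by push_cast; ring
  rwa [h] at this

theorem modelHom_mem_degree {m D : ℤ} {P : Model n} (hP : P ∈ modelDegree m n D) :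
    modelHom n P ∈ HH.degree (grading m n) D := by
  induction hP using modelDegree_induction with
  | even k l h =>
    rw [modelHom_evenMono]
    refine mem_degree_of_eq (mul_mem_degree (pow_mem_degree (tClass_mem_degree m n) k)
      (pow_mem_degree (xClass_mem_degree m n) l)) ?_
    linear_combination h
  | odd k l h =>
    rw [modelHom_oddMono]
    refine mem_degree_of_eq (mul_mem_degree (mul_mem_degree
      (pow_mem_degree (tClass_mem_degree m n) k) (uClass_mem_degree m n))
      (pow_mem_degree (xClass_mem_degree m n) l)) ?_
    linear_combination h
  | zero => rw [map_zero]; exact zero_mem _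
  | add P Q _ _ h h' => rw [map_add]; exact add_mem h h'
  | neg P _ h => rw [map_neg]; exact neg_mem h

/-- The model is spanned by the monomials. -/
theorem model_induction {p : Model n → Prop} (even : ∀ k l, p (evenMono n k l))
    (odd : ∀ k l, p (oddMono n k l)) (add : ∀ P Q, p P → p Q → p (P + Q))
    (zero : p 0) (neg : ∀ P, p P → p (-P)) (P : Model n) : p P := by
  let S : AddSubgroup (Model n) :=
    { carrier := {P | p P}
      add_mem' := fun {P Q} h h' => add P Q h h'
      zero_mem' := zero
      neg_mem' := fun {P} h => neg P h }
  suffices h : ∀ k, Model.t n ^ k * P ∈ S by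
    have h0 := h 0
    rw [pow_zero, one_mul] at h0
    exact h0
  induction isHorner P with
  | zero => intro k; rw [mul_zero]; exact zero_mem S
  | step P b a _ ih =>
    intro k
    have e : Model.t n ^ k * (Model.t n * P + Model.u n * Model.const n b + Model.const n a)
        = Model.t n ^ (k + 1) * P + ∑ l ∈ Finset.range (n + 1), coord n l b • oddMono n k l
          + ∑ l ∈ Finset.range (n + 1), coord n l a • evenMono n k l := by
      conv_lhs => rw [← sum_coord n b, ← sum_coord n a]
      simp only [map_sum, map_zsmul, map_pow, Model.const_gen, mul_add, Finset.mul_sum,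
        mul_smul_comm, evenMono, oddMono]
      congr 1
      congr 1
      · ring
      · exact Finset.sum_congr rfl fun l _ => by rw [mul_assoc (Model.t n ^ k)]
    rw [e]
    exact add_mem (add_mem (ih _) (sum_mem fun l _ => zsmul_mem (odd k l) _))
      (sum_mem fun l _ => zsmul_mem (even k l) _)

/-- The ring homomorphism `x ↦ x T^{|x|}`, `u ↦ u T^{|u|}`, `t ↦ t T^{|t|}` to the Laurent
polynomials over the model. It multiplies elements of degree `D` by `T^D`, which shows that the sum
of the homogeneous components is direct. -/
noncomputable def weightHom (m : ℤ) (n : ℕ) : Model n →+* LaurentPolynomial (Model n) :=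
  Ideal.Quotient.lift _ (MvPolynomial.eval₂Hom (Int.castRingHom _)
    ![C (Model.x n) * T (-2 * m), C (Model.u n) * T (-1),
      C (Model.t n) * T (2 * m * n + 2 * (m - 1))]) <| by
    set φ := MvPolynomial.eval₂Hom (Int.castRingHom (LaurentPolynomial (Model n)))
      ![C (Model.x n) * T (-2 * m), C (Model.u n) * T (-1),
        C (Model.t n) * T (2 * m * n + 2 * (m - 1))] with hφ
    have h0 : φ (MvPolynomial.X 0) = C (Model.x n) * T (-2 * m) := MvPolynomial.eval₂_X _ _ _
    have h1 : φ (MvPolynomial.X 1) = C (Model.u n) * T (-1) := MvPolynomial.eval₂_X _ _ _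
    have h2 : φ (MvPolynomial.X 2) = C (Model.t n) * T (2 * m * n + 2 * (m - 1)) :=
      MvPolynomial.eval₂_X _ _ _
    suffices h : Ideal.span _ ≤ RingHom.ker φ from fun a ha => h ha
    rw [Ideal.span_le]
    rintro a (rfl | rfl | rfl | rfl) <;> rw [SetLike.mem_coe, RingHom.mem_ker]
    · rw [map_pow, h0, mul_pow, ← map_pow, Model.x_pow, map_zero, zero_mul]
    · rw [map_pow, h1, mul_pow, ← map_pow, Model.u_sq, map_zero, zero_mul]
    · have h := congrArg C (Model.x_pow_mul_t n)
      simp only [map_mul, map_add, map_natCast, map_one, map_pow, map_zero] at h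
      simp only [map_mul, map_add, map_natCast, map_one, map_pow, h0, h2]
      linear_combination (T (-2 * m) ^ n * T (2 * m * n + 2 * (m - 1))) * h
    · have h := congrArg C (Model.u_mul_x_pow n)
      simp only [map_mul, map_pow, map_zero] at h
      simp only [map_mul, map_pow, h0, h1]
      linear_combination (T (-1) * T (-2 * m) ^ n) * h

theorem weightHom_x (m : ℤ) (n : ℕ) :
    weightHom m n (Model.x n) = C (Model.x n) * T (-2 * m) :=
  (Ideal.Quotient.lift_mk _ _ _).trans (MvPolynomial.eval₂_X _ _ _)

theorem weightHom_u (m : ℤ) (n : ℕ) :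
    weightHom m n (Model.u n) = C (Model.u n) * T (-1) :=
  (Ideal.Quotient.lift_mk _ _ _).trans (MvPolynomial.eval₂_X _ _ _)

theorem weightHom_t (m : ℤ) (n : ℕ) :
    weightHom m n (Model.t n) = C (Model.t n) * T (2 * m * n + 2 * (m - 1)) :=
  (Ideal.Quotient.lift_mk _ _ _).trans (MvPolynomial.eval₂_X _ _ _)

theorem weightHom_of_mem {m D : ℤ} {P : Model n} (hP : P ∈ modelDegree m n D) :
    weightHom m n P = C P * T D := by
  induction hP using modelDegree_induction with
  | even k l h =>
    have hT : (T D : LaurentPolynomial (Model n))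
        = T (k * (2 * m * n + 2 * (m - 1))) * T (l * (-2 * m)) := by
      rw [← T_add]; congr 1; linear_combination -h
    simp only [evenMono, map_mul, map_pow, weightHom_t, weightHom_x, mul_pow, T_pow, hT]
    ring
  | odd k l h =>
    have hT : (T D : LaurentPolynomial (Model n))
        = T (k * (2 * m * n + 2 * (m - 1))) * T (-1) * T (l * (-2 * m)) := by
      rw [← T_add, ← T_add]; congr 1; linear_combination -h
    simp only [oddMono, map_mul, map_pow, weightHom_t, weightHom_x, weightHom_u, mul_pow, T_pow, hT]
    ring
  | zero => rw [map_zero, map_zero, zero_mul]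
  | add P Q _ _ h h' => rw [map_add, h, h', map_add, add_mul]
  | neg P _ h => rw [map_neg, h, map_neg, neg_mul]

theorem coeff_C_mul_T (P : Model n) (D D' : ℤ) :
    (C P * T D : LaurentPolynomial (Model n)).coeff D' = if D = D' then P else 0 := by
  rw [← single_eq_C_mul_T, AddMonoidAlgebra.coeff_single, Finsupp.single_apply]

theorem isInternal_degree (m : ℤ) (n : ℕ) :
    DirectSum.IsInternal (HH.degree (A := TruncPoly n) (grading m n)) := by
  constructor
  · let φ : DirectSum ℤ (fun D => HH.degree (A := TruncPoly n) (grading m n) D) →+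
        LaurentPolynomial (Model n) :=
      ((weightHom m n).toAddMonoidHom.comp (modelEquiv n).symm.toRingHom.toAddMonoidHom).comp
        (DirectSum.coeAddMonoidHom (HH.degree (A := TruncPoly n) (grading m n)))
    have hφ : ∀ v D, (φ v).coeff D = (modelEquiv n).symm (v D) := by
      intro v D
      induction v using DirectSum.induction_on with
      | zero => simp
      | of D' y =>
        obtain ⟨P, hP, hPy⟩ := exists_of_mem_degree y.2
        have hsymm : (modelEquiv n).symm (y : HH (TruncPoly n)) = P := by
          rw [RingEquiv.symm_apply_eq]; exact hPy.symm
        have h1 : φ (DirectSum.of _ D' y) = C P * T D' := by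
          change weightHom m n ((modelEquiv n).symm (DirectSum.coeAddMonoidHom _
            (DirectSum.of _ D' y))) = _
          rw [DirectSum.coeAddMonoidHom_of, hsymm, weightHom_of_mem hP]
        rw [h1, coeff_C_mul_T]
        split_ifs with h
        · subst h
          rw [DirectSum.of_eq_same, hsymm]
        · rw [DirectSum.of_eq_of_ne _ _ _ (Ne.symm h), ZeroMemClass.coe_zero, map_zero]
      | add v w hv hw =>
        rw [map_add, DirectSum.add_apply, AddSubgroup.coe_add, map_add, ← hv, ← hw]
        rfl
    rw [injective_iff_map_eq_zero]
    intro v hv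
    refine DFinsupp.ext fun D => Subtype.ext ?_
    have h1 : φ v = 0 := by
      change weightHom m n ((modelEquiv n).symm (DirectSum.coeAddMonoidHom _ v)) = 0
      rw [hv, map_zero, map_zero]
    have h2 := hφ v D
    rw [h1] at h2
    exact (map_eq_zero_iff _ (modelEquiv n).symm.injective).mp h2.symm
  · intro y
    obtain ⟨P, rfl⟩ := modelHom_surjective n y
    have hof : ∀ {D : ℤ} {P : Model n}, P ∈ modelDegree m n D → ∃ v,
        DirectSum.coeAddMonoidHom (HH.degree (A := TruncPoly n) (grading m n)) v
          = modelHom n P := fun {D P} hP =>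
      ⟨DirectSum.of _ D ⟨_, modelHom_mem_degree hP⟩, DirectSum.coeAddMonoidHom_of _ _ _⟩
    induction P using model_induction with
    | even k l => exact hof (evenMono_mem rfl)
    | odd k l => exact hof (oddMono_mem rfl)
    | add P Q hP hQ =>
      obtain ⟨v, hv⟩ := hP
      obtain ⟨w, hw⟩ := hQ
      exact ⟨v + w, by rw [map_add, hv, hw, map_add]⟩
    | zero => exact ⟨0, by rw [map_zero, map_zero]⟩
    | neg P hP =>
      obtain ⟨v, hv⟩ := hP
      exact ⟨-v, by rw [map_neg, hv, map_neg]⟩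

/-- The operator `Δ` on the model. -/
noncomputable def bvModel (n : ℕ) : Model n →+ Model n :=
  (modelEquiv n).symm.toRingHom.toAddMonoidHom.comp
    ((bvHom n).comp (modelHom n).toAddMonoidHom)

theorem bvHom_modelHom (P : Model n) : bvHom n (modelHom n P) = modelHom n (bvModel n P) :=
  ((modelEquiv n).apply_symm_apply (bvHom n (modelHom n P))).symm

theorem bvModel_evenMono (k l : ℕ) : bvModel n (evenMono n k l) = 0 := by
  refine modelHom_injective n ?_
  rw [← bvHom_modelHom, modelHom_evenMono, bvHom_even, map_zero]

theorem bvModel_oddMono (k l : ℕ) :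
    bvModel n (oddMono n k l) = (-((k : ℤ) + 1) * n - k + l) • evenMono n k l := by
  refine modelHom_injective n ?_
  rw [← bvHom_modelHom, modelHom_oddMono, bvHom_odd, map_zsmul, modelHom_evenMono]

theorem bvModel_mem {m D : ℤ} {P : Model n} (hP : P ∈ modelDegree m n D) :
    bvModel n P ∈ modelDegree m n (D + 1) := by
  induction hP using modelDegree_induction with
  | even k l h => rw [bvModel_evenMono]; exact zero_mem _
  | odd k l h =>
    rw [bvModel_oddMono]
    refine zsmul_mem (evenMono_mem ?_) _
    linear_combination h
  | zero => rw [map_zero]; exact zero_mem _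
  | add P Q _ _ h h' => rw [map_add]; exact add_mem h h'
  | neg P _ h => rw [map_neg]; exact neg_mem h

theorem bvModel_bvModel (P : Model n) : bvModel n (bvModel n P) = 0 := by
  induction P using model_induction with
  | even k l => rw [bvModel_evenMono, map_zero]
  | odd k l => rw [bvModel_oddMono, map_zsmul, bvModel_evenMono, smul_zero]
  | add P Q h h' => rw [map_add, map_add, h, h', add_zero]
  | zero => rw [map_zero, map_zero]
  | neg P h => rw [map_neg, map_neg, h, neg_zero]

theorem even_of_degree {m i : ℤ} {k l : ℕ}
    (h : k * (2 * m * n + 2 * (m - 1)) - 2 * m * l = i) : Even i :=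
  ⟨k * (m * n + (m - 1)) - m * l, by rw [← h]; ring⟩

theorem odd_of_degree {m i : ℤ} {k l : ℕ}
    (h : k * (2 * m * n + 2 * (m - 1)) - 1 - 2 * m * l = i) : Odd i :=
  ⟨k * (m * n + (m - 1)) - m * l - 1, by rw [← h]; ring⟩

theorem model_graded_comm {m i j : ℤ} {P Q : Model n} (hP : P ∈ modelDegree m n i)
    (hQ : Q ∈ modelDegree m n j) : P * Q = ((i * j).negOnePow : ℤ) • (Q * P) := by
  induction hP using modelDegree_induction with
  | even k l h =>
    rw [Int.negOnePow_even _ ((even_of_degree h).mul_right j), Units.val_one, one_smul, mul_comm]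
  | odd k l h =>
    induction hQ using modelDegree_induction with
    | even k' l' h' =>
      rw [Int.negOnePow_even _ ((even_of_degree h').mul_left i), Units.val_one, one_smul, mul_comm]
    | odd k' l' h' => rw [oddMono_mul_oddMono, oddMono_mul_oddMono, smul_zero]
    | zero => simp
    | add P Q _ _ h h' => rw [mul_add, add_mul, smul_add, h, h']
    | neg P _ h => rw [mul_neg, neg_mul, smul_neg, h]
  | zero => simp
  | add P Q _ _ h h' => rw [mul_add, add_mul, smul_add, h, h']
  | neg P _ h => rw [mul_neg, neg_mul, smul_neg, h]

/-- The seven-term relation in the model, with the signs as parameters. -/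
def SevenTerm (n : ℕ) (s s' s'' : ℤ) (P Q R : Model n) : Prop :=
  bvModel n (P * Q * R) = bvModel n (P * Q) * R + s • (P * bvModel n (Q * R))
    + s' • (Q * bvModel n (P * R)) - bvModel n P * Q * R - s • (P * bvModel n Q * R)
    - s'' • (P * Q * bvModel n R)

theorem SevenTerm.of_mono {s s' s'' : ℤ} {P Q : Model n}
    (even : ∀ k l, SevenTerm n s s' s'' P Q (evenMono n k l))
    (odd : ∀ k l, SevenTerm n s s' s'' P Q (oddMono n k l)) (R : Model n) :
    SevenTerm n s s' s'' P Q R := by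
  induction R using model_induction with
  | even k l => exact even k l
  | odd k l => exact odd k l
  | add R R' h h' =>
    simp only [SevenTerm, mul_add, map_add, smul_add] at h h' ⊢
    rw [h, h']; abel
  | zero => simp [SevenTerm]
  | neg R h =>
    simp only [SevenTerm, mul_neg, map_neg, smul_neg] at h ⊢
    rw [h]; abel

theorem sevenTerm_even_even (k l k' l' : ℕ) (R : Model n) :
    SevenTerm n 1 1 1 (evenMono n k l) (evenMono n k' l') R := by
  refine SevenTerm.of_mono (fun k'' l'' => ?_) (fun k'' l'' => ?_) R <;>
    simp only [SevenTerm, evenMono_mul_evenMono, evenMono_mul_oddMono, bvModel_evenMono,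
      bvModel_oddMono, zero_mul, mul_zero, smul_zero, mul_smul_comm]
  · simp
  · simp only [evenMono, zsmul_eq_mul]
    push_cast
    ring

theorem sevenTerm_even_odd (k l k' l' : ℕ) (R : Model n) :
    SevenTerm n 1 (-1) (-1) (evenMono n k l) (oddMono n k' l') R := by
  refine SevenTerm.of_mono (fun k'' l'' => ?_) (fun k'' l'' => ?_) R <;>
    simp only [SevenTerm, evenMono_mul_evenMono, evenMono_mul_oddMono, oddMono_mul_evenMono,
      oddMono_mul_oddMono, bvModel_evenMono, bvModel_oddMono, zero_mul, mul_zero, smul_zero,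
      mul_smul_comm, smul_mul_assoc, map_zero] <;>
    simp only [evenMono, oddMono, zsmul_eq_mul] <;>
    push_cast <;>
    ring

theorem sevenTerm_odd_even (k l k' l' : ℕ) (R : Model n) :
    SevenTerm n (-1) 1 (-1) (oddMono n k l) (evenMono n k' l') R := by
  refine SevenTerm.of_mono (fun k'' l'' => ?_) (fun k'' l'' => ?_) R <;>
    simp only [SevenTerm, evenMono_mul_evenMono, evenMono_mul_oddMono, oddMono_mul_evenMono,
      oddMono_mul_oddMono, bvModel_evenMono, bvModel_oddMono, zero_mul, mul_zero, smul_zero,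
      mul_smul_comm, smul_mul_assoc, map_zero] <;>
    simp only [evenMono, oddMono, zsmul_eq_mul] <;>
    push_cast <;>
    ring

theorem sevenTerm_odd_odd (k l k' l' : ℕ) (R : Model n) :
    SevenTerm n (-1) 1 1 (oddMono n k l) (oddMono n k' l') R := by
  refine SevenTerm.of_mono (fun k'' l'' => ?_) (fun k'' l'' => ?_) R <;>
    simp only [SevenTerm, evenMono_mul_oddMono, oddMono_mul_evenMono,
      oddMono_mul_oddMono, bvModel_evenMono, bvModel_oddMono, zero_mul, mul_zero, smul_zero,
      mul_smul_comm, smul_mul_assoc, map_zero]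
  · simp only [oddMono, zsmul_eq_mul]
    push_cast
    ring
  · simp

theorem sevenTerm {m i j : ℤ} {P Q : Model n} (R : Model n) (hP : P ∈ modelDegree m n i)
    (hQ : Q ∈ modelDegree m n j) : SevenTerm n (i.negOnePow : ℤ) (((i - 1) * j).negOnePow : ℤ)
      ((i + j).negOnePow : ℤ) P Q R := by
  induction hP using modelDegree_induction with
  | zero => simp [SevenTerm]
  | add P P' _ _ h h' =>
    simp only [SevenTerm, add_mul, map_add, smul_add, mul_add] at h h' ⊢
    rw [h, h']; abel
  | neg P _ h =>
    simp only [SevenTerm, neg_mul, map_neg, smul_neg, mul_neg] at h ⊢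
    rw [h]; abel
  | even k l hi =>
    have hi' := even_of_degree hi
    induction hQ using modelDegree_induction with
    | zero => simp [SevenTerm]
    | add P P' _ _ h h' =>
      simp only [SevenTerm, add_mul, map_add, smul_add, mul_add] at h h' ⊢
      rw [h, h']; abel
    | neg P _ h =>
      simp only [SevenTerm, neg_mul, map_neg, smul_neg, mul_neg] at h ⊢
      rw [h]; abel
    | even k' l' hj =>
      have hj' := even_of_degree hj
      rw [Int.negOnePow_even _ hi', Int.negOnePow_even _ (hj'.mul_left _),
        Int.negOnePow_even _ (hi'.add hj')]
      exact sevenTerm_even_even k l k' l' R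
    | odd k' l' hj =>
      have hj' := odd_of_degree hj
      rw [Int.negOnePow_even _ hi', Int.negOnePow_odd _ ((hi'.sub_odd odd_one).mul hj'),
        Int.negOnePow_odd _ (hi'.add_odd hj')]
      exact sevenTerm_even_odd k l k' l' R
  | odd k l hi =>
    have hi' := odd_of_degree hi
    induction hQ using modelDegree_induction with
    | zero => simp [SevenTerm]
    | add P P' _ _ h h' =>
      simp only [SevenTerm, add_mul, map_add, smul_add, mul_add] at h h' ⊢
      rw [h, h']; abel
    | neg P _ h =>
      simp only [SevenTerm, neg_mul, map_neg, smul_neg, mul_neg] at h ⊢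
      rw [h]; abel
    | even k' l' hj =>
      have hj' := even_of_degree hj
      rw [Int.negOnePow_odd _ hi', Int.negOnePow_even _ (hj'.mul_left _),
        Int.negOnePow_odd _ (hi'.add_even hj')]
      exact sevenTerm_odd_even k l k' l' R
    | odd k' l' hj =>
      have hj' := odd_of_degree hj
      rw [Int.negOnePow_odd _ hi', Int.negOnePow_even _ ((hi'.sub_odd odd_one).mul_right _),
        Int.negOnePow_even _ (hi'.add_odd hj')]
      exact sevenTerm_odd_odd k l k' l' R

theorem isBVAlgebra (m : ℤ) (n : ℕ) :
    IsBVAlgebra (HH.degree (A := TruncPoly n) (grading m n)) (bvHom n) where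
  isInternal := isInternal_degree m n
  one_mem := one_mem_degree m n
  mul_mem _ _ _ _ := mul_mem_degree
  graded_comm i j a b ha hb := by
    obtain ⟨P, hP, rfl⟩ := exists_of_mem_degree ha
    obtain ⟨Q, hQ, rfl⟩ := exists_of_mem_degree hb
    rw [← map_mul, ← map_mul, model_graded_comm hP hQ, map_zsmul]
  map_degree i a ha := by
    obtain ⟨P, hP, rfl⟩ := exists_of_mem_degree ha
    rw [bvHom_modelHom]
    exact modelHom_mem_degree (bvModel_mem hP)
  square_zero a := by
    obtain ⟨P, rfl⟩ := modelHom_surjective n a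
    rw [bvHom_modelHom, bvHom_modelHom, bvModel_bvModel, map_zero]
  seven_term i j a b c ha hb := by
    obtain ⟨P, hP, rfl⟩ := exists_of_mem_degree ha
    obtain ⟨Q, hQ, rfl⟩ := exists_of_mem_degree hb
    obtain ⟨R, rfl⟩ := modelHom_surjective n c
    simp only [← map_mul, bvHom_modelHom, ← map_zsmul, ← map_add, ← map_sub]
    exact congrArg _ (sevenTerm R hP hQ)

theorem isXBar_const (n : ℕ) : IsXBar n (const (gen n)) :=
  ⟨rfl, fun _ => const_apply_eq_zero _⟩

theorem isUBar_ubar (n : ℕ) : IsUBar n (ubar n) :=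
  ⟨fun i _ => euler_gen_pow n i, fun _ => linear_apply_eq_zero _⟩

theorem isTBar_tbar (n : ℕ) : IsTBar n (tbar n) :=
  ⟨fun _ _ hi hj => carryHom_gen_pow hi hj, fun _ => bilinear_apply_eq_zero _⟩

end TruncatedPolynomial

theorem mainTheorem1 (m : ℤ) (n : ℕ) :
    ∃ Δ : Hochschild.HH (TruncatedPolynomial.TruncPoly n) →+
        Hochschild.HH (TruncatedPolynomial.TruncPoly n),
      Hochschild.IsInducedBy (TruncatedPolynomial.bvOperator n) Δ ∧
      IsBVAlgebra (Hochschild.HH.degree (TruncatedPolynomial.grading m n)) Δ ∧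
      ∃ Φ : TruncatedPolynomial.Model n ≃+* Hochschild.HH (TruncatedPolynomial.TruncPoly n),
        (∃ z : Hochschild.cocycles (TruncatedPolynomial.TruncPoly n),
          TruncatedPolynomial.IsXBar n z ∧
            Φ (TruncatedPolynomial.Model.x n) = Hochschild.HH.mk _ z) ∧
        (∃ z : Hochschild.cocycles (TruncatedPolynomial.TruncPoly n),
          TruncatedPolynomial.IsUBar n z ∧
            Φ (TruncatedPolynomial.Model.u n) = Hochschild.HH.mk _ z) ∧
        (∃ z : Hochschild.cocycles (TruncatedPolynomial.TruncPoly n),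
          TruncatedPolynomial.IsTBar n z ∧
            Φ (TruncatedPolynomial.Model.t n) = Hochschild.HH.mk _ z) ∧
        Φ (TruncatedPolynomial.Model.x n) ∈
          Hochschild.HH.degree (TruncatedPolynomial.grading m n) (-2 * m) ∧
        Φ (TruncatedPolynomial.Model.u n) ∈
          Hochschild.HH.degree (TruncatedPolynomial.grading m n) (-1) ∧
        Φ (TruncatedPolynomial.Model.t n) ∈
          Hochschild.HH.degree (TruncatedPolynomial.grading m n) (2 * m * n + 2 * (m - 1)) ∧
        (∀ k l : ℕ,
          Δ (Φ (TruncatedPolynomial.Model.t n ^ k * TruncatedPolynomial.Model.x n ^ l)) = 0) ∧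
        ∀ k l : ℕ,
          Δ (Φ (TruncatedPolynomial.Model.t n ^ k * TruncatedPolynomial.Model.u n *
              TruncatedPolynomial.Model.x n ^ l)) =
            (-((k : ℤ) + 1) * n - k + l) •
              Φ (TruncatedPolynomial.Model.t n ^ k * TruncatedPolynomial.Model.x n ^ l) := by
  open TruncatedPolynomial in
    refine ⟨bvHom n, isInducedBy_bvHom n, isBVAlgebra m n, modelEquiv n,
      ⟨constHom n (gen n), isXBar_const n, modelHom_x⟩, ⟨uCocycle n, isUBar_ubar n, modelHom_u⟩,
      ⟨tCocycle n, isTBar_tbar n, modelHom_t⟩, modelHom_x.symm ▸ xClass_mem_degree m n,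
      modelHom_u.symm ▸ uClass_mem_degree m n, modelHom_t.symm ▸ tClass_mem_degree m n,
      fun k l => ?_, fun k l => ?_⟩
    · change bvHom n (modelHom n (evenMono n k l)) = 0
      rw [bvHom_modelHom, bvModel_evenMono, map_zero]
    · change bvHom n (modelHom n (oddMono n k l)) = _ • modelHom n (evenMono n k l)
      rw [bvHom_modelHom, bvModel_oddMono, map_zsmul]
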